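/- Let $0<\beta\le 1$, $\mu>0$, $\alpha>1$, $\gamma\ge 0$, $0<\kappa<1$ and $w\ne 0$. Write $E_\beta(z)=\sum_{k\ge 0} z^k/\Gamma(\beta k+1)$ for the Mittag-Leffler function and consider the one-dimensional fractional Riesz–Bessel equation $$\partial_t^\beta u(t,x)=-\mu\,(I-\Delta)^{\gamma/2}(-\Delta)^{\alpha/2}u(t,x),\quad t>0,\ x\in\mathbb R,\qquad u(0,x)=\eta(x),$$ where $\partial_t^\beta$ is the Caputo–Djrbashian derivative and $\eta$ is a measurable, stationary, zero-mean, real Gaussian process with covariance function $$\operatorname{Cov}(\eta(x),\eta(y))=\frac{\cos(w(x-y))}{(1+(x-y)^2)^{\kappa/2}},\qquad x,y\in\mathbb R.$$ Let $G(t,x)$, $t>0$, be the Green function of the equation, that is, the inverse Fourier transform of $\lambda\mapsto E_\beta\big(-\mu|\lambda|^\alpha(1+\lambda^2)^{\gamma/2}t^\beta\big)$. Then $G(t,\cdot)$ is integrable with $\int_{\mathbb R}G(t,x)e^{ix\lambda}\,dx=\widehat G(t,\lambda):=E_\beta\big(-\mu|\lambda|^\alpha(1+\lambda^2)^{\gamma/2}t^\beta\big)$,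 for every $\lambda$ the function $\widehat G(\cdot,\lambda)$ solves $\partial_t^\beta \widehat G=-\mu|\lambda|^\alpha(1+\lambda^2)^{\gamma/2}\widehat G$, $\widehat G(0,\lambda)=1$, and the integral defining the Green function solution $$u(t,x)=\int_{\mathbb R}G(t,x-y)\,\eta(y)\,dy,\qquad t>0,\ x\in\mathbb R,$$ converges almost surely for all $t>0$ and $x\in\mathbb R$. As $\varepsilon\to 0+$, the finite-dimensional distributions of the random fields $$U_\varepsilon(t,x)=\varepsilon^{-\beta/(2\alpha)}\,u\!\left(\frac t\varepsilon,\frac x{\varepsilon^{\beta/\alpha}}\right),\qquad t>0,\ x\in\mathbb R,$$ converge weakly to those of the real-valued zero-mean Gaussian random field $$U_0(t,x)=\sqrt{\frac{c_2(\kappa)}{|w|^{1-\kappa}}\bigl(1-\theta_\kappa(|w|)\bigr)}\int_{\mathbb R}e^{i\lambda x}E_\beta\bigl(-\mu t^\beta|\lambda|^\alpha\bigr)\,W(d\lambda),$$ where $W$ is a complex Gaussian white noise random measure on $\mathbb R$ (zero mean, $\mathbb E\,W(A)\overline{W(B)}=|A\cap B|$, $W(-A)=\overline{W(A)}$). Its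 covariance function is $$\operatorname{Cov}(U_0(t,x),U_0(t',x'))=\frac{2c_2(\kappa)\bigl(1-\theta_\kappa(|w|)\bigr)}{|w|^{1-\kappa}}\int_0^\infty\cos(\lambda(x-x'))\,E_\beta(-\mu t^\beta\lambda^\alpha)\,E_\beta(-\mu t'^\beta\lambda^\alpha)\,d\lambda ,$$ the integral being absolutely convergent. Here $$c_1(\kappa)=\frac{2^{(1-\kappa)/2}}{\sqrt\pi\,\Gamma(\kappa/2)},\qquad c_2(\kappa)=\frac1{2\Gamma(\kappa)\cos(\kappa\pi/2)},\qquad 1-\theta_\kappa(u)=\frac{c_1(\kappa)}{c_2(\kappa)}\,K_{\frac{\kappa-1}2}(u)\,u^{\frac{1-\kappa}2}\quad(u>0),$$ and $K_\nu(z)=\frac12\int_0^\infty s^{\nu-1}\exp\!\big(-\tfrac12(s+\tfrac1s)z\big)\,ds$ is the modified Bessel function of the second kind. -/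

import Mathlib

open MeasureTheory ProbabilityTheory Filter Topology

noncomputable section

/-- The Mittag-Leffler function `E_β(z) = ∑ₖ zᵏ / Γ(βk + 1)` (for real `z`). -/
def mittagLeffler (β z : ℝ) : ℝ :=
  ∑' k : ℕ, z ^ k / Real.Gamma (β * k + 1)

/-- The Fourier symbol `μ |l|^α (1 + l²)^(γ/2)` of the operator `μ (I - Δ)^(γ/2) (-Δ)^(α/2)`
on the line. -/
def frbeSymbol (μ α γ l : ℝ) : ℝ :=
  μ * (|l| ^ α * (1 + l ^ 2) ^ (γ / 2))

/-- The spatial Fourier transform of the Green function,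
`E_β(-μ |l|^α (1 + l²)^(γ/2) t^β)`. -/
def greenFourier (β μ α γ t l : ℝ) : ℝ :=
  mittagLeffler β (-(frbeSymbol μ α γ l * t ^ β))

/-- The Green function `G(t, x)` of `∂_t^β + μ (I - Δ)^(γ/2) (-Δ)^(α/2)` on the line: the inverse
Fourier transform of `greenFourier` (which is even in `l`, so that the exponential
`e^{-ilx}` reduces to a cosine). -/
def greenFunction (β μ α γ t x : ℝ) : ℝ :=
  (2 * Real.pi)⁻¹ * ∫ l : ℝ, Real.cos (l * x) * greenFourier β μ α γ t l

/-- `v` has Caputo-Djrbashian derivative `d` of order `β ∈ (0, 1]` at the time `t`, that is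
`d = Γ(1-β)⁻¹ (d/dt ∫₀ᵗ v(τ) (t-τ)^(-β) dτ - v(0) t^(-β))` for `β < 1` and `d = v'(t)` for
`β = 1`; the differentiability is part of the definition. -/
def HasCaputoDerivAt (β : ℝ) (v : ℝ → ℝ) (d t : ℝ) : Prop :=
  if β = 1 then HasDerivAt v d t
  else HasDerivAt (fun s : ℝ => ∫ τ in (0 : ℝ)..s, v τ / (s - τ) ^ β)
    (Real.Gamma (1 - β) * d + v 0 / t ^ β) t

/-- `G` is the Green function of `∂_t^β + μ (I - Δ)^(γ/2) (-Δ)^(α/2)`: its spatial Fourier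
transform exists, is `greenFourier`, and solves the Fourier transformed equation with initial
value `1` (the Fourier transform of the Dirac mass). -/
structure IsGreenFunction (β μ α γ : ℝ) (G : ℝ → ℝ → ℝ) : Prop where
  integrable : ∀ t : ℝ, 0 < t → Integrable (G t)
  fourier : ∀ t : ℝ, 0 < t → ∀ l : ℝ,
    ∫ x : ℝ, (G t x : ℂ) * Complex.exp (Complex.I * x * l) = (greenFourier β μ α γ t l : ℂ)
  initial : ∀ l : ℝ, greenFourier β μ α γ 0 l = 1
  equation : ∀ l t : ℝ, 0 < t →
    HasCaputoDerivAt β (fun s => greenFourier β μ α γ s l)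
      (-(frbeSymbol μ α γ l * greenFourier β μ α γ t l)) t

/-- The Green function solution `u(t, x) = ∫ G(t, x - y) η(y) dy` of the initial value problem
with the random initial condition `η`. -/
def frbeSolution {Ω : Type*} (β μ α γ : ℝ) (η : ℝ → Ω → ℝ) (t x : ℝ) (ω : Ω) : ℝ :=
  ∫ y : ℝ, greenFunction β μ α γ t (x - y) * η y ω

/-- The rescaled field `ε^(-β/(2α)) u(t/ε, x/ε^(β/α))`. -/
def rescaledSolution {Ω : Type*} (β μ α γ : ℝ) (η : ℝ → Ω → ℝ) (ε t x : ℝ) (ω : Ω) : ℝ :=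
  (ε ^ (β / (2 * α)))⁻¹ * frbeSolution β μ α γ η (t / ε) (x / ε ^ (β / α)) ω

/-- The cyclic long-range dependent covariance function `cos(wx) / (1 + x²)^(κ/2)`. -/
def cyclicCov (κ w x : ℝ) : ℝ :=
  Real.cos (w * x) / (1 + x ^ 2) ^ (κ / 2)

/-- `η` is a measurable zero-mean Gaussian process on the line, with the stationary covariance
function `cyclicCov κ w`. -/
structure IsCyclicInitialCondition {Ω : Type*} [MeasurableSpace Ω] (P : Measure Ω)
    (κ w : ℝ) (η : ℝ → Ω → ℝ) : Prop where
  measurable : Measurable (Function.uncurry η)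
  gaussian : IsGaussianProcess η P
  mean_zero : ∀ x : ℝ, ∫ ω, η x ω ∂P = 0
  cov_eq : ∀ x y : ℝ, covariance (η x) (η y) P = cyclicCov κ w (x - y)

/-- The modified Bessel function of the second kind,
`K_ν(z) = ½ ∫₀^∞ s^(ν-1) exp(-½ (s + 1/s) z) ds` for `z > 0`. -/
def besselK (ν z : ℝ) : ℝ :=
  (1 / 2) * ∫ s in Set.Ioi (0 : ℝ), s ^ (ν - 1) * Real.exp (-(1 / 2) * (s + 1 / s) * z)

/-- `c₁(κ) = 2^((1-κ)/2) / (√π Γ(κ/2))`. -/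
def c₁ (κ : ℝ) : ℝ :=
  2 ^ ((1 - κ) / 2) / (√Real.pi * Real.Gamma (κ / 2))

/-- `c₂(κ) = (2 Γ(κ) cos(κπ/2))⁻¹`. -/
def c₂ (κ : ℝ) : ℝ :=
  (2 * Real.Gamma κ * Real.cos (κ * Real.pi / 2))⁻¹

/-- The function `θ_κ`, given by `1 - θ_κ(u) = (c₁(κ) / c₂(κ)) K_{(κ-1)/2}(u) u^((1-κ)/2)`, so
that `c₂(κ) (1 - θ_κ(|l|)) / |l|^(1-κ)` is the spectral density of `(1 + x²)^(-κ/2)`. -/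
def theta (κ u : ℝ) : ℝ :=
  1 - c₁ κ / c₂ κ * besselK ((κ - 1) / 2) u * u ^ ((1 - κ) / 2)

/-- The constant `c₂(κ) (1 - θ_κ(|w|)) / |w|^(1-κ)`. -/
def limitConst (κ w : ℝ) : ℝ :=
  c₂ κ / |w| ^ (1 - κ) * (1 - theta κ |w|)

/-- The index sets of a white noise on the line: Borel sets of finite Lebesgue measure. -/
abbrev FiniteBorel : Type :=
  {A : Set ℝ // MeasurableSet A ∧ volume A < ⊤}

/-- `W` is a complex Gaussian white noise random measure on the line, with Lebesgue control measure
and the symmetry `W(-A) = conj W(A)` under which the integrals of functions with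
`h(-l) = conj h(l)` are real. (Additivity follows from the covariance.) -/
structure IsWhiteNoise {Ω : Type*} [MeasurableSpace Ω] (P : Measure Ω)
    (W : Set ℝ → Ω → ℂ) : Prop where
  gaussian : IsGaussianProcess (fun A : FiniteBorel => W A.1) P
  mean_zero : ∀ A : FiniteBorel, ∫ ω, W A.1 ω ∂P = 0
  cov_eq : ∀ A B : FiniteBorel,
    ∫ ω, W A.1 ω * (starRingEnd ℂ) (W B.1 ω) ∂P = ((volume (A.1 ∩ B.1)).toReal : ℂ)
  symm : ∀ A : FiniteBorel,
    ∀ᵐ ω ∂P, W ((fun l : ℝ => -l) ⁻¹' A.1) ω = (starRingEnd ℂ) (W A.1 ω)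

/-- The integral `∑_z z W(s = z)` of a simple function `s` with respect to `W`. -/
def simpleIntegral {Ω : Type*} (W : Set ℝ → Ω → ℂ) (s : SimpleFunc ℝ ℂ) (ω : Ω) : ℂ :=
  ∑ z ∈ s.range, z * W (s ⁻¹' {z}) ω

/-- `X = ∫ h(l) W(dl)`: the random variable `X` is the mean-square limit of the integrals of
square integrable simple functions that converge to `h` in `L²(ℝ)`. -/
def IsWienerIntegral {Ω : Type*} [MeasurableSpace Ω] (P : Measure Ω)
    (W : Set ℝ → Ω → ℂ) (h : ℝ → ℂ) (X : Ω → ℂ) : Prop :=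
  MemLp h 2 volume ∧ MemLp X 2 P ∧ ∃ s : ℕ → SimpleFunc ℝ ℂ,
    (∀ n, MemLp (s n) 2 volume) ∧
    Tendsto (fun n => eLpNorm (fun l => s n l - h l) 2 volume) atTop (𝓝 0) ∧
    Tendsto (fun n => eLpNorm (fun ω => simpleIntegral W (s n) ω - X ω) 2 P) atTop (𝓝 0)

end

/-!
If the covariance of the initial condition has an integrable spectral density `f`, then the
solution has the covariance
`Cov(u(t, x), u(t', x')) = ∫ cos(l (x - x')) Ĝ(t, l) Ĝ(t', l) f(l) dl`. Under the scaling
`t ↦ t / ε`, `x ↦ x / ε^(β/α)` only frequencies of order `ε^(β/α)` survive: there the Bessel factor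
`(1 + l²)^(γ/2)` tends to `1`, and `f` enters only through `f(0)`, so the covariances converge to
those of `√f(0) ∫ e^{ilx} E_β(-μ t^β |l|^α) W(dl)`. Centred Gaussian vectors converge in
distribution as soon as their covariance matrices do.

The Green function is integrable because two integrations by parts bound it by a multiple of `x⁻²`.
This rests on the complete monotonicity of `x ↦ E_β(-x)`, whose moments `k! / Γ(βk + 1)` are limits
of moments of products of independent mixtures of a Dirac mass and a Beta distribution, and on the
decay of its derivatives, which monotonicity extracts from the fractional relaxation equation.

The covariance `cos(wx) (1 + x²)^(-κ/2)` is, up to the cosine, a Gamma mixture of Gaussians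
`e^{-s x²}`. Its spectral density is the same mixture of their Fourier transforms, a Bessel function
`K_{(κ-1)/2}` shifted to `±w`, and is continuous at `0` since `w ≠ 0`.
-/

section ExponentialSeries

/-- The exponential generating series `∑ₖ aₖ (-x)ᵏ / k!`. The sign turns a moment sequence into the
Laplace transform of its measure. -/
noncomputable def expSeries (a : ℕ → ℝ) (x : ℝ) : ℝ :=
  ∑' k : ℕ, a k * ((-x) ^ k / k.factorial)

/-- The exponential generating series of `a` converges absolutely on the whole line. -/
def EntireSeq (a : ℕ → ℝ) : Prop :=
  ∀ x : ℝ, 0 ≤ x → Summable fun k : ℕ => |a k| * (x ^ k / k.factorial)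

lemma norm_expSeries_term (a x : ℝ) (k : ℕ) :
    ‖a * ((-x) ^ k / k.factorial)‖ = |a| * (|x| ^ k / k.factorial) := by
  simp only [norm_mul, norm_div, norm_pow, norm_neg, Real.norm_eq_abs, Nat.abs_cast]

lemma expSeries_zero (a : ℕ → ℝ) : expSeries a 0 = a 0 := by
  rw [expSeries, tsum_eq_single 0 fun k hk => by simp [hk]]
  simp

namespace EntireSeq

variable {a b : ℕ → ℝ}

lemma hasSum (h : EntireSeq a) (x : ℝ) :
    HasSum (fun k : ℕ => a k * ((-x) ^ k / k.factorial)) (expSeries a x) :=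
  (Summable.of_norm ((h |x| (abs_nonneg x)).congr fun k => (norm_expSeries_term _ x k).symm)).hasSum

lemma mono (h : EntireSeq a) (hba : ∀ k, |b k| ≤ |a k|) : EntireSeq b := fun x hx =>
  Summable.of_nonneg_of_le (fun k => by positivity)
    (fun k => mul_le_mul_of_nonneg_right (hba k) (by positivity)) (h x hx)

lemma summable_deriv (h : EntireSeq a) {x : ℝ} (hx : 0 ≤ x) :
    Summable fun k : ℕ => |a k| * (k * x ^ (k - 1) / k.factorial) := by
  refine Summable.of_nonneg_of_le (fun k => by positivity) (fun k => ?_)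
    (h (2 * (x + 1)) (by positivity))
  have hk : (k : ℝ) ≤ 2 ^ k := by exact_mod_cast Nat.lt_two_pow_self.le
  have hpow : x ^ (k - 1) ≤ (x + 1) ^ k :=
    (pow_le_pow_left₀ hx (by linarith) _).trans
      (pow_le_pow_right₀ (by linarith) (Nat.sub_le k 1))
  rw [mul_pow]
  gcongr

lemma succ (h : EntireSeq a) : EntireSeq fun k => a (k + 1) := fun x hx => by
  refine ((summable_nat_add_iff 1).2 (h.summable_deriv hx)).congr fun k => ?_
  rw [Nat.factorial_succ]
  push_cast
  field_simp

lemma add_right (h : EntireSeq a) (j : ℕ) : EntireSeq fun k => a (k + j) := by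
  induction j with
  | zero => exact h
  | succ j ih => simpa only [add_assoc, add_comm 1 j] using ih.succ

lemma tsum_deriv_eq (h : EntireSeq a) (x : ℝ) :
    ∑' k : ℕ, a k * (k * (-x) ^ (k - 1) * (-1) / k.factorial)
      = -expSeries (fun k => a (k + 1)) x := by
  have hs : Summable fun k : ℕ => a k * (k * (-x) ^ (k - 1) * (-1) / k.factorial) :=
    Summable.of_norm ((h.summable_deriv (abs_nonneg x)).congr fun k => by simp)
  rw [hs.tsum_eq_zero_add, expSeries, ← tsum_neg]
  simp only [CharP.cast_eq_zero, zero_mul, zero_div, mul_zero, zero_add]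
  refine tsum_congr fun k => ?_
  rw [Nat.factorial_succ]
  push_cast
  field_simp

lemma hasDerivAt_expSeries (h : EntireSeq a) (x : ℝ) :
    HasDerivAt (expSeries a) (-expSeries (fun k => a (k + 1)) x) x := by
  rw [← h.tsum_deriv_eq]
  refine hasDerivAt_tsum_of_isPreconnected (h.summable_deriv (x := |x| + 1) (by positivity))
    (g := fun (k : ℕ) (y : ℝ) => a k * ((-y) ^ k / k.factorial))
    (g' := fun (k : ℕ) (y : ℝ) => a k * (k * (-y) ^ (k - 1) * (-1) / k.factorial))
    (t := Metric.ball 0 (|x| + 1)) (y₀ := 0) Metric.isOpen_ball (convex_ball 0 _).isPreconnected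
    (fun k y _ => (((hasDerivAt_neg y).pow k).div_const _).const_mul _) (fun k y hy => ?_)
    (Metric.mem_ball_self (by positivity)) (h.hasSum 0).summable (by simp)
  have hy' : |y| ≤ |x| + 1 := (mem_ball_zero_iff.1 hy).le
  simp only [norm_mul, norm_div, Real.norm_eq_abs, abs_pow, abs_neg, abs_one, mul_one,
    Nat.abs_cast]
  gcongr

lemma continuous_expSeries (h : EntireSeq a) : Continuous (expSeries a) :=
  continuous_iff_continuousAt.2 fun x => (h.hasDerivAt_expSeries x).continuousAt

lemma div_add (h : EntireSeq a) (m : ℕ) : EntireSeq fun k => a k / (m + 1 + k) :=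
  h.mono fun k => by
    rw [abs_div, abs_of_pos (by positivity : (0 : ℝ) < m + 1 + k)]
    exact div_le_self (abs_nonneg _) (by linarith [m.cast_nonneg (α := ℝ), k.cast_nonneg (α := ℝ)])

/-- `1 / (m + 1 + k)` is the `k`-th moment of the measure `sᵐ ds` on `[0, 1]`. -/
lemma expSeries_div_add (h : EntireSeq a) (m : ℕ) (x : ℝ) :
    expSeries (fun k => a k / (m + 1 + k)) x = ∫ s in (0 : ℝ)..1, s ^ m * expSeries a (s * x) := by
  have hsum := intervalIntegral.hasSum_integral_of_dominated_convergence (μ := volume)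
    (a := (0 : ℝ)) (b := 1)
    (F := fun (k : ℕ) (s : ℝ) => s ^ m * (a k * ((-(s * x)) ^ k / k.factorial)))
    (f := fun s => s ^ m * expSeries a (s * x))
    (fun k _ => |a k| * (|x| ^ k / k.factorial))
    (fun k => by fun_prop) (fun k => .of_forall fun s hs => ?_)
    (.of_forall fun _ _ => h |x| (abs_nonneg x)) intervalIntegrable_const
    (.of_forall fun s _ => (h.hasSum (s * x)).mul_left _)
  · refine ((h.div_add m).hasSum x).unique (hsum.congr_fun fun k => ?_)
    have hint : ∫ s in (0 : ℝ)..1, s ^ (m + k) = 1 / (m + 1 + k) := by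
      rw [integral_pow]
      push_cast
      simp [add_right_comm]
    rw [div_mul_eq_mul_div, ← mul_one_div, ← hint, mul_comm,
      ← intervalIntegral.integral_mul_const]
    refine intervalIntegral.integral_congr fun s _ => ?_
    simp only [pow_add, ← mul_neg, mul_pow]
    ring
  · rw [Set.uIoc_of_le zero_le_one] at hs
    have hs0 : 0 ≤ s := hs.1.le
    have hsx : |s * x| ≤ |x| := by
      rw [abs_mul, abs_of_nonneg hs0]
      exact mul_le_of_le_one_left (abs_nonneg x) hs.2
    rw [norm_mul, norm_expSeries_term, norm_pow, Real.norm_of_nonneg hs0]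
    refine (mul_le_of_le_one_left (by positivity) (pow_le_one₀ hs0 hs.2)).trans ?_
    gcongr

lemma expSeries_div_add_nonneg (h : EntireSeq a) (ha : ∀ x, 0 ≤ x → 0 ≤ expSeries a x) (m : ℕ)
    {x : ℝ} (hx : 0 ≤ x) : 0 ≤ expSeries (fun k => a k / (m + 1 + k)) x := by
  rw [h.expSeries_div_add]
  exact intervalIntegral.integral_nonneg zero_le_one fun s hs =>
    mul_nonneg (pow_nonneg hs.1 m) (ha _ (mul_nonneg hs.1 hx))

end EntireSeq

/-- The function `expSeries a` is entire and completely monotone on the half line; its `j`-th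
derivative is `(-1)ʲ` times the series of the shifted sequence `a (· + j)`. -/
structure CompletelyMonotoneSeries (a : ℕ → ℝ) : Prop where
  entire : EntireSeq a
  nonneg : ∀ (j : ℕ) (x : ℝ), 0 ≤ x → 0 ≤ expSeries (fun k => a (k + j)) x

namespace CompletelyMonotoneSeries

variable {a : ℕ → ℝ}

lemma pow {c : ℝ} (hc : 0 ≤ c) : CompletelyMonotoneSeries fun k => c ^ k where
  entire := fun x _ => (Real.summable_pow_div_factorial (c * x)).congr fun k => by
    rw [abs_of_nonneg (by positivity), mul_pow, mul_div_assoc]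
  nonneg := fun j x _ => by
    have hexp : expSeries (fun k => c ^ (k + j)) x = c ^ j * Real.exp (-(c * x)) := by
      rw [expSeries, Real.exp_eq_exp_ℝ, NormedSpace.exp_eq_tsum_div, ← tsum_mul_left]
      refine tsum_congr fun k => ?_
      rw [← mul_neg, mul_pow, pow_add]
      ring
    rw [hexp]
    positivity

/-- The factor is the `k`-th moment of a mixture of the Dirac mass at `1` and a Beta distribution on
`[0, 1]`. -/
lemma mul_div_add (h : CompletelyMonotoneSeries a) {b : ℝ} (hb : 0 ≤ b) (hb' : b ≤ 1) (m : ℕ) :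
    CompletelyMonotoneSeries fun k => a k * ((m + 1 + b * k) / (m + 1 + k)) where
  entire := h.entire.mono fun k => by
    rw [abs_mul]
    refine mul_le_of_le_one_right (abs_nonneg _) ?_
    rw [abs_of_nonneg (by positivity), div_le_one (by positivity)]
    nlinarith [k.cast_nonneg (α := ℝ)]
  nonneg := fun j x hx => by
    have haj := h.entire.add_right j
    have hsplit : expSeries (fun k => a (k + j) *
          ((m + 1 + b * (k + j : ℕ)) / (m + 1 + (k + j : ℕ)))) x
        = b * expSeries (fun k => a (k + j)) x
          + (1 - b) * (m + 1) * expSeries (fun k => a (k + j) / ((m + j : ℕ) + 1 + k)) x := by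
      refine HasSum.tsum_eq ?_
      convert! ((haj.hasSum x).mul_left b).add
        (((haj.div_add (m + j)).hasSum x).mul_left ((1 - b) * (m + 1))) using 2 with k
      push_cast
      field_simp
      ring
    rw [hsplit]
    exact add_nonneg (mul_nonneg hb (h.nonneg j x hx))
      (mul_nonneg (mul_nonneg (sub_nonneg.2 hb') (by positivity))
        (haj.expSeries_div_add_nonneg (h.nonneg j) (m + j) hx))

lemma of_tendsto {A : ℕ → ℕ → ℝ} (ha : EntireSeq a) (hA : ∀ N, CompletelyMonotoneSeries (A N))
    (hle : ∀ᶠ N in atTop, ∀ k, |A N k| ≤ |a k|)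
    (hlim : ∀ k, Tendsto (fun N => A N k) atTop (𝓝 (a k))) : CompletelyMonotoneSeries a where
  entire := ha
  nonneg := fun j x hx => by
    refine ge_of_tendsto' (tendsto_tsum_of_dominated_convergence
      (ha.add_right j |x| (abs_nonneg x)) (fun k => (hlim (k + j)).mul_const _) ?_)
      fun N => (hA N).nonneg j x hx
    filter_upwards [hle] with N hN k
    rw [norm_expSeries_term]
    exact mul_le_mul_of_nonneg_right (hN _) (by positivity)

end CompletelyMonotoneSeries

end ExponentialSeries

section Gamma

lemma Gamma_mul_sub_one_rpow_le {a d : ℝ} (ha : 1 < a) (hd : 0 ≤ d) :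
    Real.Gamma a * (a - 1) ^ d ≤ Real.Gamma (a + d) := by
  rcases hd.eq_or_lt with rfl | hd'
  · simp
  have ha1 : 0 < a - 1 := by linarith
  have ha0 : 0 < a := by linarith
  have had : 0 < a + d := by linarith
  have hG := Real.Gamma_pos_of_pos ha0
  have hrec : Real.log (Real.Gamma a) = Real.log (a - 1) + Real.log (Real.Gamma (a - 1)) := by
    rw [← Real.log_mul ha1.ne' (Real.Gamma_pos_of_pos ha1).ne', ← Real.Gamma_add_one ha1.ne',
      sub_add_cancel]
  have hslope := Real.convexOn_log_Gamma.slope_mono_adjacent (x := a - 1) (y := a) (z := a + d)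
    ha1 had (by linarith) (by linarith)
  simp only [Function.comp_apply, hrec, sub_sub_cancel, div_one, add_sub_cancel_left,
    add_sub_cancel_right] at hslope
  rw [le_div_iff₀ hd', ← hrec] at hslope
  rw [← Real.log_le_log_iff (by positivity) (Real.Gamma_pos_of_pos had),
    Real.log_mul hG.ne' (by positivity), Real.log_rpow ha1]
  linarith

lemma prod_add_eq_Gamma_div {s : ℝ} (hs : 0 < s) (n : ℕ) :
    ∏ j ∈ Finset.range n, (s + j) = Real.Gamma (s + n) / Real.Gamma s := by
  induction n with
  | zero => simp [(Real.Gamma_pos_of_pos hs).ne']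
  | succ n ih =>
    rw [Finset.prod_range_succ, ih, Nat.cast_succ, ← add_assoc, Real.Gamma_add_one (by positivity)]
    ring

lemma summable_pow_div_Gamma {b c : ℝ} (hb : 0 < b) (hc : 0 < c) (A : ℝ) :
    Summable fun k : ℕ => A ^ k / Real.Gamma (b * k + c) := by
  refine summable_of_ratio_norm_eventually_le (r := 1 / 2) (by norm_num) ?_
  have hshift : Tendsto (fun k : ℕ => b * k + (c - 1)) atTop atTop :=
    tendsto_atTop_add_const_right _ _ (tendsto_natCast_atTop_atTop.const_mul_atTop hb)
  filter_upwards [hshift.eventually_gt_atTop 0,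
    ((tendsto_rpow_atTop hb).comp hshift).eventually_ge_atTop (2 * |A|)] with k hk hkA
  have hGamma := Gamma_mul_sub_one_rpow_le (a := b * k + c) (d := b) (by linarith) hb.le
  have hG : 0 < Real.Gamma (b * k + c) := Real.Gamma_pos_of_pos (by positivity)
  have hG' : 0 < Real.Gamma (b * k + c + b) := Real.Gamma_pos_of_pos (by positivity)
  rw [show b * (k + 1 : ℕ) + c = b * k + c + b by push_cast; ring]
  simp only [norm_div, norm_pow, Real.norm_eq_abs, abs_of_pos hG, abs_of_pos hG']
  rw [div_mul_div_comm, one_mul, div_le_div_iff₀ hG' (by positivity), pow_succ, mul_assoc]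
  refine mul_le_mul_of_nonneg_left ?_ (by positivity)
  calc |A| * (2 * Real.Gamma (b * k + c))
      = Real.Gamma (b * k + c) * (2 * |A|) := by ring
    _ ≤ Real.Gamma (b * k + c) * (b * k + c - 1) ^ b := by
        rw [add_sub_assoc]
        exact mul_le_mul_of_nonneg_left hkA hG.le
    _ ≤ Real.Gamma (b * k + c + b) := hGamma

end Gamma

section MittagLeffler

/-- The moments `k! / Γ(βk + 1)` of the Mittag-Leffler distribution, whose Laplace transform is
`x ↦ E_β(-x)`. -/
noncomputable def mlMoment (β : ℝ) (k : ℕ) : ℝ :=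
  k.factorial / Real.Gamma (β * k + 1)

/-- The Euler product approximations of `mlMoment β`, each the moment sequence of a product of
independent bounded random variables. -/
noncomputable def mlApprox (β : ℝ) (N k : ℕ) : ℝ :=
  ((N : ℝ) ^ (1 - β)) ^ k * ∏ j ∈ Finset.range (N + 1), (((j : ℝ) + 1 + β * k) / (j + 1 + k))

/-- The derivative of order `j` of `x ↦ E_β(-x)`, up to the sign `(-1)ʲ`. -/
noncomputable def mlDeriv (β : ℝ) (j : ℕ) (x : ℝ) : ℝ :=
  expSeries (fun k => mlMoment β (k + j)) x

lemma mittagLeffler_neg (β x : ℝ) : mittagLeffler β (-x) = expSeries (mlMoment β) x := by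
  refine tsum_congr fun k => ?_
  rw [mlMoment]
  field_simp

lemma mlDeriv_zero (β x : ℝ) : mlDeriv β 0 x = mittagLeffler β (-x) :=
  (mittagLeffler_neg β x).symm

lemma mittagLeffler_zero (β : ℝ) : mittagLeffler β 0 = 1 := by
  rw [← neg_zero, mittagLeffler_neg, expSeries_zero]
  simp [mlMoment]

lemma mittagLeffler_one (x : ℝ) : mittagLeffler 1 x = Real.exp x := by
  rw [mittagLeffler, Real.exp_eq_exp_ℝ, NormedSpace.exp_eq_tsum_div]
  simp only [one_mul, Real.Gamma_nat_eq_factorial]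

variable {β : ℝ}

lemma mlMoment_pos (hβ : 0 < β) (k : ℕ) : 0 < mlMoment β k :=
  div_pos (by positivity) (Real.Gamma_pos_of_pos (by positivity))

lemma entireSeq_mlMoment (hβ : 0 < β) : EntireSeq (mlMoment β) := fun x _ =>
  (summable_pow_div_Gamma hβ one_pos x).congr fun k => by
    rw [abs_of_pos (mlMoment_pos hβ k), mlMoment]
    field_simp

lemma completelyMonotoneSeries_mlApprox (hβ : 0 < β) (hβ' : β ≤ 1) (N : ℕ) :
    CompletelyMonotoneSeries (mlApprox β N) := by
  suffices h : ∀ n : ℕ, CompletelyMonotoneSeries fun k => ((N : ℝ) ^ (1 - β)) ^ k *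
      ∏ j ∈ Finset.range n, (((j : ℝ) + 1 + β * k) / (j + 1 + k)) from h (N + 1)
  intro n
  induction n with
  | zero =>
    simpa only [Finset.range_zero, Finset.prod_empty, mul_one] using
      CompletelyMonotoneSeries.pow (c := (N : ℝ) ^ (1 - β)) (by positivity)
  | succ n ih =>
    simp only [Finset.prod_range_succ, ← mul_assoc]
    exact ih.mul_div_add hβ.le hβ' n

lemma mlApprox_nonneg (hβ : 0 < β) (N k : ℕ) : 0 ≤ mlApprox β N k :=
  mul_nonneg (by positivity) (Finset.prod_nonneg fun j _ => by positivity)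

lemma mlApprox_eq_GammaSeq_div (hβ : 0 < β) {N : ℕ} (hN : N ≠ 0) (k : ℕ) :
    mlApprox β N k = Real.GammaSeq (k + 1) N / Real.GammaSeq (β * k + 1) N := by
  have hN' : (0 : ℝ) < N := by positivity
  have hpow : (N : ℝ) ^ ((k : ℝ) + 1) = ((N : ℝ) ^ (1 - β)) ^ k * (N : ℝ) ^ (β * k + 1) := by
    rw [← Real.rpow_mul_natCast hN'.le, ← Real.rpow_add hN']
    ring_nf
  have hprod : ∀ {s : ℝ}, 0 < s → ∏ j ∈ Finset.range (N + 1), (s + j) ≠ 0 := fun hs =>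
    Finset.prod_ne_zero_iff.2 fun j _ => by positivity
  have h₁ := hprod (s := k + 1) (by positivity)
  have h₂ := hprod (s := β * k + 1) (by positivity)
  rw [mlApprox, Finset.prod_div_distrib, Real.GammaSeq, Real.GammaSeq, hpow]
  simp only [add_right_comm _ (1 : ℝ), add_comm (_ : ℝ) (β * k), add_comm (_ : ℝ) (k : ℝ)] at *
  field_simp

lemma mlApprox_le_mlMoment (hβ : 0 < β) (hβ' : β ≤ 1) (N k : ℕ) :
    mlApprox β N k ≤ mlMoment β k := by
  have hk : 0 ≤ β * k := by positivity
  have hd : 0 ≤ (1 - β) * k := mul_nonneg (sub_nonneg.2 hβ') k.cast_nonneg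
  have hGamma := Gamma_mul_sub_one_rpow_le (a := β * k + 1 + (N + 1 : ℕ)) (d := (1 - β) * k)
    (by push_cast; linarith [N.cast_nonneg (α := ℝ)]) hd
  rw [show β * k + 1 + (N + 1 : ℕ) + (1 - β) * k = k + 1 + (N + 1 : ℕ) by ring] at hGamma
  have hle : ((N : ℝ) ^ (1 - β)) ^ k ≤ (β * k + 1 + (N + 1 : ℕ) - 1) ^ ((1 - β) * k) := by
    rw [← Real.rpow_mul_natCast N.cast_nonneg]
    exact Real.rpow_le_rpow N.cast_nonneg (by push_cast; linarith) hd
  have hG := Real.Gamma_pos_of_pos (show 0 < β * k + 1 by positivity)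
  have hGN := Real.Gamma_pos_of_pos (show 0 < β * k + 1 + (N + 1 : ℕ) by positivity)
  have hGN' := Real.Gamma_pos_of_pos (show (0 : ℝ) < k + 1 + (N + 1 : ℕ) by positivity)
  rw [mlApprox, Finset.prod_div_distrib]
  simp only [add_right_comm _ (1 : ℝ), add_comm (_ : ℝ) (β * k), add_comm (_ : ℝ) (k : ℝ)]
  simp only [add_right_comm _ _ (1 : ℝ)]
  rw [prod_add_eq_Gamma_div (by positivity), prod_add_eq_Gamma_div (by positivity), mlMoment,
    Real.Gamma_nat_eq_factorial, div_div_div_eq, mul_div_assoc',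
    div_le_div_iff₀ (mul_pos hG hGN') hG]
  calc _ = (k.factorial : ℝ) * Real.Gamma (β * k + 1) *
        (Real.Gamma (β * k + 1 + (N + 1 : ℕ)) * ((N : ℝ) ^ (1 - β)) ^ k) := by ring
    _ ≤ k.factorial * Real.Gamma (β * k + 1) * Real.Gamma (k + 1 + (N + 1 : ℕ)) := by
        gcongr
        exact (mul_le_mul_of_nonneg_left hle hGN.le).trans hGamma
    _ = _ := by ring

lemma tendsto_mlApprox (hβ : 0 < β) (k : ℕ) :
    Tendsto (fun N => mlApprox β N k) atTop (𝓝 (mlMoment β k)) := by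
  have hG := Real.Gamma_pos_of_pos (show 0 < β * k + 1 by positivity)
  rw [mlMoment, ← Real.Gamma_nat_eq_factorial]
  refine ((Real.GammaSeq_tendsto_Gamma _).div (Real.GammaSeq_tendsto_Gamma _) hG.ne').congr' ?_
  filter_upwards [eventually_ne_atTop 0] with N hN using (mlApprox_eq_GammaSeq_div hβ hN k).symm

/-- Pollard's theorem. -/
lemma completelyMonotoneSeries_mlMoment (hβ : 0 < β) (hβ' : β ≤ 1) :
    CompletelyMonotoneSeries (mlMoment β) :=
  .of_tendsto (entireSeq_mlMoment hβ) (completelyMonotoneSeries_mlApprox hβ hβ')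
    (.of_forall fun N k => by
      rw [abs_of_nonneg (mlApprox_nonneg hβ N k), abs_of_pos (mlMoment_pos hβ k)]
      exact mlApprox_le_mlMoment hβ hβ' N k)
    (tendsto_mlApprox hβ)

lemma hasDerivAt_mlDeriv (hβ : 0 < β) (j : ℕ) (x : ℝ) :
    HasDerivAt (mlDeriv β j) (-mlDeriv β (j + 1) x) x := by
  have h := ((entireSeq_mlMoment hβ).add_right j).hasDerivAt_expSeries x
  simp only [add_assoc, add_comm 1 j] at h
  exact h

lemma continuous_mlDeriv (hβ : 0 < β) (j : ℕ) : Continuous (mlDeriv β j) :=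
  ((entireSeq_mlMoment hβ).add_right j).continuous_expSeries

lemma mlDeriv_nonneg (hβ : 0 < β) (hβ' : β ≤ 1) (j : ℕ) {x : ℝ} (hx : 0 ≤ x) :
    0 ≤ mlDeriv β j x :=
  (completelyMonotoneSeries_mlMoment hβ hβ').nonneg j x hx

lemma antitoneOn_mlDeriv (hβ : 0 < β) (hβ' : β ≤ 1) (j : ℕ) :
    AntitoneOn (mlDeriv β j) (Set.Ici 0) := by
  refine antitoneOn_of_hasDerivWithinAt_nonpos (convex_Ici 0)
    (continuous_mlDeriv hβ j).continuousOn
    (fun y _ => (hasDerivAt_mlDeriv hβ j y).hasDerivWithinAt) fun y hy => ?_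
  rw [interior_Ici] at hy
  exact neg_nonpos.2 (mlDeriv_nonneg hβ hβ' _ (le_of_lt hy))

lemma mlDeriv_le_mlDeriv_zero (hβ : 0 < β) (hβ' : β ≤ 1) (j : ℕ) {x : ℝ} (hx : 0 ≤ x) :
    mlDeriv β j x ≤ mlDeriv β j 0 :=
  antitoneOn_mlDeriv hβ hβ' j Set.self_mem_Ici hx hx

lemma half_mul_mlDeriv_succ_le (hβ : 0 < β) (hβ' : β ≤ 1) (j : ℕ) {x : ℝ} (hx : 0 ≤ x) :
    x / 2 * mlDeriv β (j + 1) x ≤ mlDeriv β j (x / 2) := by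
  have hdiff := Convex.mul_sub_le_image_sub_of_le_deriv (convex_Icc (x / 2) x)
    (f := fun y => -mlDeriv β j y) (C := mlDeriv β (j + 1) x)
    (continuous_mlDeriv hβ j).neg.continuousOn
    (fun y _ => (hasDerivAt_mlDeriv hβ j y).neg.differentiableAt.differentiableWithinAt)
    (fun y hy => by
      rw [interior_Icc] at hy
      rw [(hasDerivAt_mlDeriv hβ j y).fun_neg.deriv, neg_neg]
      exact antitoneOn_mlDeriv hβ hβ' _ (Set.mem_Ici.2 (by linarith [hy.1])) hx hy.2.le)
    (x / 2) (Set.left_mem_Icc.2 (by linarith)) x (Set.right_mem_Icc.2 (by linarith)) (by linarith)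
  linarith [mlDeriv_nonneg hβ hβ' j hx]

end MittagLeffler

section FractionalIntegral

variable {β c s : ℝ}

lemma integral_rpow_mul_sub_rpow {u v s : ℝ} (hu : 0 < u) (hv : 0 < v) (hs : 0 < s) :
    ∫ x in (0 : ℝ)..s, x ^ (u - 1) * (s - x) ^ (v - 1)
      = s ^ (u + v - 1) * (Real.Gamma u * Real.Gamma v / Real.Gamma (u + v)) := by
  have hbeta := Complex.betaIntegral_scaled (u : ℂ) (v : ℂ) hs
  rw [Complex.betaIntegral_eq_Gamma_mul_div _ _ (by simpa) (by simpa), ← Complex.ofReal_add,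
    Complex.Gamma_ofReal, Complex.Gamma_ofReal, Complex.Gamma_ofReal] at hbeta
  have hcast : ∫ x in (0 : ℝ)..s, ((x ^ (u - 1) * (s - x) ^ (v - 1) : ℝ) : ℂ)
      = ∫ x in (0 : ℝ)..s, (x : ℂ) ^ ((u : ℂ) - 1) * ((s : ℂ) - x) ^ ((v : ℂ) - 1) := by
    refine intervalIntegral.integral_congr fun x hx => ?_
    rw [Set.uIcc_of_le hs.le] at hx
    have hx₁ := Complex.ofReal_cpow hx.1 (u - 1)
    have hx₂ := Complex.ofReal_cpow (sub_nonneg.2 hx.2) (v - 1)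
    push_cast at hx₁ hx₂ ⊢
    rw [hx₁, hx₂]
  have hscale := Complex.ofReal_cpow hs.le (u + v - 1)
  rw [intervalIntegral.integral_ofReal] at hcast
  rw [← hcast] at hbeta
  push_cast at hscale hbeta
  rw [← hscale] at hbeta
  exact_mod_cast hbeta

lemma integrableOn_rpow_mul_sub_rpow {u v s : ℝ} (hu : 0 < u) (hv : 0 < v) (hs : 0 < s) :
    IntegrableOn (fun x : ℝ => x ^ (u - 1) * (s - x) ^ (v - 1)) (Set.Ioc 0 s) := by
  refine not_imp_comm.1 integral_undef ?_
  rw [← intervalIntegral.integral_of_le hs.le, integral_rpow_mul_sub_rpow hu hv hs]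
  exact (mul_pos (Real.rpow_pos_of_pos hs _) (div_pos (mul_pos (Real.Gamma_pos_of_pos hu)
    (Real.Gamma_pos_of_pos hv)) (Real.Gamma_pos_of_pos (add_pos hu hv)))).ne'

lemma setIntegral_pow_div_Gamma_mul_sub_rpow (hβ : 0 < β) (hc : 0 < c) (hs : 0 < s) (A : ℝ)
    (k : ℕ) :
    ∫ τ in Set.Ioc 0 s, A ^ k / Real.Gamma (β * k + 1) * (τ ^ (β * k) * (s - τ) ^ (c - 1))
      = Real.Gamma c * (A ^ k * s ^ (β * k + c) / Real.Gamma (β * k + (1 + c))) := by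
  have hβk : 0 < β * k + 1 := by positivity
  have hbeta := integral_rpow_mul_sub_rpow hβk hc hs
  rw [add_sub_cancel_right, intervalIntegral.integral_of_le hs.le,
    add_right_comm, add_sub_cancel_right] at hbeta
  rw [integral_const_mul, hbeta, ← add_assoc, add_right_comm _ c]
  field_simp [(Real.Gamma_pos_of_pos hβk).ne']

lemma hasSum_integral_mittagLeffler (hβ : 0 < β) (hc : 0 < c) (L : ℝ) (hs : 0 < s) :
    HasSum
      (fun k : ℕ => Real.Gamma c * ((-L) ^ k * s ^ (β * k + c) / Real.Gamma (β * k + (1 + c))))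
      (∫ τ in (0 : ℝ)..s, mittagLeffler β (-(L * τ ^ β)) * (s - τ) ^ (c - 1)) := by
  have hint : ∀ k : ℕ, IntegrableOn (fun τ : ℝ => (-L) ^ k / Real.Gamma (β * k + 1) *
      (τ ^ (β * k) * (s - τ) ^ (c - 1))) (Set.Ioc 0 s) := fun k => by
    have h := integrableOn_rpow_mul_sub_rpow (show 0 < β * k + 1 by positivity) hc hs
    rw [add_sub_cancel_right] at h
    exact h.const_mul _
  have hnorm : ∀ k : ℕ, ∫ τ in Set.Ioc 0 s, ‖(-L) ^ k / Real.Gamma (β * k + 1) *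
      (τ ^ (β * k) * (s - τ) ^ (c - 1))‖
      = Real.Gamma c * s ^ c * ((|L| * s ^ β) ^ k / Real.Gamma (β * k + (1 + c))) := fun k => by
    rw [mul_pow, ← Real.rpow_mul_natCast hs.le]
    refine Eq.trans ?_ ((setIntegral_pow_div_Gamma_mul_sub_rpow hβ hc hs |L| k).trans
      (by rw [Real.rpow_add hs]; ring))
    refine setIntegral_congr_fun measurableSet_Ioc fun τ hτ => ?_
    simp only [norm_mul, norm_div, norm_pow, norm_neg, Real.norm_eq_abs]
    rw [abs_of_pos (Real.Gamma_pos_of_pos (by positivity)), abs_of_nonneg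
      (Real.rpow_nonneg hτ.1.le _), abs_of_nonneg (Real.rpow_nonneg (sub_nonneg.2 hτ.2) _)]
  have hsum := hasSum_integral_of_summable_integral_norm hint
    (((summable_pow_div_Gamma hβ (by linarith) (|L| * s ^ β)).mul_left
      (Real.Gamma c * s ^ c)).congr fun k => (hnorm k).symm)
  rw [intervalIntegral.integral_of_le hs.le]
  convert! hsum using 1
  · exact funext fun k => (setIntegral_pow_div_Gamma_mul_sub_rpow hβ hc hs (-L) k).symm
  · refine setIntegral_congr_fun measurableSet_Ioc fun τ hτ => ?_
    rw [mittagLeffler, ← tsum_mul_right]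
    refine tsum_congr fun k => ?_
    rw [← neg_mul, mul_pow, Real.rpow_mul_natCast hτ.1.le]
    ring

/-- The integrated form of the fractional relaxation equation `∂_t^β v = -L v`, `v(0) = 1`. -/
lemma integral_mittagLeffler_mul_sub_rpow (hβ : 0 < β) (hβ' : β < 1) (L : ℝ) (hs : 0 < s) :
    ∫ τ in (0 : ℝ)..s, mittagLeffler β (-(L * τ ^ β)) * (s - τ) ^ (-β)
      = s ^ (1 - β) / (1 - β)
        - Real.Gamma (1 - β) * L * ∫ τ in (0 : ℝ)..s, mittagLeffler β (-(L * τ ^ β)) := by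
  have hb : 0 < 1 - β := sub_pos.2 hβ'
  have hfrac := hasSum_integral_mittagLeffler hβ hb L hs
  have hone := hasSum_integral_mittagLeffler hβ one_pos L hs
  simp only [sub_self, Real.rpow_zero, mul_one, Real.Gamma_one, one_mul] at hone
  have hG := (Real.Gamma_pos_of_pos hb).ne'
  rw [show 1 - β - 1 = -β by ring] at hfrac
  rw [← hfrac.tsum_eq, hfrac.summable.tsum_eq_zero_add,
    sub_eq_add_neg (s ^ (1 - β) / (1 - β)), ← neg_mul, ← hone.tsum_eq, ← tsum_mul_left]
  congr 1
  · simp only [pow_zero, CharP.cast_eq_zero, mul_zero, zero_add, one_mul]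
    rw [add_comm (1 : ℝ) (1 - β), Real.Gamma_add_one hb.ne']
    field_simp
  · refine tsum_congr fun k => ?_
    push_cast
    rw [pow_succ, show β * ((k : ℝ) + 1) + (1 - β) = β * k + 1 by ring,
      show β * ((k : ℝ) + 1) + (1 + (1 - β)) = β * k + (1 + 1) by ring]
    ring

lemma continuous_mittagLeffler_neg (hβ : 0 < β) : Continuous fun x => mittagLeffler β (-x) := by
  simpa only [← mlDeriv_zero] using continuous_mlDeriv hβ 0

lemma continuous_mittagLeffler_neg_mul_rpow (hβ : 0 < β) (L : ℝ) :
    Continuous fun t : ℝ => mittagLeffler β (-(L * t ^ β)) :=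
  (continuous_mittagLeffler_neg hβ).comp (continuous_const.mul (Real.continuous_rpow_const hβ.le))

lemma hasDerivAt_exp_neg_mul (L t : ℝ) :
    HasDerivAt (fun s => Real.exp (-(L * s))) (-(L * Real.exp (-(L * t)))) t := by
  convert! ((hasDerivAt_id t).const_mul L).neg.exp using 1
  simp [mul_comm]

lemma hasDerivAt_integral_mittagLeffler_div_rpow (hβ : 0 < β) (hβ' : β < 1) (L : ℝ) {t : ℝ}
    (ht : 0 < t) :
    HasDerivAt (fun s : ℝ => ∫ τ in (0 : ℝ)..s, mittagLeffler β (-(L * τ ^ β)) / (s - τ) ^ β)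
      (t ^ (-β) - Real.Gamma (1 - β) * L * mittagLeffler β (-(L * t ^ β))) t := by
  have hcont := continuous_mittagLeffler_neg_mul_rpow hβ L
  have hint : HasDerivAt (fun s : ℝ => ∫ τ in (0 : ℝ)..s, mittagLeffler β (-(L * τ ^ β)))
      (mittagLeffler β (-(L * t ^ β))) t :=
    intervalIntegral.integral_hasDerivAt_right (hcont.intervalIntegrable _ _)
      hcont.stronglyMeasurable.stronglyMeasurableAtFilter hcont.continuousAt
  have hpow : HasDerivAt (fun s : ℝ => s ^ (1 - β) / (1 - β)) (t ^ (-β)) t := by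
    convert! (Real.hasDerivAt_rpow_const (p := 1 - β) (Or.inl ht.ne')).div_const (1 - β) using 1
    rw [sub_sub_cancel_left, mul_div_cancel_left₀ _ (sub_pos.2 hβ').ne']
  refine (hpow.sub (hint.const_mul (Real.Gamma (1 - β) * L))).congr_of_eventuallyEq ?_
  filter_upwards [lt_mem_nhds ht] with s hs
  rw [Pi.sub_apply, ← integral_mittagLeffler_mul_sub_rpow hβ hβ' L hs]
  refine intervalIntegral.integral_congr fun τ hτ => ?_
  rw [Set.uIcc_of_le hs.le] at hτ
  rw [Real.rpow_neg (sub_nonneg.2 hτ.2), div_eq_mul_inv]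

lemma hasCaputoDerivAt_mittagLeffler (hβ : 0 < β) (hβ' : β ≤ 1) (L : ℝ) {t : ℝ} (ht : 0 < t) :
    HasCaputoDerivAt β (fun s => mittagLeffler β (-(L * s ^ β)))
      (-(L * mittagLeffler β (-(L * t ^ β)))) t := by
  rcases hβ'.eq_or_lt with rfl | hβ1
  · simpa only [HasCaputoDerivAt, if_true, mittagLeffler_one, Real.rpow_one] using
      hasDerivAt_exp_neg_mul L t
  · rw [HasCaputoDerivAt, if_neg hβ1.ne]
    refine (hasDerivAt_integral_mittagLeffler_div_rpow hβ hβ1 L ht).congr_deriv ?_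
    rw [Real.zero_rpow hβ.ne', mul_zero, neg_zero, mittagLeffler_zero, Real.rpow_neg ht.le]
    ring

end FractionalIntegral

section Decay

variable {β : ℝ}

lemma mlDeriv_zero_le_integral (hβ : 0 < β) (hβ' : β ≤ 1) {x : ℝ} (hx : 0 ≤ x) :
    mlDeriv β 0 x ≤ ∫ τ in (0 : ℝ)..1, mittagLeffler β (-(x * τ ^ β)) := by
  have hmono : ∫ _ in (0 : ℝ)..1, mlDeriv β 0 x ≤
      ∫ τ in (0 : ℝ)..1, mittagLeffler β (-(x * τ ^ β)) := by
    refine intervalIntegral.integral_mono_on zero_le_one intervalIntegrable_const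
      ((continuous_mittagLeffler_neg_mul_rpow hβ x).intervalIntegrable _ _) fun τ hτ => ?_
    rw [← mlDeriv_zero]
    exact antitoneOn_mlDeriv hβ hβ' 0
      (mul_nonneg hx (Real.rpow_nonneg hτ.1 _)) hx
      (mul_le_of_le_one_right hx (Real.rpow_le_one hτ.1 hτ.2 hβ.le))
  simpa using hmono

lemma mul_mlDeriv_zero_le (hβ : 0 < β) (hβ' : β < 1) {x : ℝ} (hx : 0 ≤ x) :
    x * mlDeriv β 0 x ≤ 1 / (1 - β) / Real.Gamma (1 - β) := by
  have hG := Real.Gamma_pos_of_pos (sub_pos.2 hβ')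
  have hrelax := integral_mittagLeffler_mul_sub_rpow hβ hβ' x one_pos
  rw [Real.one_rpow] at hrelax
  have hnonneg : 0 ≤ ∫ τ in (0 : ℝ)..1, mittagLeffler β (-(x * τ ^ β)) * (1 - τ) ^ (-β) := by
    refine intervalIntegral.integral_nonneg zero_le_one fun τ hτ => ?_
    rw [← mlDeriv_zero]
    exact mul_nonneg (mlDeriv_nonneg hβ hβ'.le 0 (mul_nonneg hx (Real.rpow_nonneg hτ.1 _)))
      (Real.rpow_nonneg (sub_nonneg.2 hτ.2) _)
  rw [le_div_iff₀ hG]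
  calc x * mlDeriv β 0 x * Real.Gamma (1 - β)
      = Real.Gamma (1 - β) * x * mlDeriv β 0 x := by ring
    _ ≤ Real.Gamma (1 - β) * x * ∫ τ in (0 : ℝ)..1, mittagLeffler β (-(x * τ ^ β)) :=
        mul_le_mul_of_nonneg_left (mlDeriv_zero_le_integral hβ hβ'.le hx) (mul_nonneg hG.le hx)
    _ ≤ 1 / (1 - β) := by linarith

lemma exists_pow_succ_mul_mlDeriv_le (hβ : 0 < β) (hβ' : β ≤ 1) (j : ℕ) :
    ∃ C : ℝ, ∀ x : ℝ, 0 ≤ x → x ^ (j + 1) * mlDeriv β j x ≤ C := by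
  induction j with
  | zero =>
    simp only [zero_add, pow_one]
    rcases hβ'.eq_or_lt with rfl | hβ1
    · refine ⟨1, fun x _ => ?_⟩
      rw [mlDeriv_zero, mittagLeffler_one, Real.exp_neg, ← div_eq_mul_inv,
        div_le_one (Real.exp_pos x)]
      linarith [Real.add_one_le_exp x]
    · exact ⟨_, fun x hx => mul_mlDeriv_zero_le hβ hβ1 hx⟩
  | succ j ih =>
    obtain ⟨C, hC⟩ := ih
    refine ⟨2 ^ (j + 2) * C, fun x hx => ?_⟩
    calc x ^ (j + 1 + 1) * mlDeriv β (j + 1) x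
        = 2 ^ (j + 2) * ((x / 2) ^ (j + 1) * (x / 2 * mlDeriv β (j + 1) x)) := by
          rw [div_pow]; field_simp; ring
      _ ≤ 2 ^ (j + 2) * ((x / 2) ^ (j + 1) * mlDeriv β j (x / 2)) := by
          gcongr
          exact half_mul_mlDeriv_succ_le hβ hβ' j hx
      _ ≤ 2 ^ (j + 2) * C := by
          gcongr
          exact hC (x / 2) (div_nonneg hx zero_le_two)

lemma exists_mlDeriv_le (hβ : 0 < β) (hβ' : β ≤ 1) (j : ℕ) :
    ∃ C : ℝ, 0 < C ∧ ∀ x : ℝ, 0 ≤ x → mlDeriv β j x ≤ C ∧ x ^ (j + 1) * mlDeriv β j x ≤ C := by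
  obtain ⟨C, hC⟩ := exists_pow_succ_mul_mlDeriv_le hβ hβ' j
  refine ⟨max 1 (max C (mlDeriv β j 0)), by positivity, fun x hx => ⟨?_, ?_⟩⟩
  · exact (mlDeriv_le_mlDeriv_zero hβ hβ' j hx).trans (by simp)
  · exact (hC x hx).trans (by simp)

end Decay

section CosineTransform

variable {F F' F'' : ℝ → ℝ}

/-- The cosine transform `∫ cos(l x) F(l) dl` over the whole line, which for an even integrable
`F` is its Fourier transform, without the factor `2π` in the exponent that Mathlib puts there. -/
noncomputable def cosTransform (F : ℝ → ℝ) (x : ℝ) : ℝ :=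
  ∫ l : ℝ, Real.cos (l * x) * F l

lemma integrable_cos_mul {ν : Measure ℝ} (hF : Integrable F ν) (x : ℝ) :
    Integrable (fun l => Real.cos (l * x) * F l) ν :=
  hF.bdd_mul (c := 1) (by fun_prop) (.of_forall fun _ => Real.abs_cos_le_one _)

lemma abs_cos_mul_le (a b : ℝ) : |Real.cos a * b| ≤ |b| := by
  rw [abs_mul]
  exact mul_le_of_le_one_left (abs_nonneg b) (Real.abs_cos_le_one a)

lemma abs_cosTransform_le (hF : Integrable F) (x : ℝ) : |cosTransform F x| ≤ ∫ l, |F l| := by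
  rw [cosTransform, ← Real.norm_eq_abs]
  exact norm_integral_le_of_norm_le hF.abs (.of_forall fun _ => abs_cos_mul_le _ _)

lemma continuous_cosTransform (hF : Integrable F) : Continuous (cosTransform F) :=
  continuous_of_dominated (fun x => (integrable_cos_mul hF x).aestronglyMeasurable)
    (fun _ => .of_forall fun _ => abs_cos_mul_le _ _) hF.abs (.of_forall fun _ => by fun_prop)

lemma integral_even (heven : ∀ l, F (-l) = F l) :
    ∫ l, F l = 2 * ∫ l in Set.Ioi (0 : ℝ), F l := by
  rw [← integral_comp_abs]
  refine integral_congr_ae (.of_forall fun l => ?_)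
  rcases abs_choice l with h | h <;> simp only [h, heven]

lemma cosTransform_even (heven : ∀ l, F (-l) = F l) (x : ℝ) :
    cosTransform F x = 2 * ∫ l in Set.Ioi (0 : ℝ), Real.cos (l * x) * F l :=
  integral_even fun l => by rw [neg_mul, Real.cos_neg, heven]

lemma norm_exp_I_mul_mul (l θ : ℝ) : ‖Complex.exp (Complex.I * l * θ)‖ = 1 := by
  rw [show Complex.I * l * θ = ((l * θ : ℝ) : ℂ) * Complex.I by push_cast; ring,
    Complex.norm_exp_ofReal_mul_I]

lemma integrable_exp_mul (hF : Integrable F) (θ : ℝ) :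
    Integrable fun l : ℝ => Complex.exp (Complex.I * l * θ) * (F l : ℂ) :=
  hF.ofReal.bdd_mul (c := 1) (by fun_prop) (.of_forall fun l => (norm_exp_I_mul_mul l θ).le)

lemma integral_exp_mul_even (hF : Integrable F) (heven : ∀ l, F (-l) = F l) (θ : ℝ) :
    ∫ l : ℝ, Complex.exp (Complex.I * l * θ) * (F l : ℂ) = (cosTransform F θ : ℂ) := by
  set A := ∫ l : ℝ, Complex.exp (Complex.I * l * θ) * (F l : ℂ) with hA
  have hreflect : A = ∫ l : ℝ, Complex.exp (Complex.I * l * (-θ : ℝ)) * (F l : ℂ) := by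
    rw [hA, ← integral_neg_eq_self]
    simp only [heven, Complex.ofReal_neg, mul_neg, neg_mul]
  calc A = (1 / 2) * (A + ∫ l : ℝ, Complex.exp (Complex.I * l * (-θ : ℝ)) * (F l : ℂ)) := by
        rw [← hreflect]; ring
    _ = ∫ l : ℝ, ((Real.cos (l * θ) * F l : ℝ) : ℂ) := by
        rw [hA, ← integral_add (integrable_exp_mul hF θ) (integrable_exp_mul hF (-θ)),
          ← integral_const_mul]
        refine integral_congr_ae (.of_forall fun l => ?_)
        simp only
        push_cast
        rw [Complex.cos, show Complex.I * l * θ = l * θ * Complex.I by ring,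
          show Complex.I * l * -θ = -(l * θ) * Complex.I by ring]
        ring
    _ = (cosTransform F θ : ℂ) := integral_complex_ofReal

open scoped FourierTransform in
lemma fourier_ofReal_even (hF : Integrable F) (heven : ∀ l, F (-l) = F l) (ξ : ℝ) :
    𝓕 (fun l => (F l : ℂ)) ξ = (cosTransform F (2 * Real.pi * ξ) : ℂ) := by
  have hneg : cosTransform F (-(2 * Real.pi * ξ)) = cosTransform F (2 * Real.pi * ξ) := by
    simp only [cosTransform, mul_neg, Real.cos_neg]
  rw [← hneg, ← integral_exp_mul_even hF heven, Real.fourier_real_eq_integral_exp_smul]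
  refine integral_congr_ae (.of_forall fun l => ?_)
  simp only [smul_eq_mul]
  push_cast
  ring_nf

open scoped FourierTransform in
lemma integral_cosTransform_mul_exp (hF : Integrable F) (hFc : Continuous F)
    (heven : ∀ l, F (-l) = F l) (hcos : Integrable (cosTransform F)) (l : ℝ) :
    ∫ x : ℝ, (cosTransform F x : ℂ) * Complex.exp (Complex.I * x * l)
      = ((2 * Real.pi * F l : ℝ) : ℂ) := by
  have hpi : 0 < 2 * Real.pi := Real.two_pi_pos
  have hfourier := funext (fourier_ofReal_even hF heven)
  have hinv : 𝓕⁻ (𝓕 fun l => (F l : ℂ)) l = F l := by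
    refine congrFun ((Complex.continuous_ofReal.comp hFc).fourierInv_fourier_eq hF.ofReal ?_) l
    rw [Function.comp_def, hfourier]
    exact (hcos.comp_mul_left' hpi.ne').ofReal
  have hscale := Measure.integral_comp_mul_left
    (fun x : ℝ => (cosTransform F x : ℂ) * Complex.exp (Complex.I * x * l)) (2 * Real.pi)
  rw [abs_of_pos (inv_pos.2 hpi), eq_inv_smul_iff₀ hpi.ne'] at hscale
  rw [← hscale, Complex.ofReal_mul, ← hinv, Real.fourierInv_eq', hfourier, Complex.real_smul]
  congr 1
  refine integral_congr_ae (.of_forall fun ξ => ?_)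
  simp only [smul_eq_mul, RCLike.inner_apply, conj_trivial]
  push_cast
  ring_nf

lemma tendsto_cos_mul_zero {ν : Filter ℝ} {g : ℝ → ℝ} (hg : Tendsto g ν (𝓝 0)) (x : ℝ) :
    Tendsto (fun l => Real.cos (l * x) * g l) ν (𝓝 0) :=
  bdd_le_mul_tendsto_zero' 1 (.of_forall fun _ => Real.abs_cos_le_one _) hg

lemma tendsto_sin_mul_zero {g : ℝ → ℝ} (hg : Tendsto g atTop (𝓝 0)) (x : ℝ) :
    Tendsto (fun l => Real.sin (l * x) * g l) atTop (𝓝 0) :=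
  bdd_le_mul_tendsto_zero' 1 (.of_forall fun _ => Real.abs_sin_le_one _) hg

lemma hasDerivAt_sin_mul_add_cos_mul {x l : ℝ} (hx : x ≠ 0) (hF' : HasDerivAt F (F' l) l)
    (hF'' : HasDerivAt F' (F'' l) l) :
    HasDerivAt (fun l => x⁻¹ * (Real.sin (l * x) * F l) + (x ^ 2)⁻¹ * (Real.cos (l * x) * F' l))
      (Real.cos (l * x) * F l + (x ^ 2)⁻¹ * (Real.cos (l * x) * F'' l)) l := by
  have hsin := (hasDerivAt_mul_const x (x := l)).sin
  have hcos := (hasDerivAt_mul_const x (x := l)).cos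
  refine (((hsin.mul hF').const_mul x⁻¹).add ((hcos.mul hF'').const_mul (x ^ 2)⁻¹)).congr_deriv ?_
  field_simp
  ring

-- Two integrations by parts at once: the boundary terms are those of the primitive
-- `sin(l x) F(l) / x + cos(l x) F'(l) / x²` of `cos(l x) (F(l) + F''(l) / x²)`.
lemma integral_Ioi_cos_mul_eq_neg {a x : ℝ} (hx : x ≠ 0)
    (hF' : ∀ l ∈ Set.Ioi (0 : ℝ), HasDerivAt F (F' l) l)
    (hF'' : ∀ l ∈ Set.Ioi (0 : ℝ), HasDerivAt F' (F'' l) l)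
    (hint : IntegrableOn F (Set.Ioi 0)) (hint'' : IntegrableOn F'' (Set.Ioi 0))
    (hF_zero : Tendsto F (𝓝[>] 0) (𝓝 a)) (hF'_zero : Tendsto F' (𝓝[>] 0) (𝓝 0))
    (hF_top : Tendsto F atTop (𝓝 0)) (hF'_top : Tendsto F' atTop (𝓝 0)) :
    ∫ l in Set.Ioi (0 : ℝ), Real.cos (l * x) * F l
      = -((x ^ 2)⁻¹ * ∫ l in Set.Ioi (0 : ℝ), Real.cos (l * x) * F'' l) := by
  have hsin_zero : Tendsto (fun l => Real.sin (l * x) * F l) (𝓝[>] 0) (𝓝 0) := by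
    have hsin : Continuous fun l : ℝ => Real.sin (l * x) := by fun_prop
    simpa using ((hsin.tendsto 0).mono_left nhdsWithin_le_nhds).mul hF_zero
  have hzero : Tendsto (fun l => x⁻¹ * (Real.sin (l * x) * F l)
      + (x ^ 2)⁻¹ * (Real.cos (l * x) * F' l)) (𝓝[>] 0) (𝓝 0) := by
    simpa using (hsin_zero.const_mul x⁻¹).add
      ((tendsto_cos_mul_zero hF'_zero x).const_mul (x ^ 2)⁻¹)
  have htop : Tendsto (fun l => x⁻¹ * (Real.sin (l * x) * F l)
      + (x ^ 2)⁻¹ * (Real.cos (l * x) * F' l)) atTop (𝓝 0) := by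
    simpa using ((tendsto_sin_mul_zero hF_top x).const_mul x⁻¹).add
      ((tendsto_cos_mul_zero hF'_top x).const_mul (x ^ 2)⁻¹)
  have hcosF := integrable_cos_mul hint x
  have hcosF'' := (integrable_cos_mul hint'' x).const_mul (x ^ 2)⁻¹
  have hparts := integral_Ioi_deriv_mul_eq_sub (v := fun _ => 1) (v' := fun _ => 0)
    (fun l hl => hasDerivAt_sin_mul_add_cos_mul hx (hF' l hl) (hF'' l hl))
    (fun l _ => hasDerivAt_const l 1)
    ((hcosF.add hcosF'').congr (.of_forall fun l => by simp))
    (hzero.congr fun l => by simp) (htop.congr fun l => by simp)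
  simp only [mul_one, mul_zero, add_zero, sub_zero] at hparts
  rw [integral_add hcosF hcosF'', integral_const_mul] at hparts
  exact eq_neg_of_add_eq_zero_left hparts

lemma sq_mul_abs_cosTransform_le {a : ℝ} (heven : ∀ l, F (-l) = F l)
    (hF' : ∀ l ∈ Set.Ioi (0 : ℝ), HasDerivAt F (F' l) l)
    (hF'' : ∀ l ∈ Set.Ioi (0 : ℝ), HasDerivAt F' (F'' l) l)
    (hint : Integrable F) (hint'' : IntegrableOn F'' (Set.Ioi 0))
    (hF_zero : Tendsto F (𝓝[>] 0) (𝓝 a)) (hF'_zero : Tendsto F' (𝓝[>] 0) (𝓝 0))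
    (hF_top : Tendsto F atTop (𝓝 0)) (hF'_top : Tendsto F' atTop (𝓝 0)) (x : ℝ) :
    x ^ 2 * |cosTransform F x| ≤ 2 * ∫ l in Set.Ioi (0 : ℝ), |F'' l| := by
  have hnonneg : 0 ≤ ∫ l in Set.Ioi (0 : ℝ), |F'' l| := integral_nonneg fun l => abs_nonneg _
  rcases eq_or_ne x 0 with rfl | hx
  · simpa using hnonneg
  have hx2 : 0 < x ^ 2 := sq_pos_of_ne_zero hx
  have hbound : |∫ l in Set.Ioi (0 : ℝ), Real.cos (l * x) * F'' l|
      ≤ ∫ l in Set.Ioi (0 : ℝ), |F'' l| := by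
    rw [← Real.norm_eq_abs]
    exact norm_integral_le_of_norm_le hint''.abs (.of_forall fun _ => abs_cos_mul_le _ _)
  rw [cosTransform_even heven, integral_Ioi_cos_mul_eq_neg hx hF' hF'' hint.integrableOn hint''
    hF_zero hF'_zero hF_top hF'_top, abs_mul, abs_neg, abs_mul, abs_two, abs_inv, abs_of_pos hx2]
  calc _ = 2 * |∫ l in Set.Ioi (0 : ℝ), Real.cos (l * x) * F'' l| := by field_simp
    _ ≤ _ := by gcongr

lemma integrable_of_continuous_of_sq_mul_abs_le {g : ℝ → ℝ} (hg : Continuous g) {A B : ℝ}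
    (hA : ∀ x, |g x| ≤ A) (hB : ∀ x, x ^ 2 * |g x| ≤ B) : Integrable g := by
  refine (integrable_inv_one_add_sq.const_mul (A + B)).mono' hg.aestronglyMeasurable
    (.of_forall fun x => ?_)
  rw [← div_eq_mul_inv, le_div_iff₀ (by positivity), Real.norm_eq_abs]
  linarith [hA x, hB x]

end CosineTransform
section RadialProfile

variable {β c α γ l : ℝ}

/-- The symbol `c l^α (1 + l²)^(γ/2)` on the half line `l > 0`. -/
noncomputable def radialSymbol (c α γ l : ℝ) : ℝ :=
  c * (l ^ α * (1 + l ^ 2) ^ (γ / 2))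

/-- The local homogeneity degree `l X'(l) / X(l)` of the symbol `X = radialSymbol c α γ`. -/
noncomputable def radialIndex (α γ l : ℝ) : ℝ :=
  α + γ * l ^ 2 / (1 + l ^ 2)

/-- The second order analogue `l² X''(l) / X(l)` of `radialIndex`. -/
noncomputable def radialIndex₂ (α γ l : ℝ) : ℝ :=
  radialIndex α γ l ^ 2 - radialIndex α γ l + 2 * γ * l ^ 2 / (1 + l ^ 2) ^ 2

/-- The profile `l ↦ E_β(-c l^α (1 + l²)^(γ/2))` of the Fourier transformed Green function on the
half line. -/
noncomputable def radialProfile (β c α γ l : ℝ) : ℝ :=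
  mlDeriv β 0 (radialSymbol c α γ l)

/-- The derivative of `radialProfile` on the open half line. -/
noncomputable def radialProfile' (β c α γ l : ℝ) : ℝ :=
  -(radialSymbol c α γ l * mlDeriv β 1 (radialSymbol c α γ l) * radialIndex α γ l / l)

/-- The second derivative of `radialProfile` on the open half line. -/
noncomputable def radialProfile'' (β c α γ l : ℝ) : ℝ :=
  (radialSymbol c α γ l ^ 2 * mlDeriv β 2 (radialSymbol c α γ l) * radialIndex α γ l ^ 2
    - radialSymbol c α γ l * mlDeriv β 1 (radialSymbol c α γ l) * radialIndex₂ α γ l) / l ^ 2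

lemma radialSymbol_nonneg (hc : 0 ≤ c) (hl : 0 ≤ l) : 0 ≤ radialSymbol c α γ l :=
  mul_nonneg hc (mul_nonneg (Real.rpow_nonneg hl α) (Real.rpow_nonneg (by positivity) _))

lemma mul_rpow_le_radialSymbol (hc : 0 ≤ c) (hγ : 0 ≤ γ) (hl : 0 ≤ l) :
    c * l ^ α ≤ radialSymbol c α γ l :=
  mul_le_mul_of_nonneg_left (le_mul_of_one_le_right (Real.rpow_nonneg hl α)
    (Real.one_le_rpow (le_add_of_nonneg_right (sq_nonneg l)) (by positivity))) hc

lemma min_one_radialSymbol_le (hc : 0 ≤ c) (hα : 0 ≤ α) (hγ : 0 ≤ γ) (hl : 0 ≤ l) :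
    min 1 (radialSymbol c α γ l) ≤ (1 + c * 2 ^ (γ / 2)) * min 1 (l ^ α) := by
  have hlα := Real.rpow_nonneg hl α
  have hE : 0 ≤ c * 2 ^ (γ / 2) := by positivity
  rw [mul_min_of_nonneg _ _ (by linarith), mul_one]
  refine le_min ((min_le_left _ _).trans (by linarith)) ?_
  rcases le_total l 1 with hl1 | hl1
  · refine (min_le_right _ _).trans ?_
    have hpow : (1 + l ^ 2) ^ (γ / 2) ≤ 2 ^ (γ / 2) := by gcongr; nlinarith
    calc radialSymbol c α γ l ≤ c * (l ^ α * 2 ^ (γ / 2)) := by unfold radialSymbol; gcongr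
      _ ≤ (1 + c * 2 ^ (γ / 2)) * l ^ α := by linarith
  · have hone : 1 ≤ l ^ α := Real.one_le_rpow hl1 hα
    exact (min_le_left _ _).trans (one_le_mul_of_one_le_of_one_le (by linarith) hone)

lemma hasDerivAt_radialSymbol (hl : 0 < l) :
    HasDerivAt (radialSymbol c α γ) (radialSymbol c α γ l * radialIndex α γ l / l) l := by
  have hp : 0 < 1 + l ^ 2 := by positivity
  have hpow := Real.hasDerivAt_rpow_const (x := l) (p := α) (Or.inl hl.ne')
  have hbase : HasDerivAt (fun l : ℝ => 1 + l ^ 2) (2 * l) l := by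
    simpa using (hasDerivAt_pow 2 l).const_add 1
  refine ((hpow.mul (hbase.rpow_const (p := γ / 2) (Or.inl hp.ne'))).const_mul c).congr_deriv ?_
  rw [radialSymbol, radialIndex, Real.rpow_sub_one hl.ne', Real.rpow_sub_one hp.ne']
  field_simp

lemma hasDerivAt_radialIndex :
    HasDerivAt (radialIndex α γ) (2 * γ * l / (1 + l ^ 2) ^ 2) l := by
  have hp : 0 < 1 + l ^ 2 := by positivity
  have hbase : HasDerivAt (fun l : ℝ => 1 + l ^ 2) (2 * l) l := by
    simpa using (hasDerivAt_pow 2 l).const_add 1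
  have hnum : HasDerivAt (fun l : ℝ => γ * l ^ 2) (γ * (2 * l)) l := by
    simpa using (hasDerivAt_pow 2 l).const_mul γ
  refine ((hnum.div hbase hp.ne').const_add α).congr_deriv ?_
  field_simp
  ring

lemma radialIndex_mem_Icc (hγ : 0 ≤ γ) : radialIndex α γ l ∈ Set.Icc α (α + γ) := by
  have hp : 0 < 1 + l ^ 2 := by positivity
  refine ⟨le_add_of_nonneg_right (by positivity), add_le_add_right ?_ α⟩
  rw [div_le_iff₀ hp]
  linarith

lemma abs_radialIndex₂_le (hα : 1 ≤ α) (hγ : 0 ≤ γ) :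
    |radialIndex₂ α γ l| ≤ 2 * (α + γ) ^ 2 := by
  obtain ⟨hle, hge⟩ := radialIndex_mem_Icc (α := α) (l := l) hγ
  have hlast : 2 * γ * l ^ 2 / (1 + l ^ 2) ^ 2 ≤ γ := by
    rw [div_le_iff₀ (by positivity)]
    nlinarith [mul_nonneg hγ (sq_nonneg (l ^ 2))]
  have hlast0 : 0 ≤ 2 * γ * l ^ 2 / (1 + l ^ 2) ^ 2 := by positivity
  rw [radialIndex₂, abs_of_nonneg (by nlinarith)]
  nlinarith

lemma hasDerivAt_radialProfile (hβ : 0 < β) (hl : 0 < l) :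
    HasDerivAt (radialProfile β c α γ) (radialProfile' β c α γ l) l := by
  refine ((hasDerivAt_mlDeriv hβ 0 _).comp l (hasDerivAt_radialSymbol hl)).congr_deriv ?_
  rw [radialProfile', zero_add]
  ring

lemma hasDerivAt_radialProfile' (hβ : 0 < β) (hl : 0 < l) :
    HasDerivAt (radialProfile' β c α γ) (radialProfile'' β c α γ l) l := by
  have hX := hasDerivAt_radialSymbol (c := c) (α := α) (γ := γ) hl
  have hE₁ := (hasDerivAt_mlDeriv hβ 1 _).comp l hX
  refine (((hX.mul hE₁).mul hasDerivAt_radialIndex).div (hasDerivAt_id l) hl.ne').neg.congr_deriv ?_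
  simp only [radialProfile'', radialIndex₂, Function.comp_apply, Pi.mul_apply, id_eq]
  field_simp
  ring

lemma exists_pow_succ_mul_mlDeriv_succ_le_min (hβ : 0 < β) (hβ' : β ≤ 1) (j : ℕ) :
    ∃ C : ℝ, 0 < C ∧ ∀ x : ℝ, 0 ≤ x → x ^ (j + 1) * mlDeriv β (j + 1) x ≤ C * min 1 x := by
  obtain ⟨C, hC, hbound⟩ := exists_mlDeriv_le hβ hβ' (j + 1)
  refine ⟨C, hC, fun x hx => ?_⟩
  have hE := mlDeriv_nonneg hβ hβ' (j + 1) hx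
  obtain ⟨hle, hdecay⟩ := hbound x hx
  rcases le_total x 1 with h | h
  · rw [min_eq_right h, mul_comm]
    exact mul_le_mul hle (pow_le_of_le_one hx h j.succ_ne_zero) (by positivity) hC.le
  · rw [min_eq_left h, mul_one]
    exact (mul_le_mul_of_nonneg_right (pow_le_pow_right₀ h (j + 1).le_succ) hE).trans hdecay

lemma exists_radialSymbol_pow_mul_mlDeriv_le (hβ : 0 < β) (hβ' : β ≤ 1) (hc : 0 ≤ c)
    (hα : 0 ≤ α) (hγ : 0 ≤ γ) (j : ℕ) :
    ∃ C : ℝ, 0 < C ∧ ∀ l : ℝ, 0 ≤ l →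
      radialSymbol c α γ l ^ (j + 1) * mlDeriv β (j + 1) (radialSymbol c α γ l)
        ≤ C * min 1 (l ^ α) := by
  obtain ⟨C, hC, hE⟩ := exists_pow_succ_mul_mlDeriv_succ_le_min hβ hβ' j
  refine ⟨C * (1 + c * 2 ^ (γ / 2)), by positivity, fun l hl => ?_⟩
  rw [mul_assoc]
  exact (hE _ (radialSymbol_nonneg hc hl)).trans
    (mul_le_mul_of_nonneg_left (min_one_radialSymbol_le hc hα hγ hl) hC.le)

lemma exists_abs_radialProfile'_le (hβ : 0 < β) (hβ' : β ≤ 1) (hc : 0 ≤ c) (hα : 0 ≤ α)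
    (hγ : 0 ≤ γ) :
    ∃ K : ℝ, 0 ≤ K ∧ ∀ l : ℝ, 0 < l → |radialProfile' β c α γ l| ≤ K * (min 1 (l ^ α) / l) := by
  obtain ⟨C, hC, hE⟩ := exists_radialSymbol_pow_mul_mlDeriv_le hβ hβ' hc hα hγ 0
  refine ⟨C * (α + γ), by positivity, fun l hl => ?_⟩
  have hX := radialSymbol_nonneg (α := α) (γ := γ) hc hl.le
  have hXE := mul_nonneg hX (mlDeriv_nonneg hβ hβ' 1 hX)
  have hle := hE l hl.le
  simp only [zero_add, pow_one] at hle
  obtain ⟨hp, hp'⟩ := radialIndex_mem_Icc (α := α) (l := l) hγ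
  have hp0 := hα.trans hp
  rw [radialProfile', abs_neg, abs_of_nonneg (div_nonneg (mul_nonneg hXE hp0) hl.le),
    ← mul_div_assoc, div_le_div_iff_of_pos_right hl, mul_right_comm C]
  exact mul_le_mul hle hp' hp0 (hXE.trans hle)

lemma exists_abs_radialProfile''_le (hβ : 0 < β) (hβ' : β ≤ 1) (hc : 0 ≤ c) (hα : 1 ≤ α)
    (hγ : 0 ≤ γ) :
    ∃ K : ℝ, ∀ l : ℝ, 0 < l → |radialProfile'' β c α γ l| ≤ K * (min 1 (l ^ α) / l ^ 2) := by
  have hα0 := zero_le_one.trans hα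
  obtain ⟨C₁, -, hE₁⟩ := exists_radialSymbol_pow_mul_mlDeriv_le hβ hβ' hc hα0 hγ 0
  obtain ⟨C₂, -, hE₂⟩ := exists_radialSymbol_pow_mul_mlDeriv_le hβ hβ' hc hα0 hγ 1
  refine ⟨C₂ * (α + γ) ^ 2 + C₁ * (2 * (α + γ) ^ 2), fun l hl => ?_⟩
  have hX := radialSymbol_nonneg (α := α) (γ := γ) hc hl.le
  have hXE₁ := mul_nonneg hX (mlDeriv_nonneg hβ hβ' 1 hX)
  have hXE₂ := mul_nonneg (sq_nonneg (radialSymbol c α γ l)) (mlDeriv_nonneg hβ hβ' 2 hX)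
  have hle₁ := hE₁ l hl.le
  have hle₂ := hE₂ l hl.le
  simp only [zero_add, pow_one] at hle₁
  obtain ⟨hp, hp'⟩ := radialIndex_mem_Icc (α := α) (l := l) hγ
  rw [radialProfile'', abs_div, abs_of_pos (sq_pos_of_pos hl), ← mul_div_assoc,
    div_le_div_iff_of_pos_right (sq_pos_of_pos hl), add_mul, mul_right_comm C₂,
    mul_right_comm C₁]
  refine (abs_sub _ _).trans (add_le_add ?_ ?_)
  · rw [abs_of_nonneg (mul_nonneg hXE₂ (sq_nonneg _))]
    exact mul_le_mul hle₂ (pow_le_pow_left₀ (hα0.trans hp) hp' 2) (sq_nonneg _) (hXE₂.trans hle₂)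
  · rw [abs_mul, abs_of_nonneg hXE₁]
    exact mul_le_mul hle₁ (abs_radialIndex₂_le hα hγ) (abs_nonneg _) (hXE₁.trans hle₁)

lemma integrableOn_min_one_rpow_div_sq (hα : 1 < α) :
    IntegrableOn (fun l : ℝ => min 1 (l ^ α) / l ^ 2) (Set.Ioi 0) := by
  have hmeas : Measurable fun l : ℝ => min 1 (l ^ α) / l ^ 2 := by fun_prop
  rw [← Set.Ioc_union_Ioi_eq_Ioi zero_le_one]
  refine IntegrableOn.union ?_ ?_
  · have hdom : IntegrableOn (fun l : ℝ => l ^ (α - 2)) (Set.Ioc 0 1) :=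
      (intervalIntegrable_iff_integrableOn_Ioc_of_le zero_le_one).1
        (intervalIntegral.intervalIntegrable_rpow' (by linarith))
    refine hdom.mono' hmeas.aestronglyMeasurable
      ((ae_restrict_iff' measurableSet_Ioc).2 (.of_forall fun l hl => ?_))
    rw [Real.norm_of_nonneg (div_nonneg (le_min zero_le_one (Real.rpow_nonneg hl.1.le α))
      (sq_nonneg l)), Real.rpow_sub hl.1, Real.rpow_two]
    gcongr
    exact min_le_right _ _
  · have hdom : IntegrableOn (fun l : ℝ => l ^ (-2 : ℝ)) (Set.Ioi 1) :=
      integrableOn_Ioi_rpow_of_lt (by norm_num) one_pos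
    refine hdom.mono' hmeas.aestronglyMeasurable
      ((ae_restrict_iff' measurableSet_Ioi).2 (.of_forall fun l hl => ?_))
    have hl0 : 0 ≤ l := zero_le_one.trans hl.out.le
    rw [Real.norm_of_nonneg (div_nonneg (le_min zero_le_one (Real.rpow_nonneg hl0 α))
      (sq_nonneg l)), Real.rpow_neg hl0, Real.rpow_two, ← one_div]
    gcongr
    exact min_le_left _ _

lemma integrableOn_radialProfile'' (hβ : 0 < β) (hβ' : β ≤ 1) (hc : 0 ≤ c) (hα : 1 < α)
    (hγ : 0 ≤ γ) : IntegrableOn (radialProfile'' β c α γ) (Set.Ioi 0) := by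
  obtain ⟨K, hK⟩ := exists_abs_radialProfile''_le hβ hβ' hc hα.le hγ
  have hmeas : Measurable (radialProfile'' β c α γ) := by
    have hE₁ := (continuous_mlDeriv hβ 1).measurable
    have hE₂ := (continuous_mlDeriv hβ 2).measurable
    unfold radialProfile'' radialIndex₂ radialIndex radialSymbol
    fun_prop
  exact ((integrableOn_min_one_rpow_div_sq hα).const_mul K).mono' hmeas.aestronglyMeasurable
    ((ae_restrict_iff' measurableSet_Ioi).2 (.of_forall hK))

lemma tendsto_radialProfile'_zero (hβ : 0 < β) (hβ' : β ≤ 1) (hc : 0 ≤ c) (hα : 1 < α)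
    (hγ : 0 ≤ γ) : Tendsto (radialProfile' β c α γ) (𝓝[>] 0) (𝓝 0) := by
  obtain ⟨K, hK0, hK⟩ := exists_abs_radialProfile'_le hβ hβ' hc (zero_le_one.trans hα.le) hγ
  have hlim : Tendsto (fun l : ℝ => K * l ^ (α - 1)) (𝓝[>] 0) (𝓝 0) := by
    have hcont := (Real.continuous_rpow_const (q := α - 1) (by linarith)).tendsto 0
    rw [Real.zero_rpow (by linarith)] at hcont
    simpa using (hcont.mono_left nhdsWithin_le_nhds).const_mul K
  refine squeeze_zero_norm' ?_ hlim
  filter_upwards [self_mem_nhdsWithin] with l (hl : 0 < l)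
  rw [Real.rpow_sub_one hl.ne']
  refine (hK l hl).trans (mul_le_mul_of_nonneg_left ?_ hK0)
  gcongr
  exact min_le_right _ _

lemma tendsto_radialProfile'_atTop (hβ : 0 < β) (hβ' : β ≤ 1) (hc : 0 ≤ c) (hα : 0 ≤ α)
    (hγ : 0 ≤ γ) : Tendsto (radialProfile' β c α γ) atTop (𝓝 0) := by
  obtain ⟨K, hK0, hK⟩ := exists_abs_radialProfile'_le hβ hβ' hc hα hγ
  refine squeeze_zero_norm' ?_ (tendsto_const_nhds (x := K).div_atTop tendsto_id)
  filter_upwards [eventually_gt_atTop 0] with l hl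
  rw [← mul_one K, mul_div_assoc]
  refine (hK l hl).trans (mul_le_mul_of_nonneg_left ?_ hK0)
  exact div_le_div_of_nonneg_right (min_le_left _ _) hl.le

end RadialProfile
section GreenFourier

variable {β μ α γ t : ℝ}

lemma greenFourier_eq_radialProfile (β μ α γ t l : ℝ) :
    greenFourier β μ α γ t l = radialProfile β (μ * t ^ β) α γ |l| := by
  rw [greenFourier, radialProfile, mlDeriv_zero, frbeSymbol, radialSymbol, sq_abs]
  ring_nf

lemma greenFourier_neg (l : ℝ) : greenFourier β μ α γ t (-l) = greenFourier β μ α γ t l := by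
  simp only [greenFourier_eq_radialProfile, abs_neg]

lemma continuous_greenFourier (hβ : 0 < β) (hα : 0 ≤ α) : Continuous (greenFourier β μ α γ t) := by
  have habs : Continuous fun l : ℝ => |l| ^ α := continuous_abs.rpow_const fun _ => Or.inr hα
  have hbessel : Continuous fun l : ℝ => (1 + l ^ 2) ^ (γ / 2) :=
    Continuous.rpow_const (by fun_prop) fun l => Or.inl (by positivity)
  exact (continuous_mittagLeffler_neg hβ).comp
    ((continuous_const.mul (habs.mul hbessel)).mul continuous_const)

lemma greenFourier_nonneg (hβ : 0 < β) (hβ' : β ≤ 1) (hμ : 0 ≤ μ) (ht : 0 ≤ t) (l : ℝ) :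
    0 ≤ greenFourier β μ α γ t l := by
  rw [greenFourier_eq_radialProfile]
  exact mlDeriv_nonneg hβ hβ' 0 (radialSymbol_nonneg (by positivity) (abs_nonneg l))

lemma greenFourier_le_one (hβ : 0 < β) (hβ' : β ≤ 1) (hμ : 0 ≤ μ) (ht : 0 ≤ t) (l : ℝ) :
    greenFourier β μ α γ t l ≤ 1 := by
  have hle := mlDeriv_le_mlDeriv_zero hβ hβ' 0
    (radialSymbol_nonneg (c := μ * t ^ β) (α := α) (γ := γ) (by positivity) (abs_nonneg l))
  rwa [mlDeriv_zero β 0, neg_zero, mittagLeffler_zero, ← radialProfile,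
    ← greenFourier_eq_radialProfile] at hle

lemma exists_mul_rpow_mul_greenFourier_le (hβ : 0 < β) (hβ' : β ≤ 1) :
    ∃ C : ℝ, 0 < C ∧ ∀ μ α γ t l : ℝ, 0 ≤ μ → 0 ≤ γ → 0 ≤ t →
      μ * t ^ β * |l| ^ α * greenFourier β μ α γ t l ≤ C := by
  obtain ⟨C, hC, hdecay⟩ := exists_mlDeriv_le hβ hβ' 0
  refine ⟨C, hC, fun μ α γ t l hμ hγ ht => ?_⟩
  have hc : 0 ≤ μ * t ^ β := by positivity
  have hX := radialSymbol_nonneg (α := α) (γ := γ) hc (abs_nonneg l)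
  rw [greenFourier_eq_radialProfile]
  calc _ ≤ radialSymbol (μ * t ^ β) α γ |l| * mlDeriv β 0 (radialSymbol (μ * t ^ β) α γ |l|) :=
        mul_le_mul_of_nonneg_right (mul_rpow_le_radialSymbol hc hγ (abs_nonneg l))
          (mlDeriv_nonneg hβ hβ' 0 hX)
    _ ≤ C := by simpa using (hdecay _ hX).2

lemma le_mul_one_add_rpow_neg {α a C r g : ℝ} (hα : 0 ≤ α) (ha : 0 < a) (hr : 0 ≤ r) (hC : 0 ≤ C)
    (hg : 0 ≤ g) (hg1 : g ≤ 1) (hgr : a * r ^ α * g ≤ C) :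
    g ≤ 2 ^ α * (1 + C / a) * (1 + r) ^ (-α) := by
  have hp : 0 < 1 + r := by linarith
  rw [Real.rpow_neg hp.le, ← div_eq_mul_inv, le_div_iff₀ (Real.rpow_pos_of_pos hp α)]
  have hCa : 0 ≤ C / a := div_nonneg hC ha.le
  rcases le_total r 1 with h | h
  · calc g * (1 + r) ^ α ≤ 1 * 2 ^ α := by gcongr; linarith
      _ ≤ 2 ^ α * (1 + C / a) := by
        rw [one_mul]
        exact le_mul_of_one_le_right (by positivity) (by linarith)
  · have hdecay : r ^ α * g ≤ C / a := by
      rw [le_div_iff₀ ha]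
      linarith
    calc g * (1 + r) ^ α ≤ g * (2 * r) ^ α := by gcongr; linarith
      _ = 2 ^ α * (r ^ α * g) := by rw [Real.mul_rpow zero_le_two hr]; ring
      _ ≤ 2 ^ α * (1 + C / a) := by gcongr; linarith

lemma exists_greenFourier_le (hβ : 0 < β) (hβ' : β ≤ 1) (hμ : 0 < μ) (hα : 0 ≤ α) (hγ : 0 ≤ γ)
    (ht : 0 < t) :
    ∃ K : ℝ, ∀ l : ℝ, greenFourier β μ α γ t l ≤ K * (1 + ‖l‖) ^ (-α) := by
  obtain ⟨C, hC, hdecay⟩ := exists_mul_rpow_mul_greenFourier_le hβ hβ'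
  exact ⟨_, fun l => le_mul_one_add_rpow_neg hα (mul_pos hμ (Real.rpow_pos_of_pos ht β))
    (abs_nonneg l) hC.le (greenFourier_nonneg hβ hβ' hμ.le ht.le l)
    (greenFourier_le_one hβ hβ' hμ.le ht.le l) (hdecay μ α γ t l hμ.le hγ ht.le)⟩

lemma integrable_greenFourier (hβ : 0 < β) (hβ' : β ≤ 1) (hμ : 0 < μ) (hα : 1 < α) (hγ : 0 ≤ γ)
    (ht : 0 < t) : Integrable (greenFourier β μ α γ t) := by
  have hα0 := zero_le_one.trans hα.le
  obtain ⟨K, hK⟩ := exists_greenFourier_le hβ hβ' hμ hα0 hγ ht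
  refine ((integrable_one_add_norm (E := ℝ) (r := α) (by simpa)).const_mul K).mono'
    (continuous_greenFourier hβ hα0).aestronglyMeasurable (.of_forall fun l => ?_)
  rw [Real.norm_of_nonneg (greenFourier_nonneg hβ hβ' hμ.le ht.le l)]
  exact hK l

lemma tendsto_greenFourier_atTop (hβ : 0 < β) (hβ' : β ≤ 1) (hμ : 0 < μ) (hα : 0 < α)
    (hγ : 0 ≤ γ) (ht : 0 < t) : Tendsto (greenFourier β μ α γ t) atTop (𝓝 0) := by
  obtain ⟨K, hK⟩ := exists_greenFourier_le hβ hβ' hμ hα.le hγ ht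
  refine squeeze_zero (greenFourier_nonneg hβ hβ' hμ.le ht.le) hK ?_
  rw [← mul_zero K]
  exact ((tendsto_rpow_neg_atTop hα).comp
    (tendsto_atTop_add_const_left _ _ tendsto_norm_atTop_atTop)).const_mul K

end GreenFourier

section GreenFunction

variable {β μ α γ t : ℝ}

lemma greenFunction_eq_cosTransform (β μ α γ t x : ℝ) :
    greenFunction β μ α γ t x = (2 * Real.pi)⁻¹ * cosTransform (greenFourier β μ α γ t) x :=
  rfl

lemma hasDerivAt_greenFourier (hβ : 0 < β) {l : ℝ} (hl : 0 < l) :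
    HasDerivAt (greenFourier β μ α γ t) (radialProfile' β (μ * t ^ β) α γ l) l := by
  refine (hasDerivAt_radialProfile hβ hl).congr_of_eventuallyEq ?_
  filter_upwards [eventually_gt_nhds hl] with s hs
  rw [greenFourier_eq_radialProfile, abs_of_pos hs]

lemma exists_sq_mul_abs_cosTransform_greenFourier_le (hβ : 0 < β) (hβ' : β ≤ 1) (hμ : 0 < μ)
    (hα : 1 < α) (hγ : 0 ≤ γ) (ht : 0 < t) :
    ∃ K : ℝ, ∀ x : ℝ, x ^ 2 * |cosTransform (greenFourier β μ α γ t) x| ≤ K := by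
  have hc : 0 ≤ μ * t ^ β := by positivity
  have hα0 := zero_lt_one.trans hα
  exact ⟨_, sq_mul_abs_cosTransform_le greenFourier_neg (fun l hl => hasDerivAt_greenFourier hβ hl)
    (fun l hl => hasDerivAt_radialProfile' hβ hl) (integrable_greenFourier hβ hβ' hμ hα hγ ht)
    (integrableOn_radialProfile'' hβ hβ' hc hα hγ)
    (((continuous_greenFourier hβ hα0.le).tendsto 0).mono_left nhdsWithin_le_nhds)
    (tendsto_radialProfile'_zero hβ hβ' hc hα hγ)
    (tendsto_greenFourier_atTop hβ hβ' hμ hα0 hγ ht)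
    (tendsto_radialProfile'_atTop hβ hβ' hc hα0.le hγ)⟩

lemma integrable_cosTransform_greenFourier (hβ : 0 < β) (hβ' : β ≤ 1) (hμ : 0 < μ) (hα : 1 < α)
    (hγ : 0 ≤ γ) (ht : 0 < t) : Integrable (cosTransform (greenFourier β μ α γ t)) := by
  have hint := integrable_greenFourier hβ hβ' hμ hα hγ ht
  obtain ⟨K, hK⟩ := exists_sq_mul_abs_cosTransform_greenFourier_le hβ hβ' hμ hα hγ ht
  exact integrable_of_continuous_of_sq_mul_abs_le (continuous_cosTransform hint)
    (abs_cosTransform_le hint) hK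

lemma integrable_greenFunction (hβ : 0 < β) (hβ' : β ≤ 1) (hμ : 0 < μ) (hα : 1 < α)
    (hγ : 0 ≤ γ) (ht : 0 < t) : Integrable (greenFunction β μ α γ t) :=
  (integrable_cosTransform_greenFourier hβ hβ' hμ hα hγ ht).const_mul _

lemma fourier_greenFunction (hβ : 0 < β) (hβ' : β ≤ 1) (hμ : 0 < μ) (hα : 1 < α)
    (hγ : 0 ≤ γ) (ht : 0 < t) (l : ℝ) :
    ∫ x : ℝ, (greenFunction β μ α γ t x : ℂ) * Complex.exp (Complex.I * x * l)
      = (greenFourier β μ α γ t l : ℂ) := by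
  simp only [greenFunction_eq_cosTransform, Complex.ofReal_mul,
    mul_assoc (Complex.ofReal (2 * Real.pi)⁻¹)]
  rw [integral_const_mul, integral_cosTransform_mul_exp (integrable_greenFourier hβ hβ' hμ hα hγ ht)
    (continuous_greenFourier hβ (zero_le_one.trans hα.le)) greenFourier_neg
    (integrable_cosTransform_greenFourier hβ hβ' hμ hα hγ ht), ← Complex.ofReal_mul,
    inv_mul_cancel_left₀ Real.two_pi_pos.ne']

theorem isGreenFunction_greenFunction (hβ : 0 < β) (hβ' : β ≤ 1) (hμ : 0 < μ) (hα : 1 < α)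
    (hγ : 0 ≤ γ) : IsGreenFunction β μ α γ (greenFunction β μ α γ) where
  integrable := fun _ ht => integrable_greenFunction hβ hβ' hμ hα hγ ht
  fourier := fun _ ht l => fourier_greenFunction hβ hβ' hμ hα hγ ht l
  initial := fun l => by
    rw [greenFourier, Real.zero_rpow hβ.ne', mul_zero, neg_zero, mittagLeffler_zero]
  equation := fun _ _ ht => hasCaputoDerivAt_mittagLeffler hβ hβ' _ ht

end GreenFunction

section SpectralDensity

lemma cosTransform_gaussian {b : ℝ} (hb : 0 < b) (x : ℝ) :
    cosTransform (fun l => Real.exp (-b * l ^ 2)) x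
      = √(Real.pi / b) * Real.exp (-x ^ 2 / (4 * b)) := by
  have hgauss := fourierIntegral_gaussian (b := (b : ℂ)) (by simpa using hb) (x : ℂ)
  have hsqrt : ((Real.pi : ℂ) / b) ^ (1 / 2 : ℂ) = ((√(Real.pi / b) : ℝ) : ℂ) := by
    rw [Real.sqrt_eq_rpow, Complex.ofReal_cpow (div_nonneg Real.pi_pos.le hb.le)]
    push_cast
    rfl
  rw [hsqrt] at hgauss
  rw [← Complex.ofReal_inj, ← integral_exp_mul_even (integrable_exp_neg_mul_sq hb)
    (fun l => by rw [neg_sq]) x]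
  push_cast
  rw [← hgauss]
  exact integral_congr_ae (.of_forall fun l => by ring_nf)

/-- The summands of the spectral density of `(1 + x²)^(-κ/2)`: up to the factor `Γ(κ/2)`, this
covariance is the mixture `∫₀^∞ e^(-s) s^(κ/2-1) e^(-s x²) ds` of Gaussian functions of `x`, and
`mixtureKernel κ l s` is the inverse Fourier transform of the integrand. -/
noncomputable def mixtureKernel (κ l s : ℝ) : ℝ :=
  Real.exp (-s) * s ^ (κ / 2 - 1) * ((√(4 * Real.pi * s))⁻¹ * Real.exp (-(4 * s)⁻¹ * l ^ 2))

/-- The spectral density of the covariance function `(1 + x²)^(-κ/2)`. -/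
noncomputable def besselDensity (κ l : ℝ) : ℝ :=
  (Real.Gamma (κ / 2))⁻¹ * ∫ s in Set.Ioi (0 : ℝ), mixtureKernel κ l s

variable {κ : ℝ}

lemma mixtureKernel_nonneg (l : ℝ) {s : ℝ} (hs : 0 ≤ s) : 0 ≤ mixtureKernel κ l s := by
  unfold mixtureKernel
  positivity

lemma measurable_mixtureKernel : Measurable (Function.uncurry (mixtureKernel κ)) := by
  unfold mixtureKernel Function.uncurry
  fun_prop

lemma sqrt_four_pi_mul {s : ℝ} (hs : 0 ≤ s) :
    √(4 * Real.pi * s) = √(4 * Real.pi) * s ^ (1 / 2 : ℝ) := by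
  rw [Real.sqrt_mul' _ hs, Real.sqrt_eq_rpow s]

lemma cosTransform_mixtureKernel (x : ℝ) {s : ℝ} (hs : 0 < s) :
    cosTransform (fun l => mixtureKernel κ l s) x
      = Real.exp (-s) * s ^ (κ / 2 - 1) * Real.exp (-s * x ^ 2) := by
  have hgauss := cosTransform_gaussian (b := (4 * s)⁻¹) (inv_pos.2 (by linarith)) x
  have hvar : Real.pi / (4 * s)⁻¹ = 4 * Real.pi * s := by field_simp
  have harg : -x ^ 2 / (4 * (4 * s)⁻¹) = -s * x ^ 2 := by field_simp
  have hsqrt : √(4 * Real.pi * s) ≠ 0 := by positivity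
  rw [hvar, harg, cosTransform] at hgauss
  simp only [cosTransform, mixtureKernel, mul_left_comm (Real.cos _)]
  rw [integral_const_mul, integral_const_mul, hgauss, inv_mul_cancel_left₀ hsqrt]

lemma integrable_mixtureKernel (hκ : 0 < κ) :
    Integrable (Function.uncurry (mixtureKernel κ))
      ((volume : Measure ℝ).prod (volume.restrict (Set.Ioi 0))) := by
  rw [integrable_prod_iff' measurable_mixtureKernel.aestronglyMeasurable]
  constructor
  · refine (ae_restrict_iff' measurableSet_Ioi).2 (.of_forall fun s (hs : 0 < s) => ?_)
    exact ((integrable_exp_neg_mul_sq (b := (4 * s)⁻¹) (inv_pos.2 (by linarith))).const_mul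
      (√(4 * Real.pi * s))⁻¹).const_mul (Real.exp (-s) * s ^ (κ / 2 - 1))
  · refine (Real.GammaIntegral_convergent (half_pos hκ)).congr_fun (fun s hs => ?_)
      measurableSet_Ioi
    have htotal := cosTransform_mixtureKernel (κ := κ) 0 hs
    simp only [cosTransform, mul_zero, Real.cos_zero, one_mul, ne_eq, OfNat.ofNat_ne_zero,
      not_false_eq_true, zero_pow, Real.exp_zero, mul_one] at htotal
    exact htotal.symm.trans (integral_congr_ae (.of_forall fun l =>
      (Real.norm_of_nonneg (mixtureKernel_nonneg l (le_of_lt hs))).symm))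

lemma integrable_besselDensity (hκ : 0 < κ) : Integrable (besselDensity κ) :=
  (integrable_mixtureKernel hκ).integral_prod_left.const_mul _

lemma besselDensity_nonneg (hκ : 0 ≤ κ) (l : ℝ) : 0 ≤ besselDensity κ l :=
  mul_nonneg (inv_nonneg.2 (Real.Gamma_nonneg_of_nonneg (div_nonneg hκ zero_le_two)))
    (setIntegral_nonneg measurableSet_Ioi fun _ hs => mixtureKernel_nonneg l (le_of_lt hs))

lemma besselDensity_neg (l : ℝ) : besselDensity κ (-l) = besselDensity κ l := by
  simp only [besselDensity, mixtureKernel, neg_sq]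

lemma cosTransform_besselDensity (hκ : 0 < κ) (x : ℝ) :
    cosTransform (besselDensity κ) x = ((1 + x ^ 2) ^ (κ / 2))⁻¹ := by
  have hΓ := (Real.Gamma_pos_of_pos (half_pos hκ)).ne'
  have hint : Integrable (Function.uncurry fun l s => Real.cos (l * x) * mixtureKernel κ l s)
      ((volume : Measure ℝ).prod (volume.restrict (Set.Ioi 0))) :=
    (integrable_mixtureKernel hκ).bdd_mul (c := 1) (f := fun p : ℝ × ℝ => Real.cos (p.1 * x))
      (by fun_prop) (.of_forall fun p => Real.abs_cos_le_one _)
  have hmix : ∫ s in Set.Ioi (0 : ℝ), cosTransform (fun l => mixtureKernel κ l s) x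
      = (1 / (1 + x ^ 2)) ^ (κ / 2) * Real.Gamma (κ / 2) := by
    rw [← Real.integral_rpow_mul_exp_neg_mul_Ioi (half_pos hκ) (by positivity)]
    refine setIntegral_congr_fun measurableSet_Ioi fun s hs => ?_
    rw [cosTransform_mixtureKernel x hs, mul_comm (Real.exp (-s)), mul_assoc, ← Real.exp_add]
    ring_nf
  simp only [cosTransform] at hmix
  simp only [cosTransform, besselDensity, mul_left_comm (Real.cos _),
    ← integral_const_mul (Real.cos _)]
  rw [integral_const_mul, integral_integral_swap hint, hmix,
    Real.div_rpow zero_le_one (by positivity), Real.one_rpow, one_div, mul_comm, mul_assoc,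
    mul_inv_cancel₀ hΓ, mul_one]

lemma mixtureKernel_le {a l s : ℝ} (ha : 0 < a) (hl : a ≤ l ^ 2) (hs : 0 < s) :
    mixtureKernel κ l s
      ≤ (√(4 * Real.pi))⁻¹ * (4 / a) * (Real.exp (-s) * s ^ ((κ / 2 + 1 / 2) - 1)) := by
  have hexp : Real.exp (-(4 * s)⁻¹ * l ^ 2) ≤ 4 / a * s := by
    have hy : 0 < (4 * s)⁻¹ * a := by positivity
    calc Real.exp (-(4 * s)⁻¹ * l ^ 2) ≤ Real.exp (-((4 * s)⁻¹ * a)) := by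
          rw [neg_mul]
          gcongr
      _ = (Real.exp ((4 * s)⁻¹ * a))⁻¹ := Real.exp_neg _
      _ ≤ ((4 * s)⁻¹ * a)⁻¹ :=
          inv_anti₀ hy ((le_add_of_nonneg_right zero_le_one).trans (Real.add_one_le_exp _))
      _ = 4 / a * s := by field_simp
  have hpow : s ^ ((κ / 2 + 1 / 2) - 1) = s ^ (κ / 2 - 1) * (s / s ^ (1 / 2 : ℝ)) := by
    rw [← Real.rpow_one_sub' hs.le (by norm_num), ← Real.rpow_add hs]
    ring_nf
  calc mixtureKernel κ l s
      ≤ Real.exp (-s) * s ^ (κ / 2 - 1) * ((√(4 * Real.pi * s))⁻¹ * (4 / a * s)) := by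
        unfold mixtureKernel
        gcongr
    _ = _ := by
        rw [sqrt_four_pi_mul hs.le, hpow, mul_inv]
        ring

lemma continuousAt_besselDensity (hκ : 0 < κ) {w : ℝ} (hw : w ≠ 0) :
    ContinuousAt (besselDensity κ) w := by
  have hw2 : 0 < w ^ 2 / 2 := by positivity
  have hnear : ∀ᶠ l in 𝓝 w, w ^ 2 / 2 < l ^ 2 :=
    (continuous_pow 2).continuousAt.eventually (lt_mem_nhds (by linarith))
  refine continuousAt_const.mul (continuousAt_of_dominated (bound := fun s =>
    (√(4 * Real.pi))⁻¹ * (4 / (w ^ 2 / 2)) * (Real.exp (-s) * s ^ ((κ / 2 + 1 / 2) - 1)))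
    ?_ ?_ ?_ ?_)
  · exact .of_forall fun l =>
      (measurable_mixtureKernel.comp measurable_prodMk_left).aestronglyMeasurable
  · filter_upwards [hnear] with l hl
    refine (ae_restrict_iff' measurableSet_Ioi).2 (.of_forall fun s (hs : 0 < s) => ?_)
    rw [Real.norm_of_nonneg (mixtureKernel_nonneg l hs.le)]
    exact mixtureKernel_le hw2 hl.le hs
  · exact (Real.GammaIntegral_convergent (add_pos (half_pos hκ) one_half_pos)).const_mul _
  · refine .of_forall fun s => ?_
    unfold mixtureKernel
    fun_prop

lemma mixtureKernel_half_abs_mul {w r : ℝ} (hw : w ≠ 0) (hr : 0 < r) :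
    mixtureKernel κ w (|w| / 2 * r)
      = (√(4 * Real.pi))⁻¹ * (|w| / 2) ^ ((κ - 1) / 2 - 1) *
        (r ^ ((κ - 1) / 2 - 1) * Real.exp (-(1 / 2) * (r + 1 / r) * |w|)) := by
  have ha : 0 < |w| := abs_pos.2 hw
  have hs : 0 < |w| / 2 * r := mul_pos (half_pos ha) hr
  have hpow : (|w| / 2 * r) ^ (κ / 2 - 1) * ((|w| / 2 * r) ^ (1 / 2 : ℝ))⁻¹
      = (|w| / 2) ^ ((κ - 1) / 2 - 1) * r ^ ((κ - 1) / 2 - 1) := by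
    rw [← Real.mul_rpow (half_pos ha).le hr.le, ← Real.rpow_neg hs.le, ← Real.rpow_add hs]
    ring_nf
  have hexp : Real.exp (-(|w| / 2 * r)) * Real.exp (-(4 * (|w| / 2 * r))⁻¹ * w ^ 2)
      = Real.exp (-(1 / 2) * (r + 1 / r) * |w|) := by
    rw [← Real.exp_add, ← sq_abs w]
    congr 1
    field_simp
    ring
  rw [mixtureKernel, sqrt_four_pi_mul hs.le, mul_inv]
  calc _ = (√(4 * Real.pi))⁻¹ *
        ((|w| / 2 * r) ^ (κ / 2 - 1) * ((|w| / 2 * r) ^ (1 / 2 : ℝ))⁻¹) *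
        (Real.exp (-(|w| / 2 * r)) * Real.exp (-(4 * (|w| / 2 * r))⁻¹ * w ^ 2)) := by ring
    _ = _ := by
        rw [hpow, hexp]
        ring

lemma integral_mixtureKernel {w : ℝ} (hw : w ≠ 0) :
    ∫ s in Set.Ioi (0 : ℝ), mixtureKernel κ w s
      = (√Real.pi)⁻¹ * (|w| / 2) ^ ((κ - 1) / 2) * besselK ((κ - 1) / 2) |w| := by
  have ha : 0 < |w| / 2 := half_pos (abs_pos.2 hw)
  have hsub := integral_comp_mul_left_Ioi (fun s => mixtureKernel κ w s) 0 ha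
  have hfour : √(4 * Real.pi) = 2 * √Real.pi := by
    rw [Real.sqrt_mul zero_le_four, show (4 : ℝ) = 2 ^ 2 by norm_num, Real.sqrt_sq zero_le_two]
  rw [mul_zero,
    setIntegral_congr_fun measurableSet_Ioi fun r hr => mixtureKernel_half_abs_mul hw hr,
    integral_const_mul, smul_eq_mul, eq_inv_mul_iff_mul_eq₀ ha.ne', hfour] at hsub
  rw [← hsub, besselK, ← sub_add_cancel ((κ - 1) / 2) 1, Real.rpow_add_one ha.ne',
    add_sub_cancel_right, mul_inv]
  ring

lemma c₂_ne_zero (hκ : 0 < κ) (hκ' : κ < 1) : c₂ κ ≠ 0 := by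
  have hcos : 0 < Real.cos (κ * Real.pi / 2) :=
    Real.cos_pos_of_mem_Ioo ⟨by nlinarith [Real.pi_pos], by nlinarith [Real.pi_pos]⟩
  exact inv_ne_zero
    (mul_ne_zero (mul_ne_zero two_ne_zero (Real.Gamma_pos_of_pos hκ).ne') hcos.ne')

lemma besselDensity_eq_limitConst (hκ : 0 < κ) (hκ' : κ < 1) {w : ℝ} (hw : w ≠ 0) :
    besselDensity κ w = limitConst κ w := by
  have ha : 0 < |w| := abs_pos.2 hw
  have hc₂ := c₂_ne_zero hκ hκ'
  have hpow : (|w| / 2) ^ ((κ - 1) / 2)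
      = |w| ^ ((1 - κ) / 2) / |w| ^ (1 - κ) * 2 ^ ((1 - κ) / 2) := by
    rw [← Real.rpow_sub ha, Real.div_rpow ha.le zero_le_two, div_eq_mul_inv,
      ← Real.rpow_neg zero_le_two]
    ring_nf
  rw [besselDensity, integral_mixtureKernel hw, limitConst, theta, sub_sub_cancel, c₁, hpow]
  field_simp

/-- The spectral density of `cyclicCov κ w`. -/
noncomputable def cyclicDensity (κ w l : ℝ) : ℝ :=
  (1 / 2) * (besselDensity κ (l + w) + besselDensity κ (l - w))

lemma integrable_cyclicDensity (hκ : 0 < κ) (w : ℝ) : Integrable (cyclicDensity κ w) :=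
  (((integrable_besselDensity hκ).comp_add_right w).add
    ((integrable_besselDensity hκ).comp_sub_right w)).const_mul _

lemma cosTransform_comp_add_add_comp_sub {f : ℝ → ℝ} (hf : Integrable f) (w x : ℝ) :
    cosTransform (fun l => f (l + w) + f (l - w)) x
      = 2 * Real.cos (w * x) * cosTransform f x := by
  have hshift (v : ℝ) : ∫ l, Real.cos (l * x) * f (l - v) = ∫ l, Real.cos ((l + v) * x) * f l := by
    rw [← integral_add_right_eq_self (fun l => Real.cos (l * x) * f (l - v)) v]
    simp only [add_sub_cancel_right]
  have hint (v : ℝ) : Integrable fun l => Real.cos (l * x) * f (l - v) :=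
    integrable_cos_mul (hf.comp_sub_right v) x
  have hint' (v : ℝ) : Integrable fun l => Real.cos ((l + v) * x) * f l := by
    simpa only [add_sub_cancel_right] using (hint v).comp_add_right v
  simp only [cosTransform, mul_add, ← sub_neg_eq_add _ w]
  rw [integral_add (hint _) (hint _), hshift, hshift, ← integral_add (hint' _) (hint' _),
    ← integral_const_mul]
  refine integral_congr_ae (.of_forall fun l => ?_)
  beta_reduce
  rw [add_mul, add_mul, neg_mul, Real.cos_add, Real.cos_add, Real.cos_neg, Real.sin_neg]
  ring

lemma cosTransform_cyclicDensity (hκ : 0 < κ) (w x : ℝ) :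
    cosTransform (cyclicDensity κ w) x = cyclicCov κ w x := by
  have hsum := cosTransform_comp_add_add_comp_sub (integrable_besselDensity hκ) w x
  rw [cosTransform_besselDensity hκ, cosTransform] at hsum
  simp only [cosTransform, cyclicDensity, mul_left_comm (Real.cos _)]
  rw [integral_const_mul, hsum, cyclicCov]
  ring

lemma continuousAt_cyclicDensity (hκ : 0 < κ) {w : ℝ} (hw : w ≠ 0) :
    ContinuousAt (cyclicDensity κ w) 0 := by
  have hadd : ContinuousAt (fun l : ℝ => besselDensity κ (l + w)) 0 :=
    ContinuousAt.comp' (by simpa using continuousAt_besselDensity hκ hw) (by fun_prop)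
  have hsub : ContinuousAt (fun l : ℝ => besselDensity κ (l - w)) 0 :=
    ContinuousAt.comp' (by simpa using continuousAt_besselDensity hκ (neg_ne_zero.2 hw))
      (by fun_prop)
  exact continuousAt_const.mul (hadd.add hsub)

lemma cyclicDensity_zero (hκ : 0 < κ) (hκ' : κ < 1) {w : ℝ} (hw : w ≠ 0) :
    cyclicDensity κ w 0 = limitConst κ w := by
  rw [cyclicDensity, zero_add, zero_sub, besselDensity_neg, besselDensity_eq_limitConst hκ hκ' hw,
    ← two_mul, one_div, inv_mul_cancel_left₀ two_ne_zero]

lemma cyclicDensity_nonneg (hκ : 0 ≤ κ) (w l : ℝ) : 0 ≤ cyclicDensity κ w l :=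
  mul_nonneg one_half_pos.le
    (add_nonneg (besselDensity_nonneg hκ _) (besselDensity_nonneg hκ _))

end SpectralDensity

section MeanSquareLimits

lemma inner_toLp_toLp {Ω 𝕜 : Type*} [MeasurableSpace Ω] [RCLike 𝕜] {P : Measure Ω}
    {X Y : Ω → 𝕜} (hX : MemLp X 2 P) (hY : MemLp Y 2 P) :
    inner 𝕜 (hY.toLp Y) (hX.toLp X) = ∫ ω, X ω * (starRingEnd 𝕜) (Y ω) ∂P := by
  rw [L2.inner_def]
  refine integral_congr_ae ?_
  filter_upwards [hX.coeFn_toLp, hY.coeFn_toLp] with ω hXω hYω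
  rw [hXω, hYω, RCLike.inner_apply]

lemma tendsto_integral_mul_conj {Ω ι 𝕜 : Type*} [MeasurableSpace Ω] [RCLike 𝕜] {P : Measure Ω}
    {u : Filter ι} {X Y : ι → Ω → 𝕜} {X₀ Y₀ : Ω → 𝕜}
    (hX : ∀ n, MemLp (X n) 2 P) (hX₀ : MemLp X₀ 2 P)
    (hY : ∀ n, MemLp (Y n) 2 P) (hY₀ : MemLp Y₀ 2 P)
    (hXlim : Tendsto (fun n => eLpNorm (X n - X₀) 2 P) u (𝓝 0))
    (hYlim : Tendsto (fun n => eLpNorm (Y n - Y₀) 2 P) u (𝓝 0)) :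
    Tendsto (fun n => ∫ ω, X n ω * (starRingEnd 𝕜) (Y n ω) ∂P) u
      (𝓝 (∫ ω, X₀ ω * (starRingEnd 𝕜) (Y₀ ω) ∂P)) := by
  have hXL := (Lp.tendsto_Lp_iff_tendsto_eLpNorm'' X hX X₀ hX₀).2 hXlim
  have hYL := (Lp.tendsto_Lp_iff_tendsto_eLpNorm'' Y hY Y₀ hY₀).2 hYlim
  simpa only [inner_toLp_toLp] using Tendsto.inner (𝕜 := 𝕜) hYL hXL

lemma tendsto_integral_of_tendsto_eLpNorm_two {Ω ι 𝕜 : Type*} [MeasurableSpace Ω] [RCLike 𝕜]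
    {P : Measure Ω} [IsFiniteMeasure P] {u : Filter ι} {X : ι → Ω → 𝕜} {Z : Ω → 𝕜}
    (hX : ∀ n, MemLp (X n) 2 P) (hZ : MemLp Z 2 P)
    (h : Tendsto (fun n => eLpNorm (X n - Z) 2 P) u (𝓝 0)) :
    Tendsto (fun n => ∫ ω, X n ω ∂P) u (𝓝 (∫ ω, Z ω ∂P)) := by
  have hlim := tendsto_integral_mul_conj hX hZ (Y := fun _ _ => (1 : 𝕜)) (Y₀ := fun _ => (1 : 𝕜))
    (fun _ => memLp_const 1) (memLp_const 1) h
    (by simp only [sub_self, eLpNorm_zero, tendsto_const_nhds])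
  simpa only [map_one, mul_one] using hlim

variable {Ω : Type*} [MeasurableSpace Ω] {P : Measure Ω}

lemma isGaussianProcess_of_hasGaussianLaw_sum {T : Type*} {Z : T → Ω → ℝ}
    (hZ : ∀ t, AEMeasurable (Z t) P)
    (hsum : ∀ (I : Finset T) (c : I → ℝ), HasGaussianLaw (fun ω => ∑ i, c i * Z i ω) P) :
    IsGaussianProcess Z P where
  hasGaussianLaw I := by
    classical
    have hmeas : AEMeasurable (fun ω => I.restrict (Z · ω)) P :=
      aemeasurable_pi_lambda _ fun i => hZ i
    refine ⟨isGaussian_of_isGaussian_map fun L => ?_⟩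
    rw [AEMeasurable.map_map_of_aemeasurable (by fun_prop) hmeas]
    have hL : (L ∘ fun ω => I.restrict (Z · ω))
        = fun ω => ∑ i : I, L (fun j => if i = j then 1 else 0) * Z i ω := by
      ext ω
      exact (L.toLinearMap.pi_apply_eq_sum_univ _).trans
        (Finset.sum_congr rfl fun i _ => mul_comm _ _)
    rw [hL]
    exact (hsum I _).isGaussian_map

variable [IsProbabilityMeasure P]

lemma tendsto_variance_of_tendsto_eLpNorm_two {ι : Type*} {u : Filter ι} {X : ι → Ω → ℝ}
    {Z : Ω → ℝ} (hX : ∀ n, MemLp (X n) 2 P) (hZ : MemLp Z 2 P)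
    (h : Tendsto (fun n => eLpNorm (X n - Z) 2 P) u (𝓝 0)) :
    Tendsto (fun n => Var[X n; P]) u (𝓝 Var[Z; P]) := by
  simp only [variance_eq_sub hZ, fun n => variance_eq_sub (hX n), Pi.pow_apply, pow_two (_ : ℝ)]
  have hmean := tendsto_integral_of_tendsto_eLpNorm_two hX hZ h
  refine Tendsto.sub ?_ (hmean.mul hmean)
  simpa only [conj_trivial] using tendsto_integral_mul_conj hX hZ hX hZ h h

lemma hasGaussianLaw_of_tendsto_eLpNorm_two {X : ℕ → Ω → ℝ} {Z : Ω → ℝ}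
    (hX : ∀ n, HasGaussianLaw (X n) P) (hZ : MemLp Z 2 P)
    (h : Tendsto (fun n => eLpNorm (X n - Z) 2 P) atTop (𝓝 0)) : HasGaussianLaw Z P := by
  have hX2 : ∀ n, MemLp (X n) 2 P := fun n => (hX n).memLp_two
  have hdist := (tendstoInMeasure_of_tendsto_eLpNorm two_ne_zero
    (fun n => (hX2 n).aestronglyMeasurable) hZ.aestronglyMeasurable h).tendstoInDistribution
    fun n => (hX n).aemeasurable
  have hmean := tendsto_integral_of_tendsto_eLpNorm_two hX2 hZ h
  have hvar := tendsto_variance_of_tendsto_eLpNorm_two hX2 hZ h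
  rw [hasGaussianLaw_iff_charFun_map_eq hZ.aestronglyMeasurable.aemeasurable]
  intro t
  refine tendsto_nhds_unique (ProbabilityMeasure.tendsto_iff_tendsto_charFun.1 hdist.tendsto t) ?_
  have hinner (Y : Ω → ℝ) (ω : Ω) : inner ℝ t (Y ω) = t * Y ω := by
    rw [RCLike.inner_apply, conj_trivial, mul_comm]
  simp only [ProbabilityMeasure.coe_mk, fun n => (hX n).charFun_map_eq t, hinner,
    integral_const_mul, variance_const_mul]
  refine (Complex.continuous_exp.tendsto _).comp (Tendsto.sub ?_ ?_)
  · exact ((Complex.continuous_ofReal.tendsto _).comp (hmean.const_mul t)).mul_const _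
  · exact ((Complex.continuous_ofReal.tendsto _).comp (hvar.const_mul (t ^ 2))).div_const _

lemma isGaussianProcess_of_tendsto_eLpNorm_two {T : Type*} {X : ℕ → T → Ω → ℝ} {Z : T → Ω → ℝ}
    (hX : ∀ n, IsGaussianProcess (X n) P) (hZ : ∀ t, MemLp (Z t) 2 P)
    (h : ∀ t, Tendsto (fun n => eLpNorm (X n t - Z t) 2 P) atTop (𝓝 0)) :
    IsGaussianProcess Z P := by
  refine isGaussianProcess_of_hasGaussianLaw_sum
    (fun t => (hZ t).aestronglyMeasurable.aemeasurable) fun I c => ?_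
  have hXsum (n : ℕ) : HasGaussianLaw (fun ω => ∑ i : I, c i * X n i ω) P := by
    have hlaw := ((hX n).hasGaussianLaw I).map_fun (∑ i, c i • ContinuousLinearMap.proj i)
    simpa only [_root_.sum_apply, _root_.smul_apply,
      ContinuousLinearMap.proj_apply, smul_eq_mul, Finset.restrict] using hlaw
  refine hasGaussianLaw_of_tendsto_eLpNorm_two hXsum
    (memLp_finsetSum _ fun i _ => (hZ i).const_mul (c i)) ?_
  have hlim : Tendsto (fun n => ∑ i : I, ‖c i‖ₑ * eLpNorm (X n i - Z i) 2 P) atTop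
      (𝓝 (∑ i : I, ‖c i‖ₑ * 0)) :=
    tendsto_finsetSum _ fun i _ =>
      ENNReal.Tendsto.const_mul (h i) (Or.inr enorm_ne_top)
  simp only [mul_zero, Finset.sum_const_zero] at hlim
  refine tendsto_of_tendsto_of_tendsto_of_le_of_le tendsto_const_nhds hlim
    (fun _ => zero_le) fun n => ?_
  have hdiff : (fun ω => ∑ i : I, c i * X n i ω) - (fun ω => ∑ i : I, c i * Z i ω)
      = ∑ i : I, c i • (X n i - Z i) := by
    ext ω
    simp only [Pi.sub_apply, Finset.sum_apply, Pi.smul_apply, smul_eq_mul, mul_sub,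
      Finset.sum_sub_distrib]
  simp only [hdiff, ← eLpNorm_const_smul]
  exact eLpNorm_sum_le (fun i _ => ((((hX n).hasGaussianLaw_eval i).memLp_two.sub
    (hZ i)).const_smul (c i)).aestronglyMeasurable) one_le_two

end MeanSquareLimits

section SecondOrderProcesses

variable {Ω : Type*} [MeasurableSpace Ω] {P : Measure Ω} {T : Type*} [MeasurableSpace T]
  {m : Measure T}

lemma integrable_prod_mul_of_integral_norm_le [SFinite P] [SFinite m] {ζ : T → Ω → ℝ} {M : ℝ}
    (hζ : AEStronglyMeasurable (fun p : Ω × T => ζ p.2 p.1) (P.prod m))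
    (hint : ∀ t, Integrable (ζ t) P) (hM : ∀ t, ∫ ω, ‖ζ t ω‖ ∂P ≤ M) {g : T → ℝ}
    (hg : Integrable g m) : Integrable (fun p : Ω × T => g p.2 * ζ p.2 p.1) (P.prod m) := by
  have hmeas : AEStronglyMeasurable (fun p : Ω × T => g p.2 * ζ p.2 p.1) (P.prod m) :=
    hg.aestronglyMeasurable.comp_snd.mul hζ
  refine (integrable_prod_iff' hmeas).2 ⟨.of_forall fun t => (hint t).const_mul (g t), ?_⟩
  refine Integrable.mono' (hg.norm.mul_const M) hmeas.norm.prod_swap.integral_prod_right'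
    (.of_forall fun t => ?_)
  simp only [norm_mul, integral_const_mul, norm_norm]
  rw [Real.norm_of_nonneg (integral_nonneg fun ω => norm_nonneg (ζ t ω))]
  exact mul_le_mul_of_nonneg_left (hM t) (norm_nonneg _)

/-- `η` is a jointly measurable process whose second moments are bounded by `M`. Its integrals
against integrable weights are square integrable random variables. -/
structure IsSecondOrderProcess (P : Measure Ω) (M : ℝ) (η : T → Ω → ℝ) : Prop where
  measurable : Measurable (Function.uncurry η)
  memLp : ∀ t, MemLp (η t) 2 P
  integral_sq_le : ∀ t, ∫ ω, η t ω ^ 2 ∂P ≤ M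

namespace IsSecondOrderProcess

variable {M : ℝ} {η : T → Ω → ℝ} {g h : T → ℝ}

lemma integral_norm_mul_le (hη : IsSecondOrderProcess P M η) {X : Ω → ℝ} (hX : MemLp X 2 P)
    (t : T) : ∫ ω, ‖X ω * η t ω‖ ∂P ≤ (∫ ω, X ω ^ 2 ∂P + M) / 2 := by
  have hsq := hX.integrable_sq.add (hη.memLp t).integrable_sq
  calc ∫ ω, ‖X ω * η t ω‖ ∂P ≤ ∫ ω, (X ω ^ 2 + η t ω ^ 2) / 2 ∂P := by
        refine integral_mono (hX.integrable_mul (hη.memLp t)).norm (hsq.div_const 2) fun ω => ?_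
        simp only [Real.norm_eq_abs, abs_mul]
        linarith [two_mul_le_add_sq |X ω| |η t ω|, sq_abs (X ω), sq_abs (η t ω)]
    _ = (∫ ω, X ω ^ 2 ∂P + ∫ ω, η t ω ^ 2 ∂P) / 2 := by
        rw [integral_div, integral_add hX.integrable_sq (hη.memLp t).integrable_sq]
    _ ≤ (∫ ω, X ω ^ 2 ∂P + M) / 2 := by linarith [hη.integral_sq_le t]

lemma measurable_comp_swap (hη : IsSecondOrderProcess P M η) :
    Measurable fun p : Ω × T => η p.2 p.1 := hη.measurable.comp measurable_swap

lemma integrable_prod_mul [SFinite P] [SFinite m] (hη : IsSecondOrderProcess P M η) {X : Ω → ℝ}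
    (hX : MemLp X 2 P) (hg : Integrable g m) :
    Integrable (fun p : Ω × T => g p.2 * (X p.1 * η p.2 p.1)) (P.prod m) :=
  integrable_prod_mul_of_integral_norm_le
    (hX.aestronglyMeasurable.comp_fst.mul hη.measurable_comp_swap.aestronglyMeasurable)
    (fun t => hX.integrable_mul (hη.memLp t)) (hη.integral_norm_mul_le hX) hg

lemma integral_mul_integral [SFinite P] [SFinite m] (hη : IsSecondOrderProcess P M η) {X : Ω → ℝ}
    (hX : MemLp X 2 P) (hg : Integrable g m) :
    ∫ ω, X ω * (∫ t, g t * η t ω ∂m) ∂P = ∫ t, g t * ∫ ω, X ω * η t ω ∂P ∂m := by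
  have hswap := integral_integral_swap (f := fun ω t => g t * (X ω * η t ω))
    (hη.integrable_prod_mul hX hg)
  simp only [integral_const_mul] at hswap
  simp only [← hswap, mul_left_comm (g _), integral_const_mul]

lemma integrable_prod_prod [SFinite P] [SFinite m] (hη : IsSecondOrderProcess P M η)
    (hg : Integrable g m) (hh : Integrable h m) :
    Integrable (fun p : Ω × T × T => (g p.2.1 * h p.2.2) * (η p.2.1 p.1 * η p.2.2 p.1))
      (P.prod (m.prod m)) := by
  have hmeas : Measurable fun p : Ω × T × T => η p.2.1 p.1 * η p.2.2 p.1 :=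
    (hη.measurable.comp (measurable_snd.fst.prodMk measurable_fst)).mul
      (hη.measurable.comp (measurable_snd.snd.prodMk measurable_fst))
  refine integrable_prod_mul_of_integral_norm_le (ζ := fun q : T × T => fun ω => η q.1 ω * η q.2 ω)
    (M := M) hmeas.aestronglyMeasurable (fun q => (hη.memLp q.1).integrable_mul (hη.memLp q.2))
    (fun q => ?_) (hg.mul_prod hh)
  linarith [hη.integral_norm_mul_le (hη.memLp q.1) q.2, hη.integral_sq_le q.1]

variable [IsFiniteMeasure P] [SFinite m]

lemma integrable_prod (hη : IsSecondOrderProcess P M η) (hg : Integrable g m) :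
    Integrable (fun p : Ω × T => g p.2 * η p.2 p.1) (P.prod m) := by
  simpa only [one_mul] using hη.integrable_prod_mul (X := fun _ => 1) (memLp_const 1) hg

lemma ae_integrable (hη : IsSecondOrderProcess P M η) (hg : Integrable g m) :
    ∀ᵐ ω ∂P, Integrable (fun t => g t * η t ω) m :=
  (hη.integrable_prod hg).prod_right_ae

lemma integral_integral (hη : IsSecondOrderProcess P M η) (hg : Integrable g m) :
    ∫ ω, ∫ t, g t * η t ω ∂m ∂P = ∫ t, g t * ∫ ω, η t ω ∂P ∂m := by
  simpa only [one_mul] using hη.integral_mul_integral (X := fun _ => 1) (memLp_const 1) hg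

lemma memLp_integral (hη : IsSecondOrderProcess P M η) (hg : Integrable g m) :
    MemLp (fun ω => ∫ t, g t * η t ω ∂m) 2 P := by
  rw [memLp_two_iff_integrable_sq (hη.integrable_prod hg).integral_prod_left.aestronglyMeasurable]
  refine (hη.integrable_prod_prod hg hg).integral_prod_left.congr (.of_forall fun ω => ?_)
  simp only [mul_mul_mul_comm (g _), pow_two,
    integral_prod_mul (fun t => g t * η t ω) (fun t => g t * η t ω)]

lemma integral_integral_mul_integral (hη : IsSecondOrderProcess P M η) (hg : Integrable g m)
    (hh : Integrable h m) :
    ∫ ω, (∫ t, g t * η t ω ∂m) * (∫ t, h t * η t ω ∂m) ∂P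
      = ∫ q : T × T, (g q.1 * h q.2) * ∫ ω, η q.1 ω * η q.2 ω ∂P ∂m.prod m := by
  have hswap := integral_integral_swap (f := fun ω (q : T × T) =>
    (g q.1 * h q.2) * (η q.1 ω * η q.2 ω)) (hη.integrable_prod_prod hg hh)
  simp only [integral_const_mul] at hswap
  rw [← hswap]
  refine integral_congr_ae (.of_forall fun ω => ?_)
  simp only [mul_mul_mul_comm (g _),
    integral_prod_mul (fun t => g t * η t ω) (fun t => h t * η t ω)]

lemma toLp_integral_mem_closure_span (hη : IsSecondOrderProcess P M η) (hg : Integrable g m) :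
    (hη.memLp_integral hg).toLp _ ∈
      (Submodule.span ℝ (Set.range fun t => (hη.memLp t).toLp (η t))).topologicalClosure := by
  set K := Submodule.span ℝ (Set.range fun t => (hη.memLp t).toLp (η t))
  rw [← Submodule.orthogonal_orthogonal_eq_closure, Submodule.mem_orthogonal']
  intro X hX
  have hX2 : MemLp X 2 P := Lp.memLp X
  have horth (t : T) : ∫ ω, X ω * η t ω ∂P = 0 := by
    have h := (Submodule.mem_orthogonal K X).1 hX _ (Submodule.subset_span ⟨t, rfl⟩)
    rwa [← Lp.toLp_coeFn X hX2, inner_toLp_toLp] at h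
  rw [← Lp.toLp_coeFn X hX2, inner_toLp_toLp]
  simp only [conj_trivial]
  rw [hη.integral_mul_integral hX2 hg]
  simp only [horth, mul_zero, integral_zero]

lemma exists_tendsto_linearCombination (hη : IsSecondOrderProcess P M η) (hg : Integrable g m) :
    ∃ c : ℕ → T →₀ ℝ, Tendsto (fun n => eLpNorm ((fun ω => (c n).sum fun t a => a * η t ω)
      - fun ω => ∫ t, g t * η t ω ∂m) 2 P) atTop (𝓝 0) := by
  obtain ⟨x, hx, hxlim⟩ := mem_closure_iff_seq_limit.1 (hη.toLp_integral_mem_closure_span hg)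
  choose c hc using fun n => Finsupp.mem_span_range_iff_exists_finsupp.1 (hx n)
  refine ⟨c, ((Lp.tendsto_Lp_iff_tendsto_eLpNorm x _ (hη.memLp_integral hg)).1 hxlim).congr
    fun n => eLpNorm_congr_ae (EventuallyEq.sub ?_ EventuallyEq.rfl)⟩
  have hterm (t : T) : ∀ᵐ ω ∂P, (c n t • (hη.memLp t).toLp (η t) : Lp ℝ 2 P) ω = c n t * η t ω := by
    filter_upwards [Lp.coeFn_smul (c n t) ((hη.memLp t).toLp (η t)), (hη.memLp t).coeFn_toLp]
      with ω hsmul hcoe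
    rw [hsmul, Pi.smul_apply, smul_eq_mul, hcoe]
  rw [← hc n, Finsupp.sum]
  filter_upwards [Lp.coeFn_finsetSum (c n).support fun t => c n t • (hη.memLp t).toLp (η t),
    (Finset.eventually_all _).2 fun t _ => hterm t] with ω hsum hω
  rw [hsum, Finset.sum_apply]
  exact Finset.sum_congr rfl hω

end IsSecondOrderProcess

end SecondOrderProcesses

section StationaryProcesses

variable {Ω : Type*} [MeasurableSpace Ω] {P : Measure Ω} {C : ℝ → ℝ} {η : ℝ → Ω → ℝ}

/-- `η` is a measurable zero-mean Gaussian process on the line with the stationary covariance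
function `C`. -/
structure IsStationaryGaussian (P : Measure Ω) (C : ℝ → ℝ) (η : ℝ → Ω → ℝ) : Prop where
  measurable : Measurable (Function.uncurry η)
  gaussian : IsGaussianProcess η P
  mean_zero : ∀ x : ℝ, ∫ ω, η x ω ∂P = 0
  cov_eq : ∀ x y : ℝ, covariance (η x) (η y) P = C (x - y)

lemma IsCyclicInitialCondition.isStationaryGaussian {κ w : ℝ}
    (hη : IsCyclicInitialCondition P κ w η) : IsStationaryGaussian P (cyclicCov κ w) η :=
  ⟨hη.measurable, hη.gaussian, hη.mean_zero, hη.cov_eq⟩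

namespace IsStationaryGaussian

lemma memLp (hη : IsStationaryGaussian P C η) (x : ℝ) : MemLp (η x) 2 P :=
  (hη.gaussian.hasGaussianLaw_eval x).memLp_two

variable [IsProbabilityMeasure P]

lemma integral_mul (hη : IsStationaryGaussian P C η) (x y : ℝ) :
    ∫ ω, η x ω * η y ω ∂P = C (x - y) := by
  rw [← hη.cov_eq, covariance_eq_sub (hη.memLp x) (hη.memLp y), hη.mean_zero, zero_mul, sub_zero]
  rfl

lemma isSecondOrderProcess (hη : IsStationaryGaussian P C η) :
    IsSecondOrderProcess P (C 0) η where
  measurable := hη.measurable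
  memLp := hη.memLp
  integral_sq_le x := by simp only [pow_two, hη.integral_mul, sub_self, le_refl]

lemma integral_integral_eq_zero (hη : IsStationaryGaussian P C η) {g : ℝ → ℝ}
    (hg : Integrable g) : ∫ ω, (∫ y, g y * η y ω) ∂P = 0 := by
  simp only [hη.isSecondOrderProcess.integral_integral hg, hη.mean_zero, mul_zero, integral_zero]

lemma isGaussianProcess_integral (hη : IsStationaryGaussian P C η) {T : Type*} {g : T → ℝ → ℝ}
    (hg : ∀ t, Integrable (g t)) : IsGaussianProcess (fun t ω => ∫ y, g t y * η y ω) P := by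
  choose c hc using fun t => hη.isSecondOrderProcess.exists_tendsto_linearCombination (hg t)
  have hcomb (n : ℕ) : IsGaussianProcess (fun t ω => (c t n).sum fun y a => a * η y ω) P := by
    refine hη.gaussian.of_isGaussianProcess fun t => ⟨(c t n).support,
      ∑ y : (c t n).support, c t n y • ContinuousLinearMap.proj y, fun ω => ?_⟩
    rw [Finsupp.sum, ← Finset.sum_coe_sort]
    simp only [_root_.sum_apply, _root_.smul_apply, ContinuousLinearMap.proj_apply, smul_eq_mul,
      Finset.restrict]
  exact isGaussianProcess_of_tendsto_eLpNorm_two hcomb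
    (fun t => hη.isSecondOrderProcess.memLp_integral (hg t)) hc

end IsStationaryGaussian

end StationaryProcesses

section SpectralCovariance

lemma re_mul_exp_mul_conj (r s a b l : ℝ) :
    (((r : ℂ) * Complex.exp (Complex.I * a * l)) *
      (starRingEnd ℂ) ((s : ℂ) * Complex.exp (Complex.I * b * l))).re
      = r * s * Real.cos (l * (a - b)) := by
  have hexp : Complex.exp (Complex.I * a * l) * (starRingEnd ℂ) (Complex.exp (Complex.I * b * l))
      = Complex.exp (((l * (a - b) : ℝ) : ℂ) * Complex.I) := by
    rw [← Complex.exp_conj, ← Complex.exp_add]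
    simp only [map_mul, Complex.conj_ofReal, Complex.conj_I]
    congr 1
    push_cast
    ring
  rw [map_mul, Complex.conj_ofReal, mul_mul_mul_comm, hexp, ← Complex.ofReal_mul,
    Complex.re_ofReal_mul, Complex.exp_ofReal_mul_I_re]

variable {g h f : ℝ → ℝ}

lemma integrable_mul_exp (hg : Integrable g) (l : ℝ) :
    Integrable fun y : ℝ => (g y : ℂ) * Complex.exp (Complex.I * y * l) := by
  simpa only [mul_comm] using integrable_exp_mul hg l

lemma integral_prod_mul_cos_sub (hg : Integrable g) (hh : Integrable h) (l : ℝ) :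
    ∫ q : ℝ × ℝ, (g q.1 * h q.2) * Real.cos (l * (q.1 - q.2))
      = ((∫ y : ℝ, (g y : ℂ) * Complex.exp (Complex.I * y * l)) *
        (starRingEnd ℂ) (∫ y : ℝ, (h y : ℂ) * Complex.exp (Complex.I * y * l))).re := by
  have hconj : Integrable fun y : ℝ =>
      (starRingEnd ℂ) ((h y : ℂ) * Complex.exp (Complex.I * y * l)) :=
    Complex.conjLIE.toContinuousLinearEquiv.integrable_comp_iff.2 (integrable_mul_exp hh l)
  rw [← integral_conj, ← integral_prod_mul, ← RCLike.re_eq_complex_re,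
    ← integral_re ((integrable_mul_exp hg l).mul_prod hconj)]
  simp only [RCLike.re_eq_complex_re, re_mul_exp_mul_conj]
  rfl

lemma integral_prod_mul_cosTransform_sub (hg : Integrable g) (hh : Integrable h)
    (hf : Integrable f) :
    ∫ q : ℝ × ℝ, (g q.1 * h q.2) * cosTransform f (q.1 - q.2)
      = ∫ l : ℝ, ((∫ y : ℝ, (g y : ℂ) * Complex.exp (Complex.I * y * l)) *
        (starRingEnd ℂ) (∫ y : ℝ, (h y : ℂ) * Complex.exp (Complex.I * y * l))).re * f l := by
  have hint : Integrable (Function.uncurry fun (q : ℝ × ℝ) (l : ℝ) =>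
      Real.cos (l * (q.1 - q.2)) * ((g q.1 * h q.2) * f l)) ((volume.prod volume).prod volume) :=
    ((hg.mul_prod hh).mul_prod hf).bdd_mul (c := 1) (by fun_prop)
      (.of_forall fun p => Real.abs_cos_le_one _)
  calc ∫ q : ℝ × ℝ, (g q.1 * h q.2) * cosTransform f (q.1 - q.2)
      = ∫ q : ℝ × ℝ, ∫ l : ℝ, Real.cos (l * (q.1 - q.2)) * ((g q.1 * h q.2) * f l) := by
        simp only [cosTransform, ← integral_const_mul, mul_left_comm]
    _ = ∫ l : ℝ, ∫ q : ℝ × ℝ, Real.cos (l * (q.1 - q.2)) * ((g q.1 * h q.2) * f l) :=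
        integral_integral_swap hint
    _ = _ := by
        refine integral_congr_ae (.of_forall fun l => ?_)
        simp only [mul_comm (Real.cos _), mul_right_comm _ (f l), integral_mul_const,
          integral_prod_mul_cos_sub hg hh]

variable {β μ α γ t t' : ℝ}

lemma integrable_greenFunction_sub (hβ : 0 < β) (hβ' : β ≤ 1) (hμ : 0 < μ) (hα : 1 < α)
    (hγ : 0 ≤ γ) (ht : 0 < t) (x : ℝ) : Integrable fun y => greenFunction β μ α γ t (x - y) :=
  (integrable_greenFunction hβ hβ' hμ hα hγ ht).comp_sub_left x

lemma fourier_greenFunction_sub (hβ : 0 < β) (hβ' : β ≤ 1) (hμ : 0 < μ) (hα : 1 < α)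
    (hγ : 0 ≤ γ) (ht : 0 < t) (x l : ℝ) :
    ∫ y : ℝ, (greenFunction β μ α γ t (x - y) : ℂ) * Complex.exp (Complex.I * y * l)
      = (greenFourier β μ α γ t l : ℂ) * Complex.exp (Complex.I * x * l) := by
  rw [← greenFourier_neg, ← fourier_greenFunction hβ hβ' hμ hα hγ ht (-l), ← integral_mul_const,
    ← integral_sub_left_eq_self _ volume x]
  refine integral_congr_ae (.of_forall fun y => ?_)
  simp only [sub_sub_cancel, mul_assoc, ← Complex.exp_add]
  congr 2
  push_cast
  ring

variable {Ω : Type*} [MeasurableSpace Ω] {P : Measure Ω} [IsProbabilityMeasure P]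
  {η : ℝ → Ω → ℝ}

lemma integral_frbeSolution_mul (hβ : 0 < β) (hβ' : β ≤ 1) (hμ : 0 < μ) (hα : 1 < α)
    (hγ : 0 ≤ γ) (hf : Integrable f) (hη : IsStationaryGaussian P (cosTransform f) η)
    (ht : 0 < t) (ht' : 0 < t') (x x' : ℝ) :
    ∫ ω, frbeSolution β μ α γ η t x ω * frbeSolution β μ α γ η t' x' ω ∂P
      = ∫ l : ℝ, Real.cos (l * (x - x')) * greenFourier β μ α γ t l *
        greenFourier β μ α γ t' l * f l := by
  have hG := integrable_greenFunction_sub hβ hβ' hμ hα hγ ht x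
  have hG' := integrable_greenFunction_sub hβ hβ' hμ hα hγ ht' x'
  simp only [frbeSolution, hη.isSecondOrderProcess.integral_integral_mul_integral hG hG',
    hη.integral_mul]
  rw [← Measure.volume_eq_prod, integral_prod_mul_cosTransform_sub hG hG' hf]
  refine integral_congr_ae (.of_forall fun l => ?_)
  simp only [fourier_greenFunction_sub hβ hβ' hμ hα hγ ht, re_mul_exp_mul_conj,
    fourier_greenFunction_sub hβ hβ' hμ hα hγ ht']
  ring

end SpectralCovariance

section Dilations

lemma tendsto_norm_mul_one_add_rpow_neg {p : ℝ} (hp : 1 < p) :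
    Tendsto (fun l : ℝ => ‖l‖ * (1 + ‖l‖) ^ (-p)) (Bornology.cobounded ℝ) (𝓝 0) := by
  have hlim : Tendsto (fun l : ℝ => (1 + ‖l‖) ^ (-(p - 1))) (Bornology.cobounded ℝ) (𝓝 0) :=
    (tendsto_rpow_neg_atTop (sub_pos.2 hp)).comp
      (tendsto_atTop_add_const_left _ _ tendsto_norm_cobounded_atTop)
  refine squeeze_zero (fun l => by positivity) (fun l => ?_) hlim
  have hpos : 0 < 1 + ‖l‖ := by positivity
  rw [neg_sub, sub_eq_add_neg, Real.rpow_add hpos, Real.rpow_one]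
  gcongr
  linarith

lemma one_add_rpow_neg_le_one {p : ℝ} (hp : 0 ≤ p) (l : ℝ) : (1 + ‖l‖) ^ (-p) ≤ 1 :=
  Real.rpow_le_one_of_one_le_of_nonpos (by linarith [norm_nonneg l]) (by linarith)

lemma tendsto_integral_mul_one_add_rpow_neg {p : ℝ} (hp : 1 < p) {g : ℝ → ℝ} (hg : Integrable g)
    (hg0 : ContinuousAt g 0) :
    Tendsto (fun c : ℝ => ∫ l, c * (1 + ‖c * l‖) ^ (-p) * g l) atTop
      (𝓝 ((∫ l : ℝ, (1 + ‖l‖) ^ (-p)) * g 0)) := by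
  have hpos (l : ℝ) : 0 < (1 + ‖l‖) ^ (-p) := Real.rpow_pos_of_pos (by positivity) _
  have hint : Integrable fun l : ℝ => (1 + ‖l‖) ^ (-p) := integrable_one_add_norm (by simpa)
  set I := ∫ l : ℝ, (1 + ‖l‖) ^ (-p) with hI
  have hIpos : 0 < I := by
    rw [hI, integral_pos_iff_support_of_nonneg (fun l => (hpos l).le) hint,
      Set.eq_univ_of_forall fun l => Function.mem_support.2 (hpos l).ne']
    simp
  have hpeak := tendsto_integral_comp_smul_smul_of_integrable (μ := volume)
    (φ := fun l : ℝ => I⁻¹ * (1 + ‖l‖) ^ (-p))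
    (fun l => mul_nonneg (inv_nonneg.2 hIpos.le) (hpos l).le)
    (by rw [integral_const_mul, inv_mul_cancel₀ hIpos.ne'])
    (by simpa only [Module.finrank_self, pow_one, mul_left_comm _ I⁻¹, mul_zero] using
      (tendsto_norm_mul_one_add_rpow_neg hp).const_mul I⁻¹) hg hg0
  refine (hpeak.const_mul I).congr fun c => ?_
  rw [← integral_const_mul]
  simp only [Module.finrank_self, pow_one, smul_eq_mul]
  congr with l
  rw [← mul_assoc, mul_left_comm c, mul_inv_cancel_left₀ hIpos.ne']

lemma integrable_dilation_mul {Φ : ℝ → ℝ} (hΦ : Measurable Φ) {K p : ℝ} (hp : 0 ≤ p)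
    (hbound : ∀ l, |Φ l| ≤ K * (1 + ‖l‖) ^ (-p)) {g : ℝ → ℝ} (hg : Integrable g) (c : ℝ) :
    Integrable fun l => c * Φ (c * l) * g l := by
  refine hg.bdd_mul (c := |c| * |K|)
    ((hΦ.comp (measurable_const_mul c)).const_mul c).aestronglyMeasurable (.of_forall fun l => ?_)
  rw [norm_mul]
  refine mul_le_mul_of_nonneg_left ((hbound (c * l)).trans ?_) (abs_nonneg c)
  calc K * (1 + ‖c * l‖) ^ (-p) ≤ |K| * (1 + ‖c * l‖) ^ (-p) := by gcongr; exact le_abs_self K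
    _ ≤ |K| := mul_le_of_le_one_right (abs_nonneg K) (one_add_rpow_neg_le_one hp (c * l))

variable {ι : Type*} {u : Filter ι} {c : ι → ℝ} {Ψ : ι → ℝ → ℝ} {Ψ₀ : ℝ → ℝ} {p K : ℝ}

lemma tendsto_integral_dilation_mul_of_bounded [u.IsCountablyGenerated] (hc : Tendsto c u atTop)
    (hp : 1 < p) (hΨ : ∀ i, Measurable (Ψ i))
    (hbound : ∀ i l, |Ψ i l| ≤ K * (1 + ‖l‖) ^ (-p))
    (hlim : ∀ l, Tendsto (fun i => Ψ i l) u (𝓝 (Ψ₀ l))) {b : ℝ → ℝ} (hb : Measurable b) {B : ℝ}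
    (hbB : ∀ l, |b l| ≤ B) (hb0 : ContinuousAt b 0) :
    Tendsto (fun i => ∫ l, c i * Ψ i (c i * l) * b l) u (𝓝 (b 0 * ∫ l, Ψ₀ l)) := by
  have hinv (l : ℝ) : Tendsto (fun i => (c i)⁻¹ * l) u (𝓝 0) := by
    simpa only [Pi.inv_apply, zero_mul] using hc.inv_tendsto_atTop.mul_const l
  have hdom : Tendsto (fun i => ∫ l, Ψ i l * b ((c i)⁻¹ * l)) u (𝓝 (∫ l, Ψ₀ l * b 0)) := by
    refine tendsto_integral_filter_of_dominated_convergence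
      (fun l => K * (1 + ‖l‖) ^ (-p) * B) (.of_forall fun i => ((hΨ i).mul
        (hb.comp (measurable_const_mul _))).aestronglyMeasurable)
      (.of_forall fun i => .of_forall fun l => ?_)
      (((integrable_one_add_norm (by simpa)).const_mul K).mul_const B)
      (.of_forall fun l => (hlim l).mul (hb0.tendsto.comp (hinv l)))
    rw [norm_mul]
    exact mul_le_mul (hbound i l) (hbB _) (norm_nonneg _) ((abs_nonneg _).trans (hbound i l))
  rw [mul_comm, ← integral_mul_const]
  refine hdom.congr' ?_
  filter_upwards [hc.eventually_gt_atTop 0] with i hi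
  have hsubst := Measure.integral_comp_mul_left (fun v => Ψ i v * b ((c i)⁻¹ * v)) (c i)
  simp only [inv_mul_cancel_left₀ hi.ne', abs_of_pos (inv_pos.2 hi), smul_eq_mul] at hsubst
  simp only [mul_assoc, integral_const_mul, hsubst, mul_inv_cancel_left₀ hi.ne']

lemma tendsto_integral_dilation_mul_of_zero (hc : Tendsto c u atTop)
    (hp : 1 < p) (hbound : ∀ i l, |Ψ i l| ≤ K * (1 + ‖l‖) ^ (-p)) {r : ℝ → ℝ}
    (hr : Integrable r) (hr0 : ContinuousAt r 0) (hzero : r 0 = 0) :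
    Tendsto (fun i => ∫ l, c i * Ψ i (c i * l) * r l) u (𝓝 0) := by
  have hpeak := ((tendsto_integral_mul_one_add_rpow_neg hp hr.abs hr0.abs).comp hc).const_mul |K|
  rw [hzero, abs_zero, mul_zero, mul_zero] at hpeak
  refine squeeze_zero_norm' ?_ hpeak
  filter_upwards [hc.eventually_gt_atTop 0] with i hi
  have hint : Integrable fun l => c i * (1 + ‖c i * l‖) ^ (-p) * |r l| :=
    integrable_dilation_mul (Φ := fun l => (1 + ‖l‖) ^ (-p)) (K := 1) (by fun_prop)
      (zero_le_one.trans hp.le)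
      (fun l => (abs_of_nonneg (by positivity)).trans_le (one_mul _).ge) hr.abs (c i)
  rw [Function.comp_apply, ← integral_const_mul]
  refine norm_integral_le_of_norm_le (hint.const_mul |K|) (.of_forall fun l => ?_)
  have hΨ : |Ψ i (c i * l)| ≤ |K| * (1 + ‖c i * l‖) ^ (-p) :=
    (hbound i _).trans (mul_le_mul_of_nonneg_right (le_abs_self K) (by positivity))
  rw [norm_mul, norm_mul, Real.norm_of_nonneg hi.le, ← mul_assoc, mul_left_comm]
  exact mul_le_mul_of_nonneg_right (mul_le_mul_of_nonneg_left hΨ hi.le) (abs_nonneg _)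

-- Near `0` only `f 0` matters: `f` is split into `f 0` on `[-1, 1]`, where dominated convergence
-- applies after substitution, and an integrable remainder vanishing at `0`, which may be unbounded.
lemma tendsto_integral_dilation_mul [u.IsCountablyGenerated] (hc : Tendsto c u atTop)
    (hp : 1 < p) (hΨ : ∀ i, Measurable (Ψ i))
    (hbound : ∀ i l, |Ψ i l| ≤ K * (1 + ‖l‖) ^ (-p))
    (hlim : ∀ l, Tendsto (fun i => Ψ i l) u (𝓝 (Ψ₀ l))) {f : ℝ → ℝ} (hf : Integrable f)
    (hf0 : ContinuousAt f 0) :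
    Tendsto (fun i => ∫ l, c i * Ψ i (c i * l) * f l) u (𝓝 (f 0 * ∫ l, Ψ₀ l)) := by
  set b : ℝ → ℝ := (Set.Icc (-1) 1).indicator fun _ => f 0
  have hbmeas : Measurable b := measurable_const.indicator measurableSet_Icc
  have hbnear : b =ᶠ[𝓝 0] fun _ => f 0 := by
    filter_upwards [Icc_mem_nhds (by norm_num : (-1 : ℝ) < 0) one_pos] with l hl
    exact Set.indicator_of_mem hl _
  have hb0 : ContinuousAt b 0 := continuousAt_const.congr hbnear.symm
  have hbint : Integrable b :=
    (integrable_indicator_iff measurableSet_Icc).2 (integrableOn_const (by simp))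
  have hbB (l : ℝ) : |b l| ≤ |f 0| := norm_indicator_le_norm_self (fun _ => f 0) l
  have hint {g : ℝ → ℝ} (hg : Integrable g) (i : ι) :
      Integrable fun l => c i * Ψ i (c i * l) * g l :=
    integrable_dilation_mul (hΨ i) (zero_le_one.trans hp.le) (hbound i) hg (c i)
  have hsum := (tendsto_integral_dilation_mul_of_bounded hc hp hΨ hbound hlim hbmeas hbB hb0).add
    (tendsto_integral_dilation_mul_of_zero hc hp hbound (hf.sub hbint) (hf0.sub hb0)
      (sub_eq_zero.2 hbnear.eq_of_nhds.symm))
  rw [add_zero, hbnear.eq_of_nhds] at hsum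
  refine hsum.congr fun i => ?_
  rw [← integral_add (hint hbint i) (hint (hf.sub hbint) i)]
  simp only [Pi.sub_apply, mul_sub, add_sub_cancel]

end Dilations

section Scaling

lemma greenFourier_zero (β μ α t l : ℝ) :
    greenFourier β μ α 0 t l = mittagLeffler β (-(μ * t ^ β * |l| ^ α)) := by
  rw [greenFourier, frbeSymbol, zero_div, Real.rpow_zero, mul_one, mul_right_comm]

variable {β μ α γ t t' : ℝ}

lemma div_rpow_mul_abs_mul_rpow (hα : α ≠ 0) (ht : 0 ≤ t) {ε : ℝ} (hε : 0 < ε) (l : ℝ) :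
    (t / ε) ^ β * |ε ^ (β / α) * l| ^ α = t ^ β * |l| ^ α := by
  rw [Real.div_rpow ht hε.le, abs_mul, abs_of_pos (Real.rpow_pos_of_pos hε _),
    Real.mul_rpow (Real.rpow_nonneg hε.le _) (abs_nonneg l), ← Real.rpow_mul hε.le,
    div_mul_cancel₀ β hα, ← mul_assoc, div_mul_cancel₀ _ (Real.rpow_pos_of_pos hε β).ne']

lemma exists_greenFourier_div_le (hβ : 0 < β) (hβ' : β ≤ 1) (hμ : 0 < μ) (hα : 0 < α)
    (hγ : 0 ≤ γ) (ht : 0 < t) : ∃ K, ∀ ε : ℝ, 0 < ε → ∀ l,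
      greenFourier β μ α γ (t / ε) (ε ^ (β / α) * l) ≤ K * (1 + ‖l‖) ^ (-α) := by
  obtain ⟨C, hC, hdecay⟩ := exists_mul_rpow_mul_greenFourier_le hβ hβ'
  refine ⟨_, fun ε hε l => le_mul_one_add_rpow_neg hα.le
    (mul_pos hμ (Real.rpow_pos_of_pos ht β)) (norm_nonneg l) hC.le
    (greenFourier_nonneg hβ hβ' hμ.le (div_nonneg ht.le hε.le) _)
    (greenFourier_le_one hβ hβ' hμ.le (div_nonneg ht.le hε.le) _) ?_⟩
  have h := hdecay μ α γ (t / ε) (ε ^ (β / α) * l) hμ.le hγ (div_nonneg ht.le hε.le)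
  rwa [mul_assoc μ, div_rpow_mul_abs_mul_rpow hα.ne' ht.le hε, ← mul_assoc μ] at h

lemma tendsto_coe_rpow_zero {r : ℝ} (hr : 0 < r) :
    Tendsto (fun ε : Set.Ioi (0 : ℝ) => (ε : ℝ) ^ r) (comap Subtype.val (𝓝 0)) (𝓝 0) := by
  simpa only [Real.zero_rpow hr.ne', Function.comp_def] using
    ((Real.continuous_rpow_const hr.le).tendsto 0).comp
      (tendsto_comap (f := ((↑) : Set.Ioi (0 : ℝ) → ℝ)))

lemma tendsto_greenFourier_div (hβ : 0 < β) (hα : 0 < α) (ht : 0 ≤ t) (l : ℝ) :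
    Tendsto (fun ε : Set.Ioi (0 : ℝ) =>
        greenFourier β μ α γ (t / ε) ((ε : ℝ) ^ (β / α) * l))
      (comap Subtype.val (𝓝 0)) (𝓝 (greenFourier β μ α 0 t l)) := by
  have hscale (ε : Set.Ioi (0 : ℝ)) :
      greenFourier β μ α γ (t / ε) ((ε : ℝ) ^ (β / α) * l) =
        mittagLeffler β (-(μ * t ^ β * |l| ^ α *
          (1 + ((ε : ℝ) ^ (β / α) * l) ^ 2) ^ (γ / 2))) := by
    rw [greenFourier, frbeSymbol, mul_assoc μ (t ^ β), ← div_rpow_mul_abs_mul_rpow hα.ne' ht ε.2]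
    ring_nf
  have hε := tendsto_coe_rpow_zero (div_pos hβ hα)
  have hbessel : Tendsto (fun ε : Set.Ioi (0 : ℝ) =>
      (1 + ((ε : ℝ) ^ (β / α) * l) ^ 2) ^ (γ / 2)) (comap Subtype.val (𝓝 0)) (𝓝 1) := by
    simpa using (((hε.mul_const l).pow 2).const_add 1).rpow_const
      (p := γ / 2) (Or.inl (by norm_num))
  simp only [hscale, greenFourier_zero]
  simpa only [mul_one, Function.comp_def] using
    ((continuous_mittagLeffler_neg hβ).tendsto _).comp (hbessel.const_mul (μ * t ^ β * |l| ^ α))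

-- The substitution `v = l / ε^(β/α)` turns the frequency integral into a dilation of `f`, and the
-- Bessel factor `(1 + l²)^(γ/2)` disappears.
lemma tendsto_integral_cos_mul_greenFourier_div (hβ : 0 < β) (hβ' : β ≤ 1) (hμ : 0 < μ)
    (hα : 1 < α) (hγ : 0 ≤ γ) (ht : 0 < t) (ht' : 0 < t') (z : ℝ) {f : ℝ → ℝ}
    (hf : Integrable f) (hf0 : ContinuousAt f 0) :
    Tendsto (fun ε : Set.Ioi (0 : ℝ) => ((ε : ℝ) ^ (β / α))⁻¹ *
        ∫ l, Real.cos (l * (z / (ε : ℝ) ^ (β / α))) * greenFourier β μ α γ (t / ε) l *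
          greenFourier β μ α γ (t' / ε) l * f l)
      (comap Subtype.val (𝓝 0))
      (𝓝 (f 0 * ∫ l, Real.cos (l * z) * greenFourier β μ α 0 t l *
        greenFourier β μ α 0 t' l)) := by
  have hα₀ : 0 < α := zero_lt_one.trans hα
  obtain ⟨K, hK⟩ := exists_greenFourier_div_le hβ hβ' hμ hα₀ hγ ht
  set Ψ : Set.Ioi (0 : ℝ) → ℝ → ℝ := fun ε v => Real.cos (v * z) *
    greenFourier β μ α γ (t / ε) ((ε : ℝ) ^ (β / α) * v) *
    greenFourier β μ α γ (t' / ε) ((ε : ℝ) ^ (β / α) * v) with hΨ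
  have hdil : Tendsto (fun ε : Set.Ioi (0 : ℝ) => ((ε : ℝ) ^ (β / α))⁻¹)
      (comap Subtype.val (𝓝 0)) atTop :=
    (tendsto_nhdsWithin_iff.2 ⟨tendsto_coe_rpow_zero (div_pos hβ hα₀),
      .of_forall fun ε => Real.rpow_pos_of_pos ε.2 _⟩).inv_tendsto_nhdsGT_zero
  have hcont (ε : Set.Ioi (0 : ℝ)) : Continuous (Ψ ε) :=
    ((Real.continuous_cos.comp (continuous_mul_const z)).mul
      ((continuous_greenFourier hβ hα₀.le).comp (continuous_const_mul _))).mul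
      ((continuous_greenFourier hβ hα₀.le).comp (continuous_const_mul _))
  have hbound (ε : Set.Ioi (0 : ℝ)) (v : ℝ) : |Ψ ε v| ≤ K * (1 + ‖v‖) ^ (-α) := by
    have hg := greenFourier_nonneg (α := α) (γ := γ) hβ hβ' hμ.le (div_nonneg ht.le ε.2.le)
      ((ε : ℝ) ^ (β / α) * v)
    have hg' := greenFourier_nonneg (α := α) (γ := γ) hβ hβ' hμ.le (div_nonneg ht'.le ε.2.le)
      ((ε : ℝ) ^ (β / α) * v)
    refine le_trans ?_ (hK ε ε.2 v)
    rw [abs_mul, abs_mul, abs_of_nonneg hg, abs_of_nonneg hg']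
    exact (mul_le_of_le_one_right (mul_nonneg (abs_nonneg _) hg)
      (greenFourier_le_one hβ hβ' hμ.le (div_nonneg ht'.le ε.2.le) _)).trans
      (mul_le_of_le_one_left hg (Real.abs_cos_le_one _))
  refine (tendsto_integral_dilation_mul hdil hα (fun ε => (hcont ε).measurable) hbound
    (fun v => ((tendsto_greenFourier_div hβ hα₀ ht.le v).const_mul _).mul
      (tendsto_greenFourier_div hβ hα₀ ht'.le v)) hf hf0).congr fun ε => ?_
  have hε (l : ℝ) : (ε : ℝ) ^ (β / α) * (((ε : ℝ) ^ (β / α))⁻¹ * l) = l :=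
    mul_inv_cancel_left₀ (Real.rpow_pos_of_pos ε.2 _).ne' l
  simp only [hΨ, hε, mul_assoc, integral_const_mul, mul_left_comm _ _ z, div_eq_mul_inv z]
  simp only [mul_comm, mul_left_comm]

end Scaling

section WhiteNoise

lemma norm_sub_eq_norm_sub_of_inner_eq {𝕜 E F : Type*} [RCLike 𝕜] [NormedAddCommGroup E]
    [InnerProductSpace 𝕜 E] [NormedAddCommGroup F] [InnerProductSpace 𝕜 F] {x y : E} {x' y' : F}
    (hx : inner 𝕜 x x = inner 𝕜 x' x') (hxy : inner 𝕜 x y = inner 𝕜 x' y')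
    (hy : inner 𝕜 y y = inner 𝕜 y' y') : ‖x - y‖ = ‖x' - y'‖ := by
  have hsq : ‖x - y‖ ^ 2 = ‖x' - y'‖ ^ 2 := by
    simp only [norm_sub_sq (𝕜 := 𝕜), norm_sq_eq_re_inner (𝕜 := 𝕜), hx, hxy, hy]
  exact (pow_left_inj₀ (norm_nonneg _) (norm_nonneg _) two_ne_zero).1 hsq

lemma integral_sum_mul_conj_sum {X ι 𝕜 : Type*} [MeasurableSpace X] [RCLike 𝕜] {m : Measure X}
    {V V' : ι → X → 𝕜} (hV : ∀ i, MemLp (V i) 2 m) (hV' : ∀ i, MemLp (V' i) 2 m)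
    (c d : ι → 𝕜) (S T : Finset ι) :
    ∫ x, (∑ i ∈ S, c i * V i x) * (starRingEnd 𝕜) (∑ j ∈ T, d j * V' j x) ∂m =
      ∑ i ∈ S, ∑ j ∈ T, c i * (starRingEnd 𝕜) (d j) *
        ∫ x, V i x * (starRingEnd 𝕜) (V' j x) ∂m := by
  have hint (i j : ι) : Integrable (fun x => c i * (starRingEnd 𝕜) (d j) *
      (V i x * (starRingEnd 𝕜) (V' j x))) m :=
    ((hV i).integrable_mul (hV' j).star).const_mul _
  have hexpand (x : X) :
      (∑ i ∈ S, c i * V i x) * (starRingEnd 𝕜) (∑ j ∈ T, d j * V' j x) =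
        ∑ i ∈ S, ∑ j ∈ T, c i * (starRingEnd 𝕜) (d j) * (V i x * (starRingEnd 𝕜) (V' j x)) := by
    rw [map_sum, Finset.sum_mul_sum]
    refine Finset.sum_congr rfl fun i _ => Finset.sum_congr rfl fun j _ => ?_
    rw [map_mul, mul_mul_mul_comm]
  simp only [hexpand]
  rw [integral_finsetSum _ fun i _ => integrable_finsetSum _ fun j _ => hint i j]
  refine Finset.sum_congr rfl fun i _ => ?_
  rw [integral_finsetSum _ fun j _ => hint i j]
  exact Finset.sum_congr rfl fun j _ => integral_const_mul _ _

lemma integral_indicator_one_mul_conj (A B : FiniteBorel) :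
    ∫ l, A.1.indicator (fun _ => (1 : ℂ)) l * (starRingEnd ℂ) (B.1.indicator (fun _ => 1) l) =
      ((volume (A.1 ∩ B.1)).toReal : ℂ) := by
  have hinter (l : ℝ) : A.1.indicator (fun _ => (1 : ℂ)) l *
      (starRingEnd ℂ) (B.1.indicator (fun _ => 1) l) = (A.1 ∩ B.1).indicator (fun _ => 1) l := by
    by_cases hA : l ∈ A.1 <;> by_cases hB : l ∈ B.1 <;> simp [hA, hB]
  simp only [hinter]
  rw [integral_indicator (A.2.1.inter B.2.1), setIntegral_const, Complex.real_smul, mul_one,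
    Measure.real]

/-- The fibre of a square integrable simple function over a nonzero value, as an index of the white
noise. The fibre over zero may have infinite measure and does not contribute to the integral; it
is replaced by the empty set. -/
noncomputable def finiteFiber (s : SimpleFunc ℝ ℂ) (hs : MemLp s 2 volume) (z : ℂ) :
    FiniteBorel :=
  open Classical in
  if hz : z = 0 then ⟨∅, MeasurableSet.empty, by simp⟩
  else ⟨s ⁻¹' {z}, s.measurableSet_fiber z,
    SimpleFunc.measure_preimage_lt_top_of_memLp two_ne_zero ENNReal.ofNat_ne_top s hs z hz⟩

lemma finiteFiber_of_ne_zero {s : SimpleFunc ℝ ℂ} (hs : MemLp s 2 volume) {z : ℂ} (hz : z ≠ 0) :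
    (finiteFiber s hs z).1 = s ⁻¹' {z} := by
  simp only [finiteFiber, hz, dite_false]

lemma mul_finiteFiber {s : SimpleFunc ℝ ℂ} (hs : MemLp s 2 volume) (V : Set ℝ → ℂ) (z : ℂ) :
    z * V (finiteFiber s hs z).1 = z * V (s ⁻¹' {z}) := by
  by_cases hz : z = 0
  · simp only [hz, zero_mul]
  · rw [finiteFiber_of_ne_zero hs hz]

lemma simpleIntegral_eq_sum_finiteFiber {Ω : Type*} (W : Set ℝ → Ω → ℂ) {s : SimpleFunc ℝ ℂ}
    (hs : MemLp s 2 volume) (ω : Ω) :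
    simpleIntegral W s ω = ∑ z ∈ s.range, z * W (finiteFiber s hs z).1 ω :=
  Finset.sum_congr rfl fun z _ => (mul_finiteFiber hs (fun A => W A ω) z).symm

lemma simpleFunc_eq_sum_finiteFiber {s : SimpleFunc ℝ ℂ} (hs : MemLp s 2 volume) (l : ℝ) :
    s l = ∑ z ∈ s.range, z * (finiteFiber s hs z).1.indicator (fun _ => (1 : ℂ)) l := by
  simp only [fun z => mul_finiteFiber hs (fun A => A.indicator (fun _ => (1 : ℂ)) l) z]
  rw [Finset.sum_eq_single_of_mem (s l) (SimpleFunc.mem_range_self s l),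
    Set.indicator_of_mem (by exact rfl), mul_one]
  intro z _ hz
  have hl : l ∉ s ⁻¹' {z} := fun h => hz (Set.mem_singleton_iff.1 h).symm
  rw [Set.indicator_of_notMem hl, mul_zero]

variable {Ω : Type*} [MeasurableSpace Ω] {P : Measure Ω} {W : Set ℝ → Ω → ℂ}

namespace IsWhiteNoise

lemma memLp (hW : IsWhiteNoise P W) (A : FiniteBorel) : MemLp (W A.1) 2 P :=
  (hW.gaussian.hasGaussianLaw_eval A).memLp_two

lemma memLp_simpleIntegral (hW : IsWhiteNoise P W) {s : SimpleFunc ℝ ℂ}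
    (hs : MemLp s 2 volume) : MemLp (simpleIntegral W s) 2 P := by
  rw [funext (simpleIntegral_eq_sum_finiteFiber W hs)]
  exact memLp_finsetSum _ fun z _ => (hW.memLp _).const_mul z

lemma integral_simpleIntegral_mul_conj (hW : IsWhiteNoise P W) {s r : SimpleFunc ℝ ℂ}
    (hs : MemLp s 2 volume) (hr : MemLp r 2 volume) :
    ∫ ω, simpleIntegral W s ω * (starRingEnd ℂ) (simpleIntegral W r ω) ∂P =
      ∫ l, s l * (starRingEnd ℂ) (r l) := by
  have hind (A : FiniteBorel) : MemLp (A.1.indicator fun _ => (1 : ℂ)) 2 (volume : Measure ℝ) :=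
    memLp_indicator_const 2 A.2.1 1 (Or.inr A.2.2.ne)
  simp only [simpleIntegral_eq_sum_finiteFiber W hs, simpleIntegral_eq_sum_finiteFiber W hr,
    simpleFunc_eq_sum_finiteFiber hs, simpleFunc_eq_sum_finiteFiber hr]
  rw [integral_sum_mul_conj_sum (fun _ => hW.memLp _) (fun _ => hW.memLp _),
    integral_sum_mul_conj_sum (fun _ => hind _) (fun _ => hind _)]
  simp only [hW.cov_eq, integral_indicator_one_mul_conj]

lemma integral_simpleIntegral [IsProbabilityMeasure P] (hW : IsWhiteNoise P W)
    {s : SimpleFunc ℝ ℂ} (hs : MemLp s 2 volume) : ∫ ω, simpleIntegral W s ω ∂P = 0 := by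
  simp only [simpleIntegral_eq_sum_finiteFiber W hs]
  rw [integral_finsetSum _ fun z _ => ((hW.memLp _).integrable one_le_two).const_mul z]
  simp only [integral_const_mul, hW.mean_zero, mul_zero, Finset.sum_const_zero]

lemma norm_toLp_simpleIntegral_sub (hW : IsWhiteNoise P W) {s r : SimpleFunc ℝ ℂ}
    (hs : MemLp s 2 volume) (hr : MemLp r 2 volume) :
    ‖(hW.memLp_simpleIntegral hs).toLp _ - (hW.memLp_simpleIntegral hr).toLp _‖ =
      ‖hs.toLp s - hr.toLp r‖ := by
  refine norm_sub_eq_norm_sub_of_inner_eq (𝕜 := ℂ) ?_ ?_ ?_ <;>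
    simp only [inner_toLp_toLp, hW.integral_simpleIntegral_mul_conj, hs, hr]

lemma exists_isWienerIntegral (hW : IsWhiteNoise P W) {h : ℝ → ℂ} (hmeas : Measurable h)
    (hh : MemLp h 2 volume) : ∃ X, IsWienerIntegral P W h X := by
  set s : ℕ → SimpleFunc ℝ ℂ := SimpleFunc.approxOn h hmeas (Set.range h ∪ {0}) 0 (by simp)
  have hs : ∀ n, MemLp (s n) 2 volume := SimpleFunc.memLp_approxOn_range hmeas hh
  have hlim : Tendsto (fun n => eLpNorm (⇑(s n) - h) 2 volume) atTop (𝓝 0) :=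
    SimpleFunc.tendsto_approxOn_range_Lp_eLpNorm ENNReal.ofNat_ne_top hmeas hh.2
  have hcauchy :
      CauchySeq fun n => (hW.memLp_simpleIntegral (hs n)).toLp (simpleIntegral W (s n)) := by
    have hcauchy_simple :=
      ((Lp.tendsto_Lp_iff_tendsto_eLpNorm'' (fun n => ⇑(s n)) hs h hh).2 hlim).cauchySeq
    rw [Metric.cauchySeq_iff] at hcauchy_simple ⊢
    simpa only [dist_eq_norm, hW.norm_toLp_simpleIntegral_sub (hs _) (hs _)] using hcauchy_simple
  obtain ⟨X, hX⟩ := cauchySeq_tendsto_of_complete hcauchy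
  rw [← Lp.toLp_coeFn X (Lp.memLp X)] at hX
  exact ⟨X, hh, Lp.memLp X, s, hs, hlim, (Lp.tendsto_Lp_iff_tendsto_eLpNorm''
    (fun n => simpleIntegral W (s n)) (fun n => hW.memLp_simpleIntegral (hs n)) X
    (Lp.memLp X)).1 hX⟩

variable {h h' : ℝ → ℂ} {X X' : Ω → ℂ}

lemma integral_mul_conj (hW : IsWhiteNoise P W) (hX : IsWienerIntegral P W h X)
    (hX' : IsWienerIntegral P W h' X') :
    ∫ ω, X ω * (starRingEnd ℂ) (X' ω) ∂P = ∫ l, h l * (starRingEnd ℂ) (h' l) := by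
  obtain ⟨hh, hXL, s, hs, hsh, hsX⟩ := hX
  obtain ⟨hh', hXL', s', hs', hsh', hsX'⟩ := hX'
  refine tendsto_nhds_unique (tendsto_integral_mul_conj
    (fun n => hW.memLp_simpleIntegral (hs n)) hXL (fun n => hW.memLp_simpleIntegral (hs' n)) hXL'
    hsX hsX') ?_
  simpa only [hW.integral_simpleIntegral_mul_conj (hs _) (hs' _)] using
    tendsto_integral_mul_conj hs hh hs' hh' hsh hsh'

lemma ae_eq (hW : IsWhiteNoise P W) (hX : IsWienerIntegral P W h X)
    (hX' : IsWienerIntegral P W h X') : X =ᵐ[P] X' := by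
  have hnorm : ‖hX.2.1.toLp X - hX'.2.1.toLp X'‖ = ‖hX.1.toLp h - hX.1.toLp h‖ := by
    refine norm_sub_eq_norm_sub_of_inner_eq (𝕜 := ℂ) ?_ ?_ ?_
    · rw [inner_toLp_toLp, inner_toLp_toLp, hW.integral_mul_conj hX hX]
    · rw [inner_toLp_toLp, inner_toLp_toLp, hW.integral_mul_conj hX' hX]
    · rw [inner_toLp_toLp, inner_toLp_toLp, hW.integral_mul_conj hX' hX']
  rwa [sub_self, norm_zero, norm_eq_zero, sub_eq_zero, MemLp.toLp_eq_toLp_iff] at hnorm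

lemma integral_eq_zero [IsProbabilityMeasure P] (hW : IsWhiteNoise P W)
    (hX : IsWienerIntegral P W h X) : ∫ ω, X ω ∂P = 0 := by
  obtain ⟨-, hXL, s, hs, -, hsX⟩ := hX
  refine tendsto_nhds_unique (tendsto_integral_of_tendsto_eLpNorm_two
    (fun n => hW.memLp_simpleIntegral (hs n)) hXL hsX) ?_
  simp only [hW.integral_simpleIntegral (hs _), tendsto_const_nhds]

end IsWhiteNoise

/-- The simple function `l ↦ conj (s (-l))`; the symmetry of a white noise says that its integral
is the conjugate of the integral of `s`. -/
noncomputable def reflectConj (s : SimpleFunc ℝ ℂ) : SimpleFunc ℝ ℂ :=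
  (s.comp Neg.neg measurable_neg).map (starRingEnd ℂ)

lemma reflectConj_apply (s : SimpleFunc ℝ ℂ) (l : ℝ) :
    reflectConj s l = (starRingEnd ℂ) (s (-l)) := rfl

lemma range_reflectConj (s : SimpleFunc ℝ ℂ) :
    (reflectConj s).range = s.range.image (starRingEnd ℂ) := by
  ext z
  simp only [SimpleFunc.mem_range, Finset.mem_image, Set.mem_range, exists_exists_eq_and,
    reflectConj_apply]
  exact ((Equiv.neg ℝ).surjective.exists (p := fun l => (starRingEnd ℂ) (s l) = z)).symm

lemma reflectConj_preimage_conj (s : SimpleFunc ℝ ℂ) (z : ℂ) :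
    reflectConj s ⁻¹' {(starRingEnd ℂ) z} = (fun l : ℝ => -l) ⁻¹' (s ⁻¹' {z}) := by
  ext l
  simp only [Set.mem_preimage, Set.mem_singleton_iff, reflectConj_apply,
    (starRingEnd ℂ).injective.eq_iff]

namespace IsWhiteNoise

lemma simpleIntegral_reflectConj (hW : IsWhiteNoise P W) {s : SimpleFunc ℝ ℂ}
    (hs : MemLp s 2 volume) :
    simpleIntegral W (reflectConj s) =ᵐ[P] fun ω => (starRingEnd ℂ) (simpleIntegral W s ω) := by
  have hsymm : ∀ z ∈ s.range, ∀ᵐ ω ∂P, W ((fun l : ℝ => -l) ⁻¹' (finiteFiber s hs z).1) ω =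
      (starRingEnd ℂ) (W (finiteFiber s hs z).1 ω) := fun z _ => hW.symm _
  filter_upwards [(Finset.eventually_all _).2 hsymm] with ω hω
  rw [simpleIntegral_eq_sum_finiteFiber W hs, map_sum, simpleIntegral, range_reflectConj,
    Finset.sum_image (starRingEnd ℂ).injective.injOn]
  refine Finset.sum_congr rfl fun z hz => ?_
  rw [map_mul, ← hω z hz, reflectConj_preimage_conj]
  by_cases h0 : z = 0
  · simp only [h0, map_zero, zero_mul]
  · rw [finiteFiber_of_ne_zero hs h0]

lemma isWienerIntegral_reflectConj (hW : IsWhiteNoise P W) {h : ℝ → ℂ} {X : Ω → ℂ}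
    (hX : IsWienerIntegral P W h X) :
    IsWienerIntegral P W (fun l => (starRingEnd ℂ) (h (-l))) fun ω => (starRingEnd ℂ) (X ω) := by
  obtain ⟨hh, hXL, s, hs, hsh, hsX⟩ := hX
  have hneg := Measure.measurePreserving_neg (volume : Measure ℝ)
  refine ⟨(hh.comp_measurePreserving hneg).star, hXL.star, fun n => reflectConj (s n),
    fun n => ((hs n).comp_measurePreserving hneg).star, hsh.congr fun n => ?_,
    hsX.congr fun n => eLpNorm_congr_norm_ae ?_⟩
  · refine (eLpNorm_comp_measurePreserving ((hs n).sub hh).aestronglyMeasurable hneg).symm.trans ?_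
    refine eLpNorm_congr_norm_ae (.of_forall fun l => ?_)
    rw [reflectConj_apply, ← map_sub, RCLike.norm_conj]
    rfl
  · filter_upwards [hW.simpleIntegral_reflectConj (hs n)] with ω hω
    rw [hω, ← map_sub, RCLike.norm_conj]

variable {h h' : ℝ → ℂ} {X X' : Ω → ℂ}

lemma ae_re_eq (hW : IsWhiteNoise P W) (hX : IsWienerIntegral P W h X)
    (hsymm : ∀ l, h (-l) = (starRingEnd ℂ) (h l)) : ∀ᵐ ω ∂P, ((X ω).re : ℂ) = X ω := by
  have hconj := hW.isWienerIntegral_reflectConj hX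
  simp only [hsymm, Complex.conj_conj] at hconj
  filter_upwards [hW.ae_eq hX hconj] with ω hω
  exact Complex.conj_eq_iff_re.1 hω.symm

lemma integral_re_eq_zero [IsProbabilityMeasure P] (hW : IsWhiteNoise P W)
    (hX : IsWienerIntegral P W h X) : ∫ ω, (X ω).re ∂P = 0 := by
  have hre := integral_re (hX.2.1.integrable one_le_two)
  rwa [hW.integral_eq_zero hX, map_zero] at hre

lemma integral_re_mul_re (hW : IsWhiteNoise P W) (hX : IsWienerIntegral P W h X)
    (hX' : IsWienerIntegral P W h' X') (hsymm : ∀ l, h (-l) = (starRingEnd ℂ) (h l))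
    (hsymm' : ∀ l, h' (-l) = (starRingEnd ℂ) (h' l)) :
    ∫ ω, (X ω).re * (X' ω).re ∂P = (∫ l, h l * (starRingEnd ℂ) (h' l)).re := by
  rw [← hW.integral_mul_conj hX hX', ← Complex.ofReal_re (∫ ω, _ ∂P), ← integral_complex_ofReal]
  congr 1
  refine integral_congr_ae ?_
  filter_upwards [hW.ae_re_eq hX hsymm, hW.ae_re_eq hX' hsymm'] with ω hω hω'
  rw [Complex.ofReal_mul, hω, ← Complex.conj_ofReal (X' ω).re, hω']

lemma isGaussianProcess_re [IsProbabilityMeasure P] (hW : IsWhiteNoise P W) {T : Type*}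
    {h : T → ℝ → ℂ} {X : T → Ω → ℂ} (hX : ∀ p, IsWienerIntegral P W (h p) (X p)) :
    IsGaussianProcess (fun p ω => (X p ω).re) P := by
  classical
  choose s hs _ hsX using fun p => (hX p).2.2
  refine isGaussianProcess_of_tendsto_eLpNorm_two
    (X := fun n p ω => (simpleIntegral W (s p n) ω).re) (fun n => ?_)
    (fun p => (hX p).2.1.re) fun p => ?_
  · refine hW.gaussian.of_isGaussianProcess fun p => ⟨(s p n).range.image (finiteFiber _ (hs p n)),
      ∑ z : (s p n).range, Complex.reCLM ∘L (ContinuousLinearMap.mul ℝ ℂ z.1 ∘L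
        ContinuousLinearMap.proj ⟨finiteFiber _ (hs p n) z.1, Finset.mem_image_of_mem _ z.2⟩),
      fun ω => ?_⟩
    rw [simpleIntegral_eq_sum_finiteFiber W (hs p n), Complex.re_sum, ← Finset.sum_coe_sort]
    simp [Finset.restrict]
  · refine tendsto_of_tendsto_of_tendsto_of_le_of_le tendsto_const_nhds (hsX p)
      (fun _ => zero_le) fun n => eLpNorm_mono fun ω => ?_
    simp only [Pi.sub_apply, ← Complex.sub_re]
    exact Complex.abs_re_le_norm _

end IsWhiteNoise
end WhiteNoise

section GaussianConvergence

variable {Ω Ω' ι : Type*} [MeasurableSpace Ω] {P : Measure Ω} [MeasurableSpace Ω']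
  {P' : Measure Ω'}

lemma covariance_const_mul_of_integral_eq_zero [IsProbabilityMeasure P] {X Y : Ω → ℝ}
    (hX : MemLp X 2 P) (hY : MemLp Y 2 P) (hX0 : ∫ ω, X ω ∂P = 0) (c : ℝ) :
    cov[fun ω => c * X ω, fun ω => c * Y ω; P] = c * c * ∫ ω, X ω * Y ω ∂P := by
  rw [covariance_const_mul_left, covariance_const_mul_right, covariance_eq_sub hX hY, hX0,
    zero_mul, sub_zero, mul_assoc]
  rfl

lemma hasGaussianLaw_comp_of_isGaussianProcess [Finite ι] {T : Type*} {X : T → Ω → ℝ}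
    (hX : IsGaussianProcess X P) (p : ι → T) : HasGaussianLaw (fun ω i => X (p i) ω) P := by
  have := Fintype.ofFinite ι
  let L : (↥(Finset.univ : Finset ι) → ℝ) →L[ℝ] ι → ℝ :=
    ContinuousLinearMap.pi fun i => ContinuousLinearMap.proj ⟨i, Finset.mem_univ i⟩
  exact ((hX.comp_right p).hasGaussianLaw Finset.univ).map L

lemma charFun_map_toLp_of_hasGaussianLaw [Fintype ι] [IsFiniteMeasure P] {X : ι → Ω → ℝ}
    (hX : HasGaussianLaw (fun ω i => X i ω) P) (hmean : ∀ i, ∫ ω, X i ω ∂P = 0)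
    (v : EuclideanSpace ℝ ι) :
    charFun (P.map fun ω => WithLp.toLp 2 fun i => X i ω) v =
      Complex.exp (-((∑ i, ∑ j, v i * (v j * cov[X i, X j; P]) : ℝ) : ℂ) / 2) := by
  have hL2 (i : ι) : MemLp (X i) 2 P := (hX.eval i).memLp_two
  have hinner (ω : Ω) : inner ℝ v (WithLp.toLp 2 fun i => X i ω) = ∑ i, v i * X i ω := by
    simp only [PiLp.inner_apply, RCLike.inner_apply, conj_trivial, mul_comm (v _)]
  have hmean_inner : ∫ ω, ∑ i, v i * X i ω ∂P = 0 := by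
    rw [integral_finsetSum _ fun i _ => ((hL2 i).integrable one_le_two).const_mul _]
    simp only [integral_const_mul, hmean, mul_zero, Finset.sum_const_zero]
  rw [(hX.toLp_pi 2).charFun_map_eq v]
  simp only [hinner]
  rw [hmean_inner, variance_fun_sum fun i => (hL2 i).const_mul (v i)]
  simp only [covariance_const_mul_left]
  simp only [covariance_const_mul_right, Complex.ofReal_zero, zero_mul, zero_sub, neg_div]

lemma tendstoInDistribution_of_tendsto_covariance {K : Type*} [Finite ι] [IsProbabilityMeasure P]
    [IsProbabilityMeasure P'] {u : Filter K} [u.IsCountablyGenerated] {X : K → ι → Ω → ℝ}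
    {Z : ι → Ω' → ℝ} (hX : ∀ k, HasGaussianLaw (fun ω i => X k i ω) P)
    (hZ : HasGaussianLaw (fun ω i => Z i ω) P') (hXmean : ∀ k i, ∫ ω, X k i ω ∂P = 0)
    (hZmean : ∀ i, ∫ ω, Z i ω ∂P' = 0)
    (hcov : ∀ i j, Tendsto (fun k => cov[X k i, X k j; P]) u (𝓝 cov[Z i, Z j; P'])) :
    TendstoInDistribution (fun k ω i => X k i ω) u (fun ω i => Z i ω) (fun _ => P) P' := by
  have := Fintype.ofFinite ι
  have htoLp : TendstoInDistribution (fun k ω => (WithLp.toLp 2 fun i => X k i ω :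
      EuclideanSpace ℝ ι)) u (fun ω => WithLp.toLp 2 fun i => Z i ω) (fun _ => P) P' := by
    refine ⟨fun k => ((hX k).toLp_pi 2).aemeasurable, (hZ.toLp_pi 2).aemeasurable, ?_⟩
    refine tendsto_of_seq_tendsto fun k hk => ProbabilityMeasure.tendsto_iff_tendsto_charFun.2
      fun v => ?_
    rw [ProbabilityMeasure.coe_mk, charFun_map_toLp_of_hasGaussianLaw hZ hZmean]
    have hquadratic : Tendsto (fun m => ∑ i, ∑ j, v i * (v j * cov[X (k m) i, X (k m) j; P])) atTop
        (𝓝 (∑ i, ∑ j, v i * (v j * cov[Z i, Z j; P']))) :=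
      tendsto_finsetSum _ fun i _ => tendsto_finsetSum _ fun j _ =>
        (((hcov i j).comp hk).const_mul _).const_mul _
    exact (hquadratic.ofReal.neg.div_const 2).cexp.congr
      fun m => (charFun_map_toLp_of_hasGaussianLaw (hX (k m)) (hXmean (k m)) v).symm
  exact htoLp.continuous_comp (g := fun v : EuclideanSpace ℝ ι => fun i => v i) (by fun_prop)

end GaussianConvergence

section LimitField

variable {β μ α γ t t' : ℝ}

lemma integrable_cos_mul_greenFourier_mul (hβ : 0 < β) (hβ' : β ≤ 1) (hμ : 0 < μ) (hα : 1 < α)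
    (hγ : 0 ≤ γ) (ht : 0 < t) (ht' : 0 < t') (z : ℝ) :
    Integrable fun l : ℝ =>
      Real.cos (l * z) * greenFourier β μ α γ t l * greenFourier β μ α γ t' l := by
  simp only [mul_assoc]
  refine integrable_cos_mul ((integrable_greenFourier hβ hβ' hμ hα hγ ht').bdd_mul (c := 1)
    (continuous_greenFourier hβ (zero_le_one.trans hα.le)).aestronglyMeasurable
    (.of_forall fun l => ?_)) z
  rw [Real.norm_of_nonneg (greenFourier_nonneg hβ hβ' hμ.le ht.le l)]
  exact greenFourier_le_one hβ hβ' hμ.le ht.le l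

/-- The integrand `e^{ilx} E_β(-μ t^β |l|^α)` of the limit field. The second factor is the Fourier
transform of the Green function for `γ = 0`. -/
noncomputable def limitKernel (β μ α t x l : ℝ) : ℂ :=
  Complex.exp (Complex.I * l * x) * (greenFourier β μ α 0 t l : ℂ)

lemma limitKernel_neg (x l : ℝ) :
    limitKernel β μ α t x (-l) = (starRingEnd ℂ) (limitKernel β μ α t x l) := by
  simp only [limitKernel, greenFourier_neg, map_mul, Complex.conj_ofReal, ← Complex.exp_conj,
    Complex.conj_I, Complex.ofReal_neg, mul_neg, neg_mul]

lemma measurable_limitKernel (hβ : 0 < β) (hα : 0 ≤ α) (x : ℝ) :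
    Measurable (limitKernel β μ α t x) :=
  ((by fun_prop : Continuous fun l : ℝ => Complex.exp (Complex.I * l * x)).mul
    (Complex.continuous_ofReal.comp (continuous_greenFourier hβ hα))).measurable

lemma re_limitKernel_mul_conj (x x' l : ℝ) :
    (limitKernel β μ α t x l * (starRingEnd ℂ) (limitKernel β μ α t' x' l)).re =
      Real.cos (l * (x - x')) * greenFourier β μ α 0 t l * greenFourier β μ α 0 t' l := by
  rw [limitKernel, limitKernel, mul_right_comm _ _ (x : ℂ), mul_right_comm _ _ (x' : ℂ), mul_comm,
    mul_comm (Complex.exp (Complex.I * x * l)), mul_comm (Complex.exp (Complex.I * x' * l)),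
    mul_comm, re_mul_exp_mul_conj, mul_comm (_ * _), mul_assoc]

lemma memLp_limitKernel (hβ : 0 < β) (hβ' : β ≤ 1) (hμ : 0 < μ) (hα : 1 < α) (ht : 0 < t)
    (x : ℝ) : MemLp (limitKernel β μ α t x) 2 volume := by
  rw [memLp_two_iff_integrable_sq_norm
    (measurable_limitKernel hβ (zero_le_one.trans hα.le) x).aestronglyMeasurable]
  simpa only [limitKernel, norm_mul, norm_exp_I_mul_mul, one_mul, Complex.norm_real,
    Real.norm_eq_abs, sq_abs, mul_zero, Real.cos_zero, ← pow_two] using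
    integrable_cos_mul_greenFourier_mul hβ hβ' hμ hα le_rfl ht ht 0

lemma re_integral_limitKernel_mul_conj (hβ : 0 < β) (hβ' : β ≤ 1) (hμ : 0 < μ) (hα : 1 < α)
    (ht : 0 < t) (ht' : 0 < t') (x x' : ℝ) :
    (∫ l, limitKernel β μ α t x l * (starRingEnd ℂ) (limitKernel β μ α t' x' l)).re =
      ∫ l, Real.cos (l * (x - x')) * greenFourier β μ α 0 t l * greenFourier β μ α 0 t' l := by
  have hint : Integrable fun l =>
      limitKernel β μ α t x l * (starRingEnd ℂ) (limitKernel β μ α t' x' l) :=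
    (memLp_limitKernel hβ hβ' hμ hα ht x).integrable_mul
      (memLp_limitKernel hβ hβ' hμ hα ht' x').star
  rw [← RCLike.re_eq_complex_re, ← integral_re hint]
  exact integral_congr_ae (.of_forall fun l => re_limitKernel_mul_conj x x' l)

/-- The stochastic integral `∫ h(l) W(dl)`, which `IsWienerIntegral` determines up to almost sure
equality; an arbitrary random variable if the integral does not exist. -/
noncomputable def wienerIntegral {Ω : Type*} [MeasurableSpace Ω] (P : Measure Ω)
    (W : Set ℝ → Ω → ℂ) (h : ℝ → ℂ) : Ω → ℂ :=
  Classical.epsilon (IsWienerIntegral P W h)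

/-- The limit field `√c ∫ e^{ilx} E_β(-μ t^β |l|^α) W(dl)`, made real on the null set where the
integral is not. -/
noncomputable def limitField {Ω : Type*} [MeasurableSpace Ω] (P : Measure Ω)
    (W : Set ℝ → Ω → ℂ) (β μ α c t x : ℝ) (ω : Ω) : ℝ :=
  √c * (wienerIntegral P W (limitKernel β μ α t x) ω).re

variable {Ω : Type*} [MeasurableSpace Ω] {P : Measure Ω} {W : Set ℝ → Ω → ℂ}

namespace IsWhiteNoise

lemma isWienerIntegral_limitKernel (hW : IsWhiteNoise P W) (hβ : 0 < β) (hβ' : β ≤ 1)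
    (hμ : 0 < μ) (hα : 1 < α) (ht : 0 < t) (x : ℝ) :
    IsWienerIntegral P W (limitKernel β μ α t x) (wienerIntegral P W (limitKernel β μ α t x)) :=
  Classical.epsilon_spec (hW.exists_isWienerIntegral
    (measurable_limitKernel hβ (zero_le_one.trans hα.le) x)
    (memLp_limitKernel hβ hβ' hμ hα ht x))

lemma ae_limitField_eq (hW : IsWhiteNoise P W) (hβ : 0 < β) (hβ' : β ≤ 1) (hμ : 0 < μ)
    (hα : 1 < α) (ht : 0 < t) (c x : ℝ) :
    ∀ᵐ ω ∂P, (limitField P W β μ α c t x ω : ℂ) =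
      (√c : ℂ) * wienerIntegral P W (limitKernel β μ α t x) ω := by
  filter_upwards [hW.ae_re_eq (hW.isWienerIntegral_limitKernel hβ hβ' hμ hα ht x)
    (limitKernel_neg x)] with ω hω
  rw [limitField, Complex.ofReal_mul, hω]

variable [IsProbabilityMeasure P]

lemma isGaussianProcess_limitField (hW : IsWhiteNoise P W) (hβ : 0 < β) (hβ' : β ≤ 1)
    (hμ : 0 < μ) (hα : 1 < α) (c : ℝ) :
    IsGaussianProcess (fun p : Set.Ioi (0 : ℝ) × ℝ => limitField P W β μ α c p.1 p.2) P :=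
  (hW.isGaussianProcess_re fun p : Set.Ioi (0 : ℝ) × ℝ =>
    hW.isWienerIntegral_limitKernel hβ hβ' hμ hα p.1.2 p.2).smul fun _ => √c

lemma integral_limitField (hW : IsWhiteNoise P W) (hβ : 0 < β) (hβ' : β ≤ 1) (hμ : 0 < μ)
    (hα : 1 < α) (ht : 0 < t) (c x : ℝ) : ∫ ω, limitField P W β μ α c t x ω ∂P = 0 := by
  simp only [limitField, integral_const_mul,
    hW.integral_re_eq_zero (hW.isWienerIntegral_limitKernel hβ hβ' hμ hα ht x), mul_zero]

lemma covariance_limitField (hW : IsWhiteNoise P W) (hβ : 0 < β) (hβ' : β ≤ 1) (hμ : 0 < μ)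
    (hα : 1 < α) {c : ℝ} (hc : 0 ≤ c) (ht : 0 < t) (ht' : 0 < t') (x x' : ℝ) :
    cov[limitField P W β μ α c t x, limitField P W β μ α c t' x'; P] =
      c * ∫ l, Real.cos (l * (x - x')) * greenFourier β μ α 0 t l * greenFourier β μ α 0 t' l := by
  have hJ := hW.isWienerIntegral_limitKernel hβ hβ' hμ hα ht x
  have hJ' := hW.isWienerIntegral_limitKernel hβ hβ' hμ hα ht' x'
  refine (covariance_const_mul_of_integral_eq_zero hJ.2.1.re hJ'.2.1.re
    (hW.integral_re_eq_zero hJ) √c).trans ?_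
  rw [Real.mul_self_sqrt hc, ← re_integral_limitKernel_mul_conj hβ hβ' hμ hα ht ht',
    ← hW.integral_re_mul_re hJ hJ' (limitKernel_neg x) (limitKernel_neg x')]
  rfl

end IsWhiteNoise
end LimitField

section RescaledSolution

variable {β μ α γ ε t t' : ℝ} {C f : ℝ → ℝ} {Ω : Type*} [MeasurableSpace Ω] {P : Measure Ω}
  [IsProbabilityMeasure P] {η : ℝ → Ω → ℝ}

lemma isGaussianProcess_rescaledSolution (hβ : 0 < β) (hβ' : β ≤ 1) (hμ : 0 < μ) (hα : 1 < α)
    (hγ : 0 ≤ γ) (hη : IsStationaryGaussian P C η) (hε : 0 < ε) :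
    IsGaussianProcess (fun p : Set.Ioi (0 : ℝ) × ℝ => rescaledSolution β μ α γ η ε p.1 p.2) P :=
  (hη.isGaussianProcess_integral fun p : Set.Ioi (0 : ℝ) × ℝ =>
    integrable_greenFunction_sub hβ hβ' hμ hα hγ (div_pos p.1.2 hε) (p.2 / ε ^ (β / α))).smul
      fun _ => (ε ^ (β / (2 * α)))⁻¹

lemma integral_frbeSolution (hβ : 0 < β) (hβ' : β ≤ 1) (hμ : 0 < μ) (hα : 1 < α) (hγ : 0 ≤ γ)
    (hη : IsStationaryGaussian P C η) (ht : 0 < t) (x : ℝ) :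
    ∫ ω, frbeSolution β μ α γ η t x ω ∂P = 0 :=
  hη.integral_integral_eq_zero (integrable_greenFunction_sub hβ hβ' hμ hα hγ ht x)

lemma integral_rescaledSolution (hβ : 0 < β) (hβ' : β ≤ 1) (hμ : 0 < μ) (hα : 1 < α)
    (hγ : 0 ≤ γ) (hη : IsStationaryGaussian P C η) (hε : 0 < ε) (ht : 0 < t) (x : ℝ) :
    ∫ ω, rescaledSolution β μ α γ η ε t x ω ∂P = 0 := by
  simp only [rescaledSolution, integral_const_mul,
    integral_frbeSolution hβ hβ' hμ hα hγ hη (div_pos ht hε), mul_zero]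

lemma covariance_rescaledSolution (hβ : 0 < β) (hβ' : β ≤ 1) (hμ : 0 < μ) (hα : 1 < α)
    (hγ : 0 ≤ γ) (hf : Integrable f) (hη : IsStationaryGaussian P (cosTransform f) η)
    (hε : 0 < ε) (ht : 0 < t) (ht' : 0 < t') (x x' : ℝ) :
    cov[rescaledSolution β μ α γ η ε t x, rescaledSolution β μ α γ η ε t' x'; P] =
      (ε ^ (β / α))⁻¹ * ∫ l : ℝ, Real.cos (l * ((x - x') / ε ^ (β / α))) *
        greenFourier β μ α γ (t / ε) l * greenFourier β μ α γ (t' / ε) l * f l := by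
  have htε := div_pos ht hε
  have htε' := div_pos ht' hε
  have hscale : (ε ^ (β / (2 * α)))⁻¹ * (ε ^ (β / (2 * α)))⁻¹ = (ε ^ (β / α))⁻¹ := by
    rw [← mul_inv, ← Real.rpow_add hε, ← div_div, div_right_comm, add_halves]
  have hL2 {s : ℝ} (hs : 0 < s) (y : ℝ) : MemLp (frbeSolution β μ α γ η s y) 2 P :=
    hη.isSecondOrderProcess.memLp_integral (integrable_greenFunction_sub hβ hβ' hμ hα hγ hs y)
  refine (covariance_const_mul_of_integral_eq_zero (hL2 htε _) (hL2 htε' _)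
    (integral_frbeSolution hβ hβ' hμ hα hγ hη htε _) _).trans ?_
  rw [hscale, integral_frbeSolution_mul hβ hβ' hμ hα hγ hf hη htε htε', sub_div]

variable {Ω' : Type*} [MeasurableSpace Ω'] {P' : Measure Ω'} [IsProbabilityMeasure P']
  {W : Set ℝ → Ω' → ℂ}

lemma tendstoInDistribution_rescaledSolution (hβ : 0 < β) (hβ' : β ≤ 1) (hμ : 0 < μ) (hα : 1 < α)
    (hγ : 0 ≤ γ) (hf : Integrable f) (hf0 : ContinuousAt f 0) (hf0' : 0 ≤ f 0)
    (hη : IsStationaryGaussian P (cosTransform f) η) (hW : IsWhiteNoise P' W) {ι : Type*}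
    [Finite ι] (p : ι → Set.Ioi (0 : ℝ) × ℝ) :
    TendstoInDistribution
      (fun (ε : Set.Ioi (0 : ℝ)) ω i => rescaledSolution β μ α γ η ε (p i).1 (p i).2 ω)
      (comap Subtype.val (𝓝 (0 : ℝ)))
      (fun ω i => limitField P' W β μ α (f 0) (p i).1 (p i).2 ω) (fun _ => P) P' := by
  refine tendstoInDistribution_of_tendsto_covariance
    (X := fun (ε : Set.Ioi (0 : ℝ)) i => rescaledSolution β μ α γ η ε (p i).1 (p i).2)
    (Z := fun i => limitField P' W β μ α (f 0) (p i).1 (p i).2)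
    (fun ε => hasGaussianLaw_comp_of_isGaussianProcess
      (isGaussianProcess_rescaledSolution hβ hβ' hμ hα hγ hη ε.2) p)
    (hasGaussianLaw_comp_of_isGaussianProcess
      (hW.isGaussianProcess_limitField hβ hβ' hμ hα (f 0)) p)
    (fun ε i => integral_rescaledSolution hβ hβ' hμ hα hγ hη ε.2 (p i).1.2 _)
    (fun i => hW.integral_limitField hβ hβ' hμ hα (p i).1.2 _ _) fun i j => ?_
  rw [hW.covariance_limitField hβ hβ' hμ hα hf0' (p i).1.2 (p j).1.2]
  exact (tendsto_integral_cos_mul_greenFourier_div hβ hβ' hμ hα hγ (p i).1.2 (p j).1.2 _ hf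
    hf0).congr fun ε => (covariance_rescaledSolution hβ hβ' hμ hα hγ hf hη ε.2 (p i).1.2
      (p j).1.2 _ _).symm

end RescaledSolution

theorem theorem4_general
    {Ω : Type*} [MeasurableSpace Ω] (P : Measure Ω) [IsProbabilityMeasure P]
    {Ω' : Type*} [MeasurableSpace Ω'] (P' : Measure Ω') [IsProbabilityMeasure P']
    (β μ α γ : ℝ) (hβ : 0 < β) (hβ' : β ≤ 1) (hμ : 0 < μ) (hα : 1 < α) (hγ : 0 ≤ γ)
    (f : ℝ → ℝ) (hf : Integrable f) (hf0 : ContinuousAt f 0) (hf0' : 0 ≤ f 0)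
    (η : ℝ → Ω → ℝ) (hη : IsStationaryGaussian P (cosTransform f) η)
    (W : Set ℝ → Ω' → ℂ) (hW : IsWhiteNoise P' W) :
    IsGreenFunction β μ α γ (greenFunction β μ α γ) ∧
    (∀ t x : ℝ, 0 < t →
      ∀ᵐ ω ∂P, Integrable (fun y : ℝ => greenFunction β μ α γ t (x - y) * η y ω)) ∧
    ∃ U₀ : ℝ → ℝ → Ω' → ℝ,
      (∀ t x : ℝ, 0 < t → ∃ J : Ω' → ℂ,
        IsWienerIntegral P' W
          (fun l : ℝ => Complex.exp (Complex.I * l * x) *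
            (mittagLeffler β (-(μ * t ^ β * |l| ^ α)) : ℂ)) J ∧
        ∀ᵐ ω ∂P', (U₀ t x ω : ℂ) = (√(f 0) : ℂ) * J ω) ∧
      IsGaussianProcess (fun p : Set.Ioi (0 : ℝ) × ℝ => U₀ p.1 p.2) P' ∧
      (∀ t x : ℝ, 0 < t → ∫ ω, U₀ t x ω ∂P' = 0) ∧
      (∀ t x t' x' : ℝ, 0 < t → 0 < t' →
        IntegrableOn (fun l : ℝ => Real.cos (l * (x - x')) *
          mittagLeffler β (-(μ * t ^ β * |l| ^ α)) *
          mittagLeffler β (-(μ * t' ^ β * |l| ^ α))) (Set.Ioi 0) ∧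
        covariance (U₀ t x) (U₀ t' x') P' =
          2 * f 0 * ∫ l in Set.Ioi (0 : ℝ), Real.cos (l * (x - x')) *
            mittagLeffler β (-(μ * t ^ β * |l| ^ α)) *
            mittagLeffler β (-(μ * t' ^ β * |l| ^ α))) ∧
      (∀ (n : ℕ) (p : Fin n → Set.Ioi (0 : ℝ) × ℝ),
        TendstoInDistribution
          (fun (ε : Set.Ioi (0 : ℝ)) (ω : Ω) (i : Fin n) =>
            rescaledSolution β μ α γ η ε (p i).1 (p i).2 ω)
          (comap Subtype.val (𝓝 (0 : ℝ)))
          (fun (ω : Ω') (i : Fin n) => U₀ (p i).1 (p i).2 ω)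
          (fun _ => P) P') := by
  simp only [← greenFourier_zero]
  refine ⟨isGreenFunction_greenFunction hβ hβ' hμ hα hγ,
    fun t x ht => hη.isSecondOrderProcess.ae_integrable
      (integrable_greenFunction_sub hβ hβ' hμ hα hγ ht x),
    limitField P' W β μ α (f 0),
    fun t x ht => ⟨_, hW.isWienerIntegral_limitKernel hβ hβ' hμ hα ht x,
      hW.ae_limitField_eq hβ hβ' hμ hα ht (f 0) x⟩,
    hW.isGaussianProcess_limitField hβ hβ' hμ hα (f 0),
    fun t x ht => hW.integral_limitField hβ hβ' hμ hα ht (f 0) x,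
    fun t x t' x' ht ht' => ⟨(integrable_cos_mul_greenFourier_mul hβ hβ' hμ hα le_rfl ht ht'
      (x - x')).integrableOn, ?_⟩,
    fun _ p => tendstoInDistribution_rescaledSolution hβ hβ' hμ hα hγ hf hf0 hf0' hη hW p⟩
  rw [hW.covariance_limitField hβ hβ' hμ hα hf0' ht ht', integral_even fun l => by
    rw [neg_mul, Real.cos_neg, greenFourier_neg, greenFourier_neg], mul_left_comm, mul_assoc]

theorem theorem4
    {Ω : Type*} [MeasurableSpace Ω] (P : Measure Ω) [IsProbabilityMeasure P]
    {Ω' : Type*} [MeasurableSpace Ω'] (P' : Measure Ω') [IsProbabilityMeasure P']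
    (β μ α γ κ w : ℝ) (hβ : 0 < β) (hβ' : β ≤ 1) (hμ : 0 < μ) (hα : 1 < α) (hγ : 0 ≤ γ)
    (hκ : 0 < κ) (hκ' : κ < 1) (hw : w ≠ 0)
    (η : ℝ → Ω → ℝ) (hη : IsCyclicInitialCondition P κ w η)
    (W : Set ℝ → Ω' → ℂ) (hW : IsWhiteNoise P' W) :
    -- the solution is well defined
    IsGreenFunction β μ α γ (greenFunction β μ α γ) ∧
    (∀ t x : ℝ, 0 < t →
      ∀ᵐ ω ∂P, Integrable (fun y : ℝ => greenFunction β μ α γ t (x - y) * η y ω)) ∧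
    -- the limit field, as a stochastic integral
    ∃ U₀ : ℝ → ℝ → Ω' → ℝ,
      (∀ t x : ℝ, 0 < t → ∃ J : Ω' → ℂ,
        IsWienerIntegral P' W
          (fun l : ℝ => Complex.exp (Complex.I * l * x) *
            (mittagLeffler β (-(μ * t ^ β * |l| ^ α)) : ℂ)) J ∧
        ∀ᵐ ω ∂P', (U₀ t x ω : ℂ) = (√(limitConst κ w) : ℂ) * J ω) ∧
      -- it is a zero-mean Gaussian field
      IsGaussianProcess (fun p : Set.Ioi (0 : ℝ) × ℝ => U₀ p.1 p.2) P' ∧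
      (∀ t x : ℝ, 0 < t → ∫ ω, U₀ t x ω ∂P' = 0) ∧
      -- its covariance function
      (∀ t x t' x' : ℝ, 0 < t → 0 < t' →
        IntegrableOn (fun l : ℝ => Real.cos (l * (x - x')) *
          mittagLeffler β (-(μ * t ^ β * |l| ^ α)) *
          mittagLeffler β (-(μ * t' ^ β * |l| ^ α))) (Set.Ioi 0) ∧
        covariance (U₀ t x) (U₀ t' x') P' =
          2 * c₂ κ * (1 - theta κ |w|) / |w| ^ (1 - κ) *
            ∫ l in Set.Ioi (0 : ℝ), Real.cos (l * (x - x')) *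
              mittagLeffler β (-(μ * t ^ β * |l| ^ α)) *
              mittagLeffler β (-(μ * t' ^ β * |l| ^ α))) ∧
      -- convergence of the finite-dimensional distributions as `ε → 0+`
      (∀ (n : ℕ) (p : Fin n → Set.Ioi (0 : ℝ) × ℝ),
        TendstoInDistribution
          (fun (ε : Set.Ioi (0 : ℝ)) (ω : Ω) (i : Fin n) =>
            rescaledSolution β μ α γ η ε (p i).1 (p i).2 ω)
          (comap Subtype.val (𝓝 (0 : ℝ)))
          (fun (ω : Ω') (i : Fin n) => U₀ (p i).1 (p i).2 ω)
          (fun _ => P) P') := by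
  have hcov : cosTransform (cyclicDensity κ w) = cyclicCov κ w :=
    funext (cosTransform_cyclicDensity hκ w)
  have hconst : 2 * c₂ κ * (1 - theta κ |w|) / |w| ^ (1 - κ) = 2 * cyclicDensity κ w 0 := by
    rw [cyclicDensity_zero hκ hκ' hw, limitConst]
    ring
  rw [hconst, ← cyclicDensity_zero hκ hκ' hw]
  exact theorem4_general P P' β μ α γ hβ hβ' hμ hα hγ (cyclicDensity κ w)
    (integrable_cyclicDensity hκ w) (continuousAt_cyclicDensity hκ hw)
    (cyclicDensity_nonneg hκ.le w 0) η (hcov ▸ hη.isStationaryGaussian) W hW
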